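/- **Setting.** Let $\eta^1,\eta^2,\eta^3$ be the left-invariant coframe on $\mathbb S^3=SU(2)$ with $d\eta^1=-2\eta^2\wedge\eta^3$ and its cyclic permutations, and $e_1,e_2,e_3$ the dual frame. For a non-empty open interval $I\subset\mathbb R$ and smooth $F,C:I\to(0,\infty)$ consider on $I\times\mathbb S^3$ the $U(2)$-invariant Riemannian metric $$g=g_{F,C}=C\Big(\tfrac{1}{4F}dz^2+F(\eta^1)^2+(\eta^2)^2+(\eta^3)^2\Big),$$ and the complex structures $J^{\pm}=\mp2F\,\partial_z\otimes\eta^1\pm\frac1{2F}e_1\otimes dz-e_2\otimes\eta^3+e_3\otimes\eta^2$. "Einstein" means that the trace-free Ricci tensor vanishes, "Kähler with respect to $J$" that $J$ is smooth, $J^2=-1$, $J$ is $g$-orthogonal and $\nabla J=0$, and KE means Einstein and Kähler. Two such metrics $g$ over $I$ and $g'$ over $I'$ are called homothetic if $\Phi^*g'=\lambda g$ for some constant $\lambda>0$ and some $U(2)$-equivariant diffeomorphism $\Phi:I\times\mathbb S^3\to I'\times\mathbb S^3$ (for example $z\mapsto\pm z+t$). **1. Einstein and harmonic curvature.** Consider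 the conditions (1) $\delta W=0$; (2) $\delta\mathrm{Rm}=0$; (3) $g$ is Einstein; (4) there are constants $C_1,\dots,C_6$ with, on $I$, $$F=1+\tfrac12C_1e^{-2z}+C_2e^{-z}+C_3e^{z}+\tfrac12C_4e^{2z},\qquad C=\frac{e^{-z}}{(C_5+C_6e^{-z})^2},\qquad C_1C_5=C_2C_6,\quad C_3C_5=C_4C_6.$$ Always (4)$\Leftrightarrow$(3)$\Rightarrow$(2)$\Rightarrow$(1), and if $W\not\equiv0$ all four conditions are equivalent. Given (4), the scalar curvature is the constant $s=-24(C_2C_5^2-2C_5C_6+C_3C_6^2)$; $g$ is KE with respect to $J^+$ if and only if $C_6=0$ (and then $C_1=C_3=0$), and KE with respect to $J^-$ if and only if $C_5=0$ (and then $C_2=C_4=0$). **2. Bach-flat metrics.** The following are equivalent: $g$ is Bach-flat; after removing at most one slice $\{z=z_0\}$, $g$ is conformal to an Einstein metric; after removing at most one slice, $g$ is conformal to an Einstein metric $g_{F,K}$ by a $U(2)$-invariant conformal factor. (In particular conformally Einstein metrics are Bach-flat.) **3. Einstein metrics up to homothety: a 2-parameter family.** Put $$F_{\sigma,a,b}=1+a\big(\tfrac\sigma2e^{-2z}+e^{-z}\big)+b\big(\sigma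 e^{z}+\tfrac12e^{2z}\big),\qquad C_\sigma=\frac{e^{-z}}{(1+\sigma e^{-z})^2},$$ and call $(\sigma,a,b)$ normalised if $\sigma=\pm1$, or $\sigma=0$ and $b=\pm1$, or $\sigma=b=0$ and $a\in\{-1,0,1\}$. For all real $(\sigma,a,b)$, the metric of $(F_{\sigma,a,b},C_\sigma)$, over any interval on which both functions are finite and positive, is Einstein; such an interval exists whenever $b>0$. Every Einstein metric $g_{F,C}$ is homothetic to one with normalised parameters. If the metrics with normalised parameters $(\sigma,a,b)$ and $(\sigma',a',b')$, over some intervals, are homothetic, then $\sigma'=\sigma$ and either $(a',b')=(a,b)$, or $\sigma\neq0$ and $(a',b')=(\sigma b,\sigma a)$. **4. Ricci-flat metrics up to homothety: a 1-parameter family.** For normalised parameters, the metric of $(F_{\sigma,a,b},C_\sigma)$ is Ricci-flat if and only if $a=\sigma(2-b)$. Every Ricci-flat $g_{F,C}$ is homothetic to one of these, and for all normalised $(\sigma,\sigma(2-b),b)$ there is an interval on which the metric exists. **5. KE metrics up to homothety: a 1-parameter family.** The metrics with $\sigma=0$ are KE with respect to $J^+$, and every $g_{F,C}$ that is KE with respect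 to $J^+$ or to $J^-$ is homothetic to one with $\sigma=0$ and normalised parameters. The metric $g_{F,C}$ over $I$ is KE with respect to $J^+$ if and only if the metric of $(F(-z),C(-z))$ over $-I$ is KE with respect to $J^-$. **6. Ricci-flat Kähler metrics.** Consider the five pairs - $F=1,\ C=e^{-z}$ (the flat metric); - $F=(1-e^{z})^2,\ C=\frac{e^{z}}{(1-e^{z})^2}$ (on $z<0$, the Taub-NUT metric); - $F=(1+e^{z})^2,\ C=\frac{e^{z}}{(1+e^{z})^2}$; - $F=1-e^{-2z},\ C=e^{z}$ (the Eguchi–Hanson metric); - $F=1+e^{-2z},\ C=e^{z}$. Over every interval on which $F$ and $C$ are finite and positive (such intervals exist), each of them is Ricci-flat, and Kähler for some complex structure. Conversely, every $g_{F,C}$ that is Ricci-flat and Kähler with respect to some complex structure (whether $U(2)$-invariant or not) is homothetic to the restriction of one of the five pairs to an interval; and metrics given by two different pairs are never homothetic. The first is flat on $\mathbb R\times\mathbb S^3$. The third and the fifth have curvature singularities at finite distance: $|\mathrm{Rm}|^2\to\infty$ as $z\to+\infty$, respectively $z\to-\infty$, and $\int_0^\infty\sqrt{C/(4F)}\,dz<\infty$,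 respectively $\int_{-\infty}^0\sqrt{C/(4F)}\,dz<\infty$. -/

import Mathlib

open scoped Quaternion ContDiff

namespace U2

/-! ## The manifold and its left-invariant frame

The manifold `I × S³` is realised, through `(z, q) ↦ e ^ z * q`, as the open set of those quaternions
`x ≠ 0` with `log ‖x‖ ∈ I`; so the coordinate is `z = log ‖x‖`.  The vector fields
`E_a (x) = x * fr a` are a global frame: `E_0 = ∂/∂z`, and `E_1, E_2, E_3` are the usual left-invariant
fields on the spheres, with `[E_1, E_2] = 2 E_3` and its cyclic permutations.  The dual coframe is
`dz, η¹, η², η³`, with `dη¹ = -2 η² ∧ η³` and its cyclic permutations. -/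

/-- The basis `1, i, j, k` of the quaternions. -/
def fr : Fin 4 → ℍ[ℝ] :=
  ![⟨1, 0, 0, 0⟩, ⟨0, 1, 0, 0⟩, ⟨0, 0, 1, 0⟩, ⟨0, 0, 0, 1⟩]

/-- The coordinates of a quaternion in the basis `1, i, j, k`. -/
def co (x : ℍ[ℝ]) : Fin 4 → ℝ := ![x.re, x.imI, x.imJ, x.imK]

/-- The open set corresponding to `S × S³`. -/
def region (S : Set ℝ) : Set ℍ[ℝ] := {x | x ≠ 0 ∧ Real.log ‖x‖ ∈ S}

/-- The derivative of a function along the frame field `E_a`. -/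
noncomputable def D (a : Fin 4) (f : ℍ[ℝ] → ℝ) (x : ℍ[ℝ]) : ℝ := fderiv ℝ f x (x * fr a)

/-- The structure constants: `[E_a, E_b] = ∑ d, str a b d • E_d`. -/
noncomputable def str (a b d : Fin 4) : ℝ := co (fr a * fr b - fr b * fr a) d

/-! ## Riemannian geometry in the frame

A metric is given by the matrix of its components `g (E_a, E_b)`; these are arbitrary functions of the
point. -/

/-- Metrics, through their components in the frame. -/
abbrev Metric : Type := ℍ[ℝ] → Matrix (Fin 4) (Fin 4) ℝ

/-- Covariant tensors of rank `k`, through their components in the frame. -/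
abbrev Tensor (k : ℕ) : Type := (Fin k → Fin 4) → ℍ[ℝ] → ℝ

/-- The Koszul formula for `g (∇_{E_a} E_b, E_d)`, where `∇` is the Levi-Civita connection. -/
noncomputable def koszul (g : Metric) (a b d : Fin 4) (x : ℍ[ℝ]) : ℝ :=
  (D a (fun y => g y b d) x + D b (fun y => g y a d) x - D d (fun y => g y a b) x
    + ∑ e, (str a b e * g x e d - str a d e * g x e b - str b d e * g x e a)) / 2

/-- The connection coefficients: `∇_{E_a} E_b = ∑ d, chr g a b d • E_d`. -/
noncomputable def chr (g : Metric) (a b d : Fin 4) (x : ℍ[ℝ]) : ℝ :=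
  ∑ e, koszul g a b e x * (g x)⁻¹ e d

/-- The curvature `∇_{E_a} ∇_{E_b} E_c - ∇_{E_b} ∇_{E_a} E_c - ∇_{[E_a, E_b]} E_c`, component along
`E_d`. -/
noncomputable def riem (g : Metric) (a b c d : Fin 4) (x : ℍ[ℝ]) : ℝ :=
  D a (chr g b c d) x - D b (chr g a c d) x
    + ∑ e, (chr g b c e x * chr g a e d x - chr g a c e x * chr g b e d x
        - str a b e * chr g e c d x)

/-- The Riemann tensor as a covariant tensor, `Rm (a, b, c, d) = g (R (E_a, E_b) E_c, E_d)`. -/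
noncomputable def rm (g : Metric) : Tensor 4 := fun i x =>
  ∑ e, riem g (i 0) (i 1) (i 2) e x * g x e (i 3)

/-- The Ricci tensor. -/
noncomputable def ric (g : Metric) (b c : Fin 4) (x : ℍ[ℝ]) : ℝ := ∑ a, riem g a b c a x

/-- The scalar curvature. -/
noncomputable def scal (g : Metric) (x : ℍ[ℝ]) : ℝ := ∑ a, ∑ b, (g x)⁻¹ a b * ric g a b x

/-- The trace-free Ricci tensor (dimension four). -/
noncomputable def tfRic (g : Metric) (a b : Fin 4) (x : ℍ[ℝ]) : ℝ :=
  ric g a b x - scal g x / 4 * g x a b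

/-- The Weyl tensor (dimension four). -/
noncomputable def weyl (g : Metric) : Tensor 4 := fun i x =>
  rm g i x
    - (g x (i 0) (i 3) * ric g (i 1) (i 2) x - g x (i 0) (i 2) * ric g (i 1) (i 3) x
        + g x (i 1) (i 2) * ric g (i 0) (i 3) x - g x (i 1) (i 3) * ric g (i 0) (i 2) x) / 2
    + scal g x / 6 * (g x (i 0) (i 3) * g x (i 1) (i 2) - g x (i 0) (i 2) * g x (i 1) (i 3))

/-- The covariant derivative of a covariant tensor; the new index comes first. -/
noncomputable def covD (g : Metric) {k : ℕ} (T : Tensor k) : Tensor (k + 1) := fun i x =>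
  D (i 0) (T (Fin.tail i)) x
    - ∑ j : Fin k, ∑ d, chr g (i 0) (i j.succ) d x * T (Function.update (Fin.tail i) j d) x

/-- The divergence `δT = - tr ∇T` on the first index. -/
noncomputable def divg (g : Metric) {k : ℕ} (T : Tensor (k + 1)) : Tensor k := fun i x =>
  -∑ a, ∑ b, (g x)⁻¹ a b * covD g T (Fin.cons a (Fin.cons b i)) x

/-- The Bach tensor `∇^t ∇^s W_{sbct} + ½ Ric^{st} W_{sbct}`. -/
noncomputable def bach (g : Metric) (b c : Fin 4) (x : ℍ[ℝ]) : ℝ :=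
  ∑ s, ∑ s', ∑ t, ∑ t', (g x)⁻¹ s s' * (g x)⁻¹ t t' *
    (covD g (covD g (weyl g)) ![t', s', s, b, c, t] x
      + weyl g ![s, b, c, t] x * ric g s' t' x / 2)

/-- The squared norm of the Riemann tensor. -/
noncomputable def rmNormSq (g : Metric) (x : ℍ[ℝ]) : ℝ :=
  ∑ i : Fin 4 → Fin 4, ∑ j : Fin 4 → Fin 4, (∏ k, (g x)⁻¹ (i k) (j k)) * (rm g i x * rm g j x)

/-! ## Conditions on a metric over `S × S³` -/

/-- Flat: the Riemann tensor vanishes. -/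
def IsFlat (S : Set ℝ) (g : Metric) : Prop := ∀ x ∈ region S, ∀ i, rm g i x = 0

/-- The Weyl tensor vanishes identically. -/
def IsWeylFlat (S : Set ℝ) (g : Metric) : Prop := ∀ x ∈ region S, ∀ i, weyl g i x = 0

/-- `δW = 0`. -/
def IsHarmonicWeyl (S : Set ℝ) (g : Metric) : Prop :=
  ∀ x ∈ region S, ∀ i, divg g (weyl g) i x = 0

/-- `δRm = 0`. -/
def IsHarmonicCurvature (S : Set ℝ) (g : Metric) : Prop :=
  ∀ x ∈ region S, ∀ i, divg g (rm g) i x = 0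

/-- Einstein: the trace-free Ricci tensor vanishes. -/
def IsEinstein (S : Set ℝ) (g : Metric) : Prop := ∀ x ∈ region S, ∀ a b, tfRic g a b x = 0

/-- Ricci-flat. -/
def IsRicciFlat (S : Set ℝ) (g : Metric) : Prop := ∀ x ∈ region S, ∀ a b, ric g a b x = 0

/-- Bach-flat. -/
def IsBachFlat (S : Set ℝ) (g : Metric) : Prop := ∀ x ∈ region S, ∀ a b, bach g a b x = 0

/-- Conformal to an Einstein metric: `u • g` is Einstein for some smooth positive function `u` on the
manifold, which need not be `U(2)`-invariant. -/
def IsConformallyEinstein (S : Set ℝ) (g : Metric) : Prop :=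
  ∃ u : ℍ[ℝ] → ℝ, ContDiffOn ℝ ∞ u (region S) ∧ (∀ x ∈ region S, 0 < u x) ∧
    IsEinstein S (fun x => u x • g x)

/-- `g` is a Kähler metric with complex structure `J`: the endomorphism field `J` (with
`J E_b = ∑ a, J x a b • E_a`) is smooth, satisfies `J² = -1`, preserves `g`, and is parallel for the
Levi-Civita connection. -/
structure IsKahler (S : Set ℝ) (g : Metric) (J : ℍ[ℝ] → Matrix (Fin 4) (Fin 4) ℝ) : Prop where
  smooth : ∀ a b, ContDiffOn ℝ ∞ (fun x => J x a b) (region S)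
  sq : ∀ x ∈ region S, J x * J x = -1
  compatible : ∀ x ∈ region S, (J x).transpose * g x * J x = g x
  parallel : ∀ x ∈ region S, ∀ a b d,
    D a (fun y => J y d b) x + ∑ e, (J x e b * chr g a e d x - chr g a b e x * J x d e) = 0

/-- Kähler-Einstein with respect to the given complex structure. -/
def IsKahlerEinstein (S : Set ℝ) (g : Metric) (J : ℍ[ℝ] → Matrix (Fin 4) (Fin 4) ℝ) : Prop :=
  IsEinstein S g ∧ IsKahler S g J

/-! ## The `U(2)`-invariant metrics -/

/-- The metric `C (dz² / (4 F) + F (η¹)² + (η²)² + (η³)²)`. -/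
noncomputable def met (F C : ℝ → ℝ) : Metric := fun x =>
  let z := Real.log ‖x‖
  Matrix.diagonal ![C z / (4 * F z), C z * F z, C z, C z]

/-- `(F, C)` defines a smooth Riemannian metric over the non-empty open interval `I`. -/
structure IsData (I : Set ℝ) (F C : ℝ → ℝ) : Prop where
  isOpen : IsOpen I
  ordConnected : I.OrdConnected
  nonempty : I.Nonempty
  smooth_F : ContDiffOn ℝ ∞ F I
  smooth_C : ContDiffOn ℝ ∞ C I
  pos_F : ∀ z ∈ I, 0 < F z
  pos_C : ∀ z ∈ I, 0 < C z

/-- The complex structure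
`J_f = -2 f ∂_z ⊗ η¹ + (1 / (2 f)) E_1 ⊗ dz - E_2 ⊗ η³ + E_3 ⊗ η²`. -/
noncomputable def cstr (f : ℝ → ℝ) : ℍ[ℝ] → Matrix (Fin 4) (Fin 4) ℝ := fun x =>
  let z := Real.log ‖x‖
  !![0, -2 * f z, 0, 0;
     1 / (2 * f z), 0, 0, 0;
     0, 0, 0, -1;
     0, 0, 1, 0]

/-- The complex structure `J⁺ = J_F`. -/
noncomputable def Jplus (F : ℝ → ℝ) : ℍ[ℝ] → Matrix (Fin 4) (Fin 4) ℝ := cstr F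

/-- The complex structure `J⁻ = J_{-F}`. -/
noncomputable def Jminus (F : ℝ → ℝ) : ℍ[ℝ] → Matrix (Fin 4) (Fin 4) ℝ := cstr (fun z => -F z)

/-- The general solution of the Einstein equations, with its six constants and two relations. -/
def HasEinsteinForm (I : Set ℝ) (F C : ℝ → ℝ) (c₁ c₂ c₃ c₄ c₅ c₆ : ℝ) : Prop :=
  (∀ z ∈ I, F z = 1 + c₁ / 2 * Real.exp (-2 * z) + c₂ * Real.exp (-z)
      + c₃ * Real.exp z + c₄ / 2 * Real.exp (2 * z)) ∧
  (∀ z ∈ I, C z = Real.exp (-z) / (c₅ + c₆ * Real.exp (-z)) ^ 2) ∧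
  c₁ * c₅ - c₂ * c₆ = 0 ∧ c₃ * c₅ - c₄ * c₆ = 0

/-! ## Homothety -/

/-- The scalar product of two tangent vectors at `x`, for the metric with frame components `g`. -/
noncomputable def inner (g : Metric) (x v w : ℍ[ℝ]) : ℝ :=
  ∑ a, ∑ b, g x a b * co (x⁻¹ * v) a * co (x⁻¹ * w) b

/-- Equivariance for `U(2)`, which acts on the quaternions by left multiplication by unit quaternions
and right multiplication by unit complex numbers `cos θ + i sin θ`. -/
def IsEquivariant (S : Set ℝ) (Φ : ℍ[ℝ] → ℍ[ℝ]) : Prop :=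
  ∀ x ∈ region S, ∀ q p : ℍ[ℝ], ‖q‖ = 1 → ‖p‖ = 1 → p.imJ = 0 → p.imK = 0 →
    Φ (q * x * p) = q * Φ x * p

/-- The `U(2)`-invariant metric of `(F, C)` over `I` is homothetic to that of `(F', C')` over `I'`:
a `U(2)`-equivariant diffeomorphism pulls the second back to a positive constant multiple of the
first. -/
def Homothetic (I : Set ℝ) (F C : ℝ → ℝ) (I' : Set ℝ) (F' C' : ℝ → ℝ) : Prop :=
  ∃ (Φ Ψ : ℍ[ℝ] → ℍ[ℝ]) (l : ℝ), 0 < l ∧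
    ContDiffOn ℝ ∞ Φ (region I) ∧ ContDiffOn ℝ ∞ Ψ (region I') ∧
    Set.MapsTo Φ (region I) (region I') ∧ Set.MapsTo Ψ (region I') (region I) ∧
    Set.InvOn Ψ Φ (region I) (region I') ∧ IsEquivariant I Φ ∧
    ∀ x ∈ region I, ∀ v w : ℍ[ℝ],
      inner (met F' C') (Φ x) (fderiv ℝ Φ x v) (fderiv ℝ Φ x w) = l * inner (met F C) x v w

/-! ## Normal forms -/

/-- The function `F` of the normal form with parameters `σ, a, b`. -/
noncomputable def nfF (σ a b : ℝ) : ℝ → ℝ := fun z =>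
  1 + a * (σ / 2 * Real.exp (-2 * z) + Real.exp (-z))
    + b * (σ * Real.exp z + Real.exp (2 * z) / 2)

/-- The function `C` of the normal form with parameter `σ`. -/
noncomputable def nfC (σ : ℝ) : ℝ → ℝ := fun z =>
  Real.exp (-z) / (1 + σ * Real.exp (-z)) ^ 2

/-- Normalised parameters: `σ = ±1` with `a, b` arbitrary, or `σ = 0` with `b = ±1` and `a` arbitrary,
or `σ = b = 0` with `a ∈ {-1, 0, 1}`. -/
def IsNormalized (σ a b : ℝ) : Prop :=
  (σ = 1 ∨ σ = -1) ∨
    (σ = 0 ∧ ((b = 1 ∨ b = -1) ∨ (b = 0 ∧ (a = 1 ∨ a = 0 ∨ a = -1))))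

/-- The functions `F` of the five Ricci-flat Kähler metrics, in the order: flat, Taub-NUT, singular
Taub-NUT, Eguchi-Hanson, singular Eguchi-Hanson. -/
noncomputable def fiveF : Fin 5 → ℝ → ℝ :=
  ![fun _ => 1,
    fun z => (1 - Real.exp z) ^ 2,
    fun z => (1 + Real.exp z) ^ 2,
    fun z => 1 - Real.exp (-2 * z),
    fun z => 1 + Real.exp (-2 * z)]

/-- The functions `C` of the five Ricci-flat Kähler metrics, in the same order. -/
noncomputable def fiveC : Fin 5 → ℝ → ℝ :=
  ![fun z => Real.exp (-z),
    fun z => Real.exp z / (1 - Real.exp z) ^ 2,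
    fun z => Real.exp z / (1 + Real.exp z) ^ 2,
    fun z => Real.exp z,
    fun z => Real.exp z]

end U2

/-!
The space `I × S³` is realised as the region of all non-zero quaternions `x` with `log ‖x‖ ∈ I`, framed
by `∂_z, e₁, e₂, e₃`.  The metric is diagonal in this frame with entries depending on `z = log ‖x‖`
alone.  The frame indices form a Klein four-group under `xr`, and every bracket and every Christoffel
symbol respects this grading, so that all curvature tensors can be written down in terms of `F`, of
`h = C' / C` and of their derivatives (`riemAt_mul_gv`, `ric_met`, `weyl_met`, `bach_met`).  Each
curvature condition thereby becomes a system of ordinary differential equations in `z` (`isEinstein_iff`,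
`isHarmonicWeyl_iff`, `isHarmonicCurvature_iff`, `isBachFlat_iff`).

*Einstein and harmonic.*  The two halves of the Weyl tensor are carried by the functions `w ± 3 F'`.
If `δW = 0`, then each of these, multiplied by `√C`, is a constant times `e ^ (±3z/2)` (`weyl_halves`),
and differentiating the equations yields `F' (1 + 2 h' - h²) = 0`.  The second factor is the missing
Einstein equation; where it fails, `F'` vanishes on an interval, which forces both halves of the Weyl
tensor to vanish everywhere (`isEinstein_of_isHarmonicWeyl`).  The Einstein equations say that
`C ^ (-1/2)` is a combination of `e ^ (±z/2)`, and they express `F` by `w ± 3 F'` and `h`; this gives the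
explicit solutions (`IsEinstein.exists_form`).

*Bach-flat.*  The Bach equations involve `F` only, so they are invariant under `U(2)`-invariant conformal
changes (`isBachFlat_of_conformal`).  They consist of a linear equation, solved by exponentials, and a
quadratic one, which says that `c₁ c₄ = c₂ c₃` (`exists_form_of_bach`); this is exactly what is needed
to find constants `c₅, c₆` as in the Einstein case, and the conformal factor blows up on the at most
one slice where `c₅ + c₆ e ^ (-z) = 0`.  For the converse with an arbitrary conformal factor
`e ^ (2p)`, the equation for `e ^ (2p) g` to be Einstein is linear in `f = e ^ (-p)`; averaging `f` over
the spheres therefore gives an invariant conformal factor (`IsConformallyEinstein.exists_radial`).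

*Homotheties.*  A `U(2)`-equivariant homothety acts on `z` by `z ↦ ε z + t` with `ε = ±1`, preserves `F`
and multiplies `C` by a constant (`Homothetic.exists_affine`), and conversely each such change of the
functions is induced by a homothety (`homothetic_of_affine`).  The classification is then a matter of
normalising the constants in the explicit solutions (`HasEinsteinForm.exists_normal_form`,
`AffRel.normalized_unique`).

*Kähler.*  The structures `J^±` are parallel exactly if `h = ∓1` (`isKahler_cstr_iff`).  For an arbitrary
parallel `J` on a Ricci-flat metric, `J` commutes with the curvature operators
(`IsKahler.commute_riem`), which is impossible if both halves of the Weyl tensor are non-zero at some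
point; hence one of them vanishes (`IsKahler.weyl_halves_mul`), and among the normal forms only the five
pairs remain.  Conversely the Taub-NUT metric and its companion `F = (1 + e ^ z)²` are Kähler for a
complex structure that is not `U(2)`-invariant and turns with the axis `x⁻¹ i x`
(`exists_isKahler_of_sq`).
-/

namespace U2

/-! ### The frame and radial functions -/

theorem forall_fin_four {P : Fin 4 → Prop} : (∀ a, P a) ↔ P 0 ∧ P 1 ∧ P 2 ∧ P 3 := by
  simp [Fin.forall_fin_succ]

/-- The addition of the Klein four-group on the index set `{0, 1, 2, 3}`: up to sign, the product of
the basis quaternions `fr a` and `fr b` is `fr (xr a b)`.  The components of every `U(2)`-invariant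
tensor vanish unless the indices sum to `0` in this group. -/
def xr : Fin 4 → Fin 4 → Fin 4 :=
  ![![0, 1, 2, 3], ![1, 0, 3, 2], ![2, 3, 0, 1], ![3, 2, 1, 0]]

/-- The only structure constant `str a b (xr a b)` that can be non-zero. -/
def strc : Fin 4 → Fin 4 → ℝ :=
  ![![0, 0, 0, 0], ![0, 0, 2, -2], ![0, -2, 0, 2], ![0, 2, -2, 0]]

theorem str_eq (a b d : Fin 4) : str a b d = if d = xr a b then strc a b else 0 := by
  revert a b d
  simp only [forall_fin_four]
  simp only [str, co, xr, strc, Matrix.cons_val, Quaternion.re_sub, Quaternion.imI_sub,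
    Quaternion.imJ_sub, Quaternion.imK_sub, Quaternion.re_mul, Quaternion.imI_mul,
    Quaternion.imJ_mul, Quaternion.imK_mul]
  simp [fr]
  norm_num

/-- Smooth positive functions `F` and `C` on an open set, which need not be connected. -/
structure IsSmoothPair (S : Set ℝ) (F C : ℝ → ℝ) : Prop where
  isOpen : IsOpen S
  smooth_F : ContDiffOn ℝ ∞ F S
  smooth_C : ContDiffOn ℝ ∞ C S
  pos_F : ∀ z ∈ S, 0 < F z
  pos_C : ∀ z ∈ S, 0 < C z

theorem IsData.isSmoothPair {I : Set ℝ} {F C : ℝ → ℝ} (h : IsData I F C) : IsSmoothPair I F C :=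
  ⟨h.isOpen, h.smooth_F, h.smooth_C, h.pos_F, h.pos_C⟩

theorem log_norm_exp (z : ℝ) : Real.log ‖((Real.exp z : ℝ) : ℍ[ℝ])‖ = z := by
  rw [Quaternion.norm_coe, Real.norm_eq_abs, abs_of_pos (Real.exp_pos z), Real.log_exp]

theorem exp_mem_region {S : Set ℝ} {z : ℝ} (hz : z ∈ S) :
    ((Real.exp z : ℝ) : ℍ[ℝ]) ∈ region S := by
  refine ⟨?_, by rwa [log_norm_exp]⟩
  rw [← norm_ne_zero_iff, Quaternion.norm_coe, norm_ne_zero_iff]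
  exact (Real.exp_pos z).ne'

theorem isOpen_region {S : Set ℝ} (hS : IsOpen S) : IsOpen (region S) := by
  have hc : ContinuousOn (fun x : ℍ[ℝ] => Real.log ‖x‖) {x | x ≠ 0} :=
    ContinuousOn.log continuous_norm.continuousOn fun x hx => norm_ne_zero_iff.2 hx
  exact hc.isOpen_inter_preimage isOpen_ne hS

theorem contDiffOn_radial {S : Set ℝ} {φ : ℝ → ℝ} (hφ : ContDiffOn ℝ ∞ φ S) :
    ContDiffOn ℝ ∞ (fun x : ℍ[ℝ] => φ (Real.log ‖x‖)) (region S) := by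
  refine hφ.comp (t := S) ?_ fun x hx => hx.2
  exact ContDiffOn.log (fun x hx => (contDiffAt_norm ℝ hx.1).contDiffWithinAt)
    fun x hx => norm_ne_zero_iff.2 hx.1

theorem norm_fr (a : Fin 4) : ‖fr a‖ = 1 := by
  have h : ‖fr a‖ * ‖fr a‖ = 1 := by
    rw [← Quaternion.normSq_eq_norm_mul_self, Quaternion.normSq_def']
    revert a
    simp only [forall_fin_four]
    simp [fr]
  nlinarith [norm_nonneg (fr a)]

theorem inner_mul_fr (x : ℍ[ℝ]) (a : Fin 4) :
    Inner.inner ℝ x (x * fr a) = if a = 0 then ‖x‖ ^ 2 else 0 := by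
  rw [pow_two, ← Quaternion.normSq_eq_norm_mul_self, Quaternion.normSq_def']
  revert a
  simp only [forall_fin_four]
  simp only [Quaternion.inner_def, star_mul, Quaternion.re_mul, Quaternion.imI_mul,
    Quaternion.imJ_mul, Quaternion.imK_mul, Quaternion.re_star, Quaternion.imI_star,
    Quaternion.imJ_star, Quaternion.imK_star]
  simp [fr]
  refine ⟨by ring, by ring, by ring, by ring⟩

theorem hasFDerivAt_log_norm {x : ℍ[ℝ]} (hx : x ≠ 0) :
    HasFDerivAt (fun y : ℍ[ℝ] => Real.log ‖y‖) ((‖x‖ ^ 2)⁻¹ • innerSL ℝ x) x := by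
  have h1 := ((hasStrictFDerivAt_norm_sq x).hasFDerivAt.log
    (pow_ne_zero 2 (norm_ne_zero_iff.2 hx))).const_mul (1 / 2 : ℝ)
  refine (h1.congr_fderiv ?_).congr_of_eventuallyEq (Filter.Eventually.of_forall fun y => ?_)
  · ext v
    simp
    ring
  · simp only [Real.log_pow]
    push_cast
    ring

theorem hasFDerivAt_radial {x : ℍ[ℝ]} (hx : x ≠ 0) {φ : ℝ → ℝ} {φ' : ℝ}
    (h : HasDerivAt φ φ' (Real.log ‖x‖)) :
    HasFDerivAt (fun y : ℍ[ℝ] => φ (Real.log ‖y‖)) (φ' • (‖x‖ ^ 2)⁻¹ • innerSL ℝ x) x :=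
  h.comp_hasFDerivAt x (hasFDerivAt_log_norm hx)

theorem D_congr {f k : ℍ[ℝ] → ℝ} {x : ℍ[ℝ]} (h : f =ᶠ[nhds x] k) (a : Fin 4) :
    D a f x = D a k x := by
  rw [D, D, h.fderiv_eq]

/-- Along the frame, a function of `z = log ‖x‖` only varies in the direction `E_0 = ∂/∂z`. -/
theorem D_radial {S : Set ℝ} (hS : IsOpen S) {f : ℍ[ℝ] → ℝ} {φ : ℝ → ℝ} {φ' : ℝ} {x : ℍ[ℝ]}
    (hx : x ∈ region S) (hf : ∀ y ∈ region S, f y = φ (Real.log ‖y‖))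
    (h : HasDerivAt φ φ' (Real.log ‖x‖)) (a : Fin 4) :
    D a f x = if a = 0 then φ' else 0 := by
  have h1 : f =ᶠ[nhds x] fun y => φ (Real.log ‖y‖) := by
    filter_upwards [(isOpen_region hS).mem_nhds hx] with y hy using hf y hy
  rw [D_congr h1, D, (hasFDerivAt_radial hx.1 h).fderiv]
  have h2 : ‖x‖ ^ 2 ≠ 0 := pow_ne_zero 2 (norm_ne_zero_iff.2 hx.1)
  simp only [smul_apply, innerSL_apply_apply, inner_mul_fr, smul_eq_mul]
  split_ifs
  · rw [inv_mul_cancel₀ h2, mul_one]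
  · simp

theorem D_const (a : Fin 4) (r : ℝ) (x : ℍ[ℝ]) : D a (fun _ => r) x = 0 := by
  simp [D]

/-! ### Smooth functions of one variable on an open set -/

theorem ContDiffOn.hasDerivAt_deriv {S : Set ℝ} (hS : IsOpen S) {f : ℝ → ℝ}
    (hf : ContDiffOn ℝ ∞ f S) {z : ℝ} (hz : z ∈ S) : HasDerivAt f (deriv f z) z :=
  ((hf.differentiableOn (by simp)).differentiableAt (hS.mem_nhds hz)).hasDerivAt

theorem ContDiffOn.deriv_infty {S : Set ℝ} (hS : IsOpen S) {f : ℝ → ℝ}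
    (hf : ContDiffOn ℝ ∞ f S) : ContDiffOn ℝ ∞ (deriv f) S :=
  hf.deriv_of_isOpen hS (by simp)

/-- The logarithmic derivative of the conformal factor. -/
noncomputable def ld (C : ℝ → ℝ) : ℝ → ℝ := fun z => deriv C z / C z

theorem IsSmoothPair.smooth_ld {S : Set ℝ} {F C : ℝ → ℝ} (h : IsSmoothPair S F C) :
    ContDiffOn ℝ ∞ (ld C) S :=
  (ContDiffOn.deriv_infty h.isOpen h.smooth_C).div h.smooth_C fun z hz => (h.pos_C z hz).ne'

/-! ### The connection coefficients -/

/-- The diagonal components of `met F C`. -/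
noncomputable def gv (F C : ℝ) : Fin 4 → ℝ := ![C / (4 * F), C * F, C, C]

theorem met_apply (F C : ℝ → ℝ) (x : ℍ[ℝ]) (a b : Fin 4) :
    met F C x a b = if a = b then gv (F (Real.log ‖x‖)) (C (Real.log ‖x‖)) a else 0 := by
  simp [met, gv, Matrix.diagonal_apply]

theorem gv_pos {F C : ℝ} (hF : 0 < F) (hC : 0 < C) (a : Fin 4) : 0 < gv F C a := by
  revert a
  simp only [forall_fin_four]
  simp only [gv, Matrix.cons_val]
  refine ⟨by positivity, by positivity, hC, hC⟩

theorem met_inv_apply {F C : ℝ → ℝ} {x : ℍ[ℝ]} (hF : 0 < F (Real.log ‖x‖))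
    (hC : 0 < C (Real.log ‖x‖)) (a b : Fin 4) :
    (met F C x)⁻¹ a b =
      if a = b then (gv (F (Real.log ‖x‖)) (C (Real.log ‖x‖)) a)⁻¹ else 0 := by
  have h : (met F C x)⁻¹ =
      Matrix.diagonal fun a => (gv (F (Real.log ‖x‖)) (C (Real.log ‖x‖)) a)⁻¹ := by
    refine Matrix.inv_eq_left_inv ?_
    have : met F C x = Matrix.diagonal (gv (F (Real.log ‖x‖)) (C (Real.log ‖x‖))) := rfl
    rw [this, Matrix.diagonal_mul_diagonal, ← Matrix.diagonal_one]
    congr 1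
    funext a
    exact inv_mul_cancel₀ (gv_pos hF hC a).ne'
  rw [h, Matrix.diagonal_apply]

/-- The derivative of `gv F C` along a curve with `F' = F1` and `C' = C * h`. -/
noncomputable def dgv (F C F1 h : ℝ) : Fin 4 → ℝ :=
  ![C * (h - F1 / F) / (4 * F), C * (F1 + F * h), C * h, C * h]

theorem hasDerivAt_gv {S : Set ℝ} {F C : ℝ → ℝ} (h : IsSmoothPair S F C) {z : ℝ} (hz : z ∈ S)
    (a : Fin 4) :
    HasDerivAt (fun z => gv (F z) (C z) a) (dgv (F z) (C z) (deriv F z) (ld C z) a) z := by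
  have hF := ContDiffOn.hasDerivAt_deriv h.isOpen h.smooth_F hz
  have hC := ContDiffOn.hasDerivAt_deriv h.isOpen h.smooth_C hz
  have hF0 := (h.pos_F z hz).ne'
  have hC0 := (h.pos_C z hz).ne'
  revert a
  simp only [forall_fin_four]
  simp only [gv, dgv, ld, Matrix.cons_val]
  refine ⟨?_, ?_, ?_, ?_⟩
  · refine (hC.div (hF.const_mul 4) (by simpa using hF0)).congr_deriv ?_
    field_simp
  · refine (hC.mul hF).congr_deriv ?_
    field_simp
    ring
  · exact hC.congr_deriv (mul_div_cancel₀ _ hC0).symm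
  · exact hC.congr_deriv (mul_div_cancel₀ _ hC0).symm

/-- The connection coefficients `chr a b (xr a b)` of `met F C` as functions of the values of `F`, of
`F1 = F'` and of `h = C' / C`; the other connection coefficients vanish. -/
noncomputable def gam (F F1 h : ℝ) : Fin 4 → Fin 4 → ℝ :=
  ![![(h - F1 / F) / 2, (h + F1 / F) / 2, h / 2, h / 2],
    ![(h + F1 / F) / 2, -2 * F * (F1 + F * h), 2 - F, F - 2],
    ![h / 2, -F, -2 * F * h, 1],
    ![h / 2, F, -1, -2 * F * h]]

theorem koszul_met {S : Set ℝ} {F C : ℝ → ℝ} (h : IsSmoothPair S F C) {x : ℍ[ℝ]}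
    (hx : x ∈ region S) (a b d : Fin 4) :
    koszul (met F C) a b d x = if d = xr a b then
      gam (F (Real.log ‖x‖)) (deriv F (Real.log ‖x‖)) (ld C (Real.log ‖x‖)) a b
        * gv (F (Real.log ‖x‖)) (C (Real.log ‖x‖)) d else 0 := by
  have hD : ∀ a b d, D a (fun y => met F C y b d) x = if b = d then if a = 0 then
      dgv (F (Real.log ‖x‖)) (C (Real.log ‖x‖)) (deriv F (Real.log ‖x‖)) (ld C (Real.log ‖x‖)) b
      else 0 else 0 := by
    intro a b d
    simp only [met_apply]
    split_ifs with h1 h2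
    · rw [D_radial h.isOpen hx (fun y _ => rfl) (hasDerivAt_gv h hx.2 b), if_pos h2]
    · rw [D_radial h.isOpen hx (fun y _ => rfl) (hasDerivAt_gv h hx.2 b), if_neg h2]
    · exact D_const _ _ _
  have hF0 := (h.pos_F _ hx.2).ne'
  simp only [koszul, hD]
  simp only [str_eq, met_apply]
  generalize F (Real.log ‖x‖) = f at *
  generalize C (Real.log ‖x‖) = c at *
  generalize deriv F (Real.log ‖x‖) = f1 at *
  generalize ld C (Real.log ‖x‖) = k at *
  revert a b d
  simp only [forall_fin_four, Fin.sum_univ_four]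
  simp only [xr, gv, dgv, gam, strc, Matrix.cons_val, Fin.reduceEq, if_true, if_false]
  and_intros <;> first | (ring; done) | (field_simp; done) | (field_simp; ring)

theorem chr_met {S : Set ℝ} {F C : ℝ → ℝ} (h : IsSmoothPair S F C) {x : ℍ[ℝ]}
    (hx : x ∈ region S) (a b d : Fin 4) :
    chr (met F C) a b d x = if d = xr a b then
      gam (F (Real.log ‖x‖)) (deriv F (Real.log ‖x‖)) (ld C (Real.log ‖x‖)) a b else 0 := by
  have h1 := (gv_pos (h.pos_F _ hx.2) (h.pos_C _ hx.2) d).ne'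
  simp only [chr, met_inv_apply (h.pos_F _ hx.2) (h.pos_C _ hx.2), mul_ite, mul_zero,
    Finset.sum_ite_eq', Finset.mem_univ, if_true, koszul_met h hx]
  split_ifs
  · rw [mul_assoc, mul_inv_cancel₀ h1, mul_one]
  · simp

/-! ### Curvature -/

theorem xr_left_comm (a b c : Fin 4) : xr b (xr a c) = xr a (xr b c) := by
  revert a b c; decide

theorem xr_assoc (a b c : Fin 4) : xr (xr a b) c = xr a (xr b c) := by
  revert a b c; decide

theorem xr_self (a : Fin 4) : xr a a = 0 := by
  revert a; decide

theorem xr_zero (a : Fin 4) : xr a 0 = a := by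
  revert a; decide

/-- `gam` along the functions `F` and `C`, at the point `z`. -/
noncomputable def gamAt (F C : ℝ → ℝ) (z : ℝ) : Fin 4 → Fin 4 → ℝ :=
  gam (F z) (deriv F z) (ld C z)

/-- The derivative of `gam F F1 h` when `F' = F1`, `F1' = F2` and `h' = h1`. -/
noncomputable def dgam (F F1 F2 h1 : ℝ) (h : ℝ) : Fin 4 → Fin 4 → ℝ :=
  ![![(h1 - (F2 * F - F1 ^ 2) / F ^ 2) / 2, (h1 + (F2 * F - F1 ^ 2) / F ^ 2) / 2, h1 / 2, h1 / 2],
    ![(h1 + (F2 * F - F1 ^ 2) / F ^ 2) / 2,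
      -2 * F1 * (F1 + F * h) - 2 * F * (F2 + F1 * h + F * h1), -F1, F1],
    ![h1 / 2, -F1, -2 * F1 * h - 2 * F * h1, 0],
    ![h1 / 2, F1, 0, -2 * F1 * h - 2 * F * h1]]

/-- The derivative of `gamAt`. -/
noncomputable def dgamAt (F C : ℝ → ℝ) (z : ℝ) : Fin 4 → Fin 4 → ℝ :=
  dgam (F z) (deriv F z) (deriv (deriv F) z) (deriv (ld C) z) (ld C z)

section

variable {S : Set ℝ} {F C : ℝ → ℝ} {x : ℍ[ℝ]}

theorem hasDerivAt_gamAt (h : IsSmoothPair S F C) {z : ℝ} (hz : z ∈ S) (a b : Fin 4) :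
    HasDerivAt (fun z => gamAt F C z a b) (dgamAt F C z a b) z := by
  have hF := ContDiffOn.hasDerivAt_deriv h.isOpen h.smooth_F hz
  have hF1 := ContDiffOn.hasDerivAt_deriv h.isOpen
    (ContDiffOn.deriv_infty h.isOpen h.smooth_F) hz
  have hh := ContDiffOn.hasDerivAt_deriv h.isOpen h.smooth_ld hz
  have hq := hF1.div hF (h.pos_F z hz).ne'
  have h01 := (hh.add hq).div_const 2
  have h02 := hh.div_const 2
  have h22 := (hF.const_mul (-2)).mul hh
  revert a b
  simp only [forall_fin_four]
  simp only [gamAt, gam, dgamAt, dgam, Matrix.cons_val]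
  refine ⟨⟨?_, ?_, ?_, ?_⟩, ⟨?_, ?_, ?_, ?_⟩, ⟨?_, ?_, ?_, ?_⟩, ⟨?_, ?_, ?_, ?_⟩⟩
  · exact ((hh.sub hq).div_const 2).congr_deriv (by ring)
  · exact h01.congr_deriv (by ring)
  · exact h02
  · exact h02
  · exact h01.congr_deriv (by ring)
  · refine ((hF.const_mul (-2)).mul (hF1.add (hF.mul hh))).congr_deriv ?_
    simp only [Pi.add_apply, Pi.mul_apply]
    ring
  · exact (hF.const_sub 2)
  · exact (hF.sub_const 2)
  · exact h02
  · exact hF.neg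
  · exact h22.congr_deriv (by ring)
  · exact hasDerivAt_const _ _
  · exact h02
  · exact hF
  · exact hasDerivAt_const _ _
  · exact h22.congr_deriv (by ring)

theorem chr_met' (h : IsSmoothPair S F C) (hx : x ∈ region S) (a b d : Fin 4) :
    chr (met F C) a b d x = if d = xr a b then gamAt F C (Real.log ‖x‖) a b else 0 :=
  chr_met h hx a b d

theorem D_chr_met (h : IsSmoothPair S F C) (hx : x ∈ region S) (e a b d : Fin 4) :
    D e (chr (met F C) a b d) x =
      if d = xr a b then if e = 0 then dgamAt F C (Real.log ‖x‖) a b else 0 else 0 := by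
  by_cases hd : d = xr a b
  · rw [if_pos hd]
    refine D_radial h.isOpen hx (fun y hy => ?_) (hasDerivAt_gamAt h hx.2 a b) e
    rw [chr_met' h hy, if_pos hd]
  · rw [if_neg hd, D_radial h.isOpen hx (φ := fun _ => 0) (fun y hy => ?_) (hasDerivAt_const _ _) e,
      ite_self]
    rw [chr_met' h hy, if_neg hd]

/-- The curvature components `riem a b c (xr a (xr b c))` of `met F C`. -/
noncomputable def riemAt (F C : ℝ → ℝ) (z : ℝ) (a b c : Fin 4) : ℝ :=
  (if a = 0 then dgamAt F C z b c else 0) - (if b = 0 then dgamAt F C z a c else 0)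
    + (gamAt F C z b c * gamAt F C z a (xr b c) - gamAt F C z a c * gamAt F C z b (xr a c)
      - strc a b * gamAt F C z (xr a b) c)

theorem riem_met (h : IsSmoothPair S F C) (hx : x ∈ region S) (a b c d : Fin 4) :
    riem (met F C) a b c d x =
      if d = xr a (xr b c) then riemAt F C (Real.log ‖x‖) a b c else 0 := by
  simp only [riem, D_chr_met h hx, chr_met' h hx, str_eq, riemAt, Finset.sum_sub_distrib, ite_mul,
    zero_mul, Finset.sum_ite_eq', Finset.mem_univ, if_true]
  simp only [xr_left_comm a b c, xr_assoc]
  rcases eq_or_ne d (xr a (xr b c)) with hd | hd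
  · subst hd
    have e1 : (xr a (xr b c) = xr b c) = (a = 0) := by
      rw [eq_iff_iff]; revert a b c; decide
    have e2 : (xr a (xr b c) = xr a c) = (b = 0) := by
      rw [eq_iff_iff]; revert a b c; decide
    simp only [e1, e2, if_true]
    split_ifs <;> simp
  · have e1 : ∀ t : ℝ, (if d = xr b c then if a = 0 then t else 0 else 0) = 0 := by
      intro t
      split_ifs with h1 h2
      · exact absurd (by rw [h1, h2]; generalize xr b c = y; revert y; decide) hd
      · rfl
      · rfl
    have e2 : ∀ t : ℝ, (if d = xr a c then if b = 0 then t else 0 else 0) = 0 := by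
      intro t
      split_ifs with h1 h2
      · refine absurd ?_ hd
        rw [h1, h2]; clear * -; revert a c; decide
      · rfl
      · rfl
    simp only [e1, e2, hd, if_false]
    simp

/-- Algebraic curvature tensors with the symmetries of `met F C`: the five numbers are the components
`T₀₁₀₁`, `T₀₂₀₂ = T₀₃₀₃`, `T₁₂₁₂ = T₁₃₁₃`, `T₂₃₂₃` and `T₀₃₁₂ = T₁₂₀₃ = -T₀₂₁₃ = -T₀₁₂₃ / 2`; the
value of `cur` at `a b c` is the component with indices `a, b, c, xr a (xr b c)`. -/
def cur (p q r s m : ℝ) : Fin 4 → Fin 4 → Fin 4 → ℝ :=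
  ![![![0, 0, 0, 0], ![p, -p, -2 * m, 2 * m], ![q, -m, -q, m], ![q, m, -m, -q]],
    ![![-p, p, 2 * m, -2 * m], ![0, 0, 0, 0], ![m, r, -r, -m], ![-m, r, m, -r]],
    ![![-q, m, q, -m], ![-m, -r, r, m], ![0, 0, 0, 0], ![-2 * m, 2 * m, s, -s]],
    ![![-q, -m, m, q], ![m, -r, -m, r], ![2 * m, -2 * m, -s, s], ![0, 0, 0, 0]]]

/-- Lowering the last index of the curvature. -/
theorem riemAt_mul_gv (h : IsSmoothPair S F C) {z : ℝ} (hz : z ∈ S) (a b c : Fin 4) :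
    riemAt F C z a b c * gv (F z) (C z) (xr a (xr b c)) =
      cur (C z * (deriv (deriv F) z + deriv F z * ld C z + F z * deriv (ld C) z) / 2)
        (C z * (deriv F z * ld C z / F z + 2 * deriv (ld C) z) / 4)
        (C z * F z * (deriv F z * ld C z - F z + F z * ld C z ^ 2))
        (C z * (-4 + 3 * F z + F z * ld C z ^ 2)) (C z * deriv F z / 2) a b c := by
  have hF0 := (h.pos_F z hz).ne'
  simp only [riemAt, gamAt, dgamAt]
  generalize deriv (deriv F) z = f2
  generalize deriv F z = f1
  generalize deriv (ld C) z = k1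
  generalize ld C z = k
  generalize C z = c0
  generalize F z = f at *
  revert a b c
  simp only [forall_fin_four]
  simp only [xr, gv, gam, dgam, strc, cur, Matrix.cons_val, Fin.reduceEq, if_true, if_false]
  and_intros <;> first | (ring; done) | (field_simp; done) | (field_simp; ring)

theorem rm_met (h : IsSmoothPair S F C) (hx : x ∈ region S) (i : Fin 4 → Fin 4) :
    rm (met F C) i x = if i 3 = xr (i 0) (xr (i 1) (i 2)) then
      riemAt F C (Real.log ‖x‖) (i 0) (i 1) (i 2)
        * gv (F (Real.log ‖x‖)) (C (Real.log ‖x‖)) (i 3) else 0 := by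
  simp only [rm, riem_met h hx, met_apply, ite_mul, zero_mul, mul_ite, mul_zero,
    Finset.sum_ite_eq', Finset.mem_univ, if_true]

/-- The quotients of the components of the Ricci tensor by those of the metric, times `C`. -/
noncomputable def ricv (F F1 F2 h h1 : ℝ) : Fin 4 → ℝ :=
  ![-2 * F2 - 4 * F1 * h - 6 * F * h1,
    -2 * F2 - 4 * F1 * h + 2 * F - 2 * F * h1 - 2 * F * h ^ 2,
    4 - 2 * F1 * h - 2 * F - 2 * F * h1 - 2 * F * h ^ 2,
    4 - 2 * F1 * h - 2 * F - 2 * F * h1 - 2 * F * h ^ 2]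

/-- `ricv` along the functions `F` and `C`. -/
noncomputable def ricAt (F C : ℝ → ℝ) (z : ℝ) : Fin 4 → ℝ :=
  ricv (F z) (deriv F z) (deriv (deriv F) z) (ld C z) (deriv (ld C) z)

theorem ric_met (h : IsSmoothPair S F C) (hx : x ∈ region S) (b c : Fin 4) :
    ric (met F C) b c x = if b = c then ricAt F C (Real.log ‖x‖) b
      * gv (F (Real.log ‖x‖)) (C (Real.log ‖x‖)) b / C (Real.log ‖x‖) else 0 := by
  have hF0 := (h.pos_F _ hx.2).ne'
  have hC0 := (h.pos_C _ hx.2).ne'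
  simp only [ric, riem_met h hx]
  split_ifs with hbc
  · subst hbc
    simp only [xr_self, xr_zero, if_true]
    simp only [riemAt, gamAt, dgamAt, ricAt]
    generalize Real.log ‖x‖ = z at *
    generalize deriv (deriv F) z = f2
    generalize deriv F z = f1
    generalize deriv (ld C) z = k1
    generalize ld C z = k
    generalize C z = c0 at *
    generalize F z = f at *
    revert b
    simp only [forall_fin_four, Fin.sum_univ_four]
    simp only [xr, gv, gam, dgam, strc, ricv, Matrix.cons_val, Fin.reduceEq, if_true, if_false]
    and_intros <;> (field_simp; ring)
  · have : ∀ a : Fin 4, ¬ a = xr a (xr b c) := by revert b c; decide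
    simp [this]

/-- `C` times the scalar curvature. -/
noncomputable def scalAt (F C : ℝ → ℝ) (z : ℝ) : ℝ :=
  8 - 4 * deriv (deriv F) z - 12 * deriv F z * ld C z - 2 * F z - 12 * F z * deriv (ld C) z
    - 6 * F z * ld C z ^ 2

theorem scal_met (h : IsSmoothPair S F C) (hx : x ∈ region S) :
    scal (met F C) x = scalAt F C (Real.log ‖x‖) / C (Real.log ‖x‖) := by
  have hg := fun a => (gv_pos (h.pos_F _ hx.2) (h.pos_C _ hx.2) a).ne'
  have hC0 := (h.pos_C _ hx.2).ne'
  simp only [scal, met_inv_apply (h.pos_F _ hx.2) (h.pos_C _ hx.2), ric_met h hx, ite_mul, zero_mul,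
    Finset.sum_ite_eq, Finset.mem_univ, if_true]
  trans ∑ a, ricAt F C (Real.log ‖x‖) a / C (Real.log ‖x‖)
  · refine Finset.sum_congr rfl fun a _ => ?_
    have := hg a
    field_simp
  · simp only [Fin.sum_univ_four, ricAt, ricv, scalAt, Matrix.cons_val]
    ring

/-- `w = F'' + 2 F - 2`; together with `F'` it determines the Weyl tensor. -/
noncomputable def wv (F : ℝ → ℝ) (z : ℝ) : ℝ := deriv (deriv F) z + 2 * F z - 2

theorem weyl_met (h : IsSmoothPair S F C) (hx : x ∈ region S) (i : Fin 4 → Fin 4) :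
    weyl (met F C) i x = if i 3 = xr (i 0) (xr (i 1) (i 2)) then
      cur (C (Real.log ‖x‖) * wv F (Real.log ‖x‖) / 6)
        (-(C (Real.log ‖x‖) * wv F (Real.log ‖x‖) / F (Real.log ‖x‖) / 12))
        (-(C (Real.log ‖x‖) * F (Real.log ‖x‖) * wv F (Real.log ‖x‖) / 3))
        (2 * C (Real.log ‖x‖) * wv F (Real.log ‖x‖) / 3)
        (C (Real.log ‖x‖) * deriv F (Real.log ‖x‖) / 2) (i 0) (i 1) (i 2) else 0 := by
  have hF0 := (h.pos_F _ hx.2).ne'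
  have hC0 := (h.pos_C _ hx.2).ne'
  simp only [weyl, rm_met h hx, met_apply, ric_met h hx, scal_met h hx]
  generalize i 0 = a
  generalize i 1 = b
  generalize i 2 = c
  generalize i 3 = d
  rcases eq_or_ne d (xr a (xr b c)) with hd | hd
  · simp only [if_pos hd]
    rw [hd, riemAt_mul_gv h hx.2]
    simp only [wv, ricAt, scalAt]
    generalize Real.log ‖x‖ = z at *
    generalize deriv (deriv F) z = f2
    generalize deriv F z = f1
    generalize deriv (ld C) z = k1
    generalize ld C z = k
    generalize C z = c0 at *
    generalize F z = f at *
    clear hd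
    revert a b c
    simp only [forall_fin_four]
    simp only [xr, gv, cur, ricv, Matrix.cons_val, Fin.reduceEq, if_true, if_false]
    and_intros <;> first | (ring; done) | (field_simp; done) | (field_simp; ring)
  · have e1 : ∀ s t : ℝ, (if a = d then s else 0) * (if b = c then t else 0) = 0 := by
      intro s t
      split_ifs with h1 h2 <;> try simp
      refine absurd ?_ hd
      rw [← h1, h2]; clear * -; revert a c; decide
    have e2 : ∀ s t : ℝ, (if a = c then s else 0) * (if b = d then t else 0) = 0 := by
      intro s t
      split_ifs with h1 h2 <;> try simp
      refine absurd ?_ hd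
      rw [← h1, h2]; clear * -; revert a d; decide
    have e3 := fun s t => (mul_comm _ _).trans (e1 s t)
    have e4 := fun s t => (mul_comm _ _).trans (e2 s t)
    simp only [if_neg hd, e1, e2, e3, e4]
    simp

end

/-! ### Covariant derivatives and divergences of invariant tensors -/

section

variable {S : Set ℝ} {F C : ℝ → ℝ} {x : ℍ[ℝ]}

theorem covD_met (h : IsSmoothPair S F C) (hx : x ∈ region S) {k : ℕ} (T : Tensor k)
    (a : Fin 4) (i : Fin k → Fin 4) :
    covD (met F C) T (Fin.cons a i) x = D a (T i) x - ∑ j : Fin k,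
      gamAt F C (Real.log ‖x‖) a (i j) * T (Function.update i j (xr a (i j))) x := by
  simp only [covD, Fin.cons_zero, Fin.tail_cons, Fin.cons_succ, chr_met' h hx, ite_mul, zero_mul,
    Finset.sum_ite_eq', Finset.mem_univ, if_true]

theorem divg_met (h : IsSmoothPair S F C) (hx : x ∈ region S) {k : ℕ} (T : Tensor (k + 1))
    (i : Fin k → Fin 4) :
    divg (met F C) T i x = -∑ a, (gv (F (Real.log ‖x‖)) (C (Real.log ‖x‖)) a)⁻¹ *
      covD (met F C) T (Fin.cons a (Fin.cons a i)) x := by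
  simp only [divg, met_inv_apply (h.pos_F _ hx.2) (h.pos_C _ hx.2), ite_mul, zero_mul,
    Finset.sum_ite_eq, Finset.mem_univ, if_true]

/-- Invariant tensors: the components are smooth functions of `z = log ‖x‖`. -/
def IsRadial (S : Set ℝ) {k : ℕ} (T : Tensor k) : Prop :=
  ∀ i, ∃ φ : ℝ → ℝ, ContDiffOn ℝ ∞ φ S ∧ ∀ x ∈ region S, T i x = φ (Real.log ‖x‖)

theorem smoothOn_gamAt (h : IsSmoothPair S F C) (a b : Fin 4) :
    ContDiffOn ℝ ∞ (fun z => gamAt F C z a b) S := by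
  have hF := h.smooth_F
  have hF1 := ContDiffOn.deriv_infty h.isOpen hF
  have hh := h.smooth_ld
  revert a b
  simp only [forall_fin_four]
  simp only [gamAt, gam, Matrix.cons_val]
  have hF0 : ∀ z ∈ S, F z ≠ 0 := fun z hz => (h.pos_F z hz).ne'
  and_intros <;> fun_prop (disch := assumption)

theorem IsRadial.covD (h : IsSmoothPair S F C) {k : ℕ} {T : Tensor k} (hT : IsRadial S T) :
    IsRadial S (covD (met F C) T) := by
  choose φ hφ hTφ using hT
  intro i
  refine ⟨fun z => (if i 0 = 0 then deriv (φ (Fin.tail i)) z else 0) - ∑ j : Fin k,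
      gamAt F C z (i 0) (Fin.tail i j) * φ (Function.update (Fin.tail i) j
        (xr (i 0) (Fin.tail i j))) z, ?_, fun x hx => ?_⟩
  · refine ContDiffOn.sub ?_ (ContDiffOn.sum fun j _ => (smoothOn_gamAt h _ _).mul (hφ _))
    split_ifs
    · exact ContDiffOn.deriv_infty h.isOpen (hφ _)
    · exact contDiffOn_const
  · conv_lhs => rw [← Fin.cons_self_tail i]
    rw [covD_met h hx, D_radial h.isOpen hx (hTφ _)
      (ContDiffOn.hasDerivAt_deriv h.isOpen (hφ _) hx.2)]
    simp only [hTφ _ x hx]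

/-- The metric is parallel, so the divergence commutes with covariant derivatives. -/
theorem covD_divg (h : IsSmoothPair S F C) (hx : x ∈ region S) {k : ℕ} {T : Tensor (k + 1)}
    (hT : IsRadial S T) (t : Fin 4) (i : Fin k → Fin 4) :
    covD (met F C) (divg (met F C) T) (Fin.cons t i) x =
      -∑ s, (gv (F (Real.log ‖x‖)) (C (Real.log ‖x‖)) s)⁻¹ *
        covD (met F C) (covD (met F C) T) (Fin.cons t (Fin.cons s (Fin.cons s i))) x := by
  have hZ := hT.covD h
  generalize hZT : covD (met F C) T = Z at hZ
  choose φ hφ hZφ using hZ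
  have hg : ∀ a z, z ∈ S → gv (F z) (C z) a ≠ 0 := fun a z hz =>
    (gv_pos (h.pos_F z hz) (h.pos_C z hz) a).ne'
  rw [covD_met h hx]
  have hdiv : ∀ j, ∀ y ∈ region S, divg (met F C) T j y = (fun z =>
      -∑ a, (gv (F z) (C z) a)⁻¹ * φ (Fin.cons a (Fin.cons a j)) z) (Real.log ‖y‖) := by
    intro j y hy
    simp only [divg_met h hy, hZT, hZφ _ y hy]
  have hder : HasDerivAt (fun z => -∑ a, (gv (F z) (C z) a)⁻¹ * φ (Fin.cons a (Fin.cons a i)) z)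
      (-∑ a, (-dgv (F (Real.log ‖x‖)) (C (Real.log ‖x‖)) (deriv F (Real.log ‖x‖))
          (ld C (Real.log ‖x‖)) a / gv (F (Real.log ‖x‖)) (C (Real.log ‖x‖)) a ^ 2
          * φ (Fin.cons a (Fin.cons a i)) (Real.log ‖x‖)
        + (gv (F (Real.log ‖x‖)) (C (Real.log ‖x‖)) a)⁻¹
          * deriv (φ (Fin.cons a (Fin.cons a i))) (Real.log ‖x‖))) (Real.log ‖x‖) := by
    refine (HasDerivAt.fun_sum fun a _ => ?_).neg
    exact ((hasDerivAt_gv h hx.2 a).inv (hg a _ hx.2)).mul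
      (ContDiffOn.hasDerivAt_deriv h.isOpen (hφ _) hx.2)
  rw [D_radial h.isOpen hx (hdiv i) hder]
  simp only [covD_met h hx, D_radial h.isOpen hx (hZφ _)
      (ContDiffOn.hasDerivAt_deriv h.isOpen (hφ _) hx.2), hdiv _ x hx, hZφ _ x hx]
  simp only [Fin.sum_univ_succ (n := k + 1), Fin.sum_univ_succ (n := k), Fin.cons_zero,
    Fin.cons_succ, Fin.update_cons_zero, ← Fin.cons_update]
  have key : ∀ ψ : Fin 4 → Fin 4 → ℝ,
      ∑ s, ((gv (F (Real.log ‖x‖)) (C (Real.log ‖x‖)) s)⁻¹ * (gamAt F C (Real.log ‖x‖) t s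
        * ψ (xr t s) s + gamAt F C (Real.log ‖x‖) t s * ψ s (xr t s))) =
      if t = 0 then ∑ s, dgv (F (Real.log ‖x‖)) (C (Real.log ‖x‖)) (deriv F (Real.log ‖x‖))
          (ld C (Real.log ‖x‖)) s / gv (F (Real.log ‖x‖)) (C (Real.log ‖x‖)) s ^ 2 * ψ s s
      else 0 := by
    intro ψ
    have hF0 := (h.pos_F _ hx.2).ne'
    have hC0 := (h.pos_C _ hx.2).ne'
    simp only [gamAt]
    generalize Real.log ‖x‖ = z at *
    generalize deriv F z = f1
    generalize ld C z = k
    clear hder hdiv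
    generalize C z = c0 at *
    generalize F z = f at *
    revert t
    simp only [forall_fin_four, Fin.sum_univ_four]
    simp only [xr, gv, gam, dgv, Matrix.cons_val, Fin.reduceEq, if_true, if_false]
    and_intros <;> (field_simp; ring)
  have key' := key fun a b => φ (Fin.cons a (Fin.cons b i)) (Real.log ‖x‖)
  have e : ∀ g d u v w : ℝ, g * (d - (u + (v + w))) = g * d - g * (u + v) - g * w := by
    intros; ring
  simp only [e, Finset.sum_sub_distrib, key']
  have e2 : ∀ s : Fin 4, (gv (F (Real.log ‖x‖)) (C (Real.log ‖x‖)) s)⁻¹ * ∑ j : Fin k,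
      gamAt F C (Real.log ‖x‖) t (i j) * φ (Fin.cons s (Fin.cons s (Function.update i j
        (xr t (i j))))) (Real.log ‖x‖) = ∑ j : Fin k, gamAt F C (Real.log ‖x‖) t (i j) *
      ((gv (F (Real.log ‖x‖)) (C (Real.log ‖x‖)) s)⁻¹ * φ (Fin.cons s (Fin.cons s
        (Function.update i j (xr t (i j))))) (Real.log ‖x‖)) := by
    intro s
    rw [Finset.mul_sum]
    exact Finset.sum_congr rfl fun j _ => by ring
  simp only [e2]
  rw [Finset.sum_comm]
  simp only [← Finset.mul_sum, mul_neg, Finset.sum_neg_distrib]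
  split_ifs with ht
  · simp only [neg_div, neg_mul, Finset.sum_add_distrib, Finset.sum_neg_distrib]
    ring
  · simp

end

section

variable {S : Set ℝ} {F C : ℝ → ℝ} {x : ℍ[ℝ]}

theorem hasDerivAt_cur {p q r s m : ℝ → ℝ} {p' q' r' s' m' z : ℝ} (hp : HasDerivAt p p' z)
    (hq : HasDerivAt q q' z) (hr : HasDerivAt r r' z) (hs : HasDerivAt s s' z)
    (hm : HasDerivAt m m' z) (a b c : Fin 4) :
    HasDerivAt (fun z => cur (p z) (q z) (r z) (s z) (m z) a b c) (cur p' q' r' s' m' a b c) z := by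
  have h0 := hasDerivAt_const z (0 : ℝ)
  revert a b c
  simp only [forall_fin_four]
  simp only [cur, Matrix.cons_val]
  and_intros <;> first
    | exact h0 | exact hp | exact hq | exact hr | exact hs | exact hm
    | exact hp.neg | exact hq.neg | exact hr.neg | exact hs.neg | exact hm.neg
    | exact hm.const_mul _

/-- Invariant tensors of rank three which are skew in the last two indices and have cyclic sum zero,
like the divergence of an algebraic curvature tensor: the three numbers are the components `T₁₀₁`,
`T₂₁₃ = T₁₂₃ / 2` and `T₂₀₂ = T₃₀₃`; the value of `cot` at `a b` is the component with indices
`a, b, xr a b`. -/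
def cot (p q r : ℝ) : Fin 4 → Fin 4 → ℝ :=
  ![![0, 0, 0, 0], ![p, -p, 2 * q, -2 * q], ![r, q, -r, -q], ![r, -q, q, -r]]

theorem hasDerivAt_cot {p q r : ℝ → ℝ} {p' q' r' z : ℝ} (hp : HasDerivAt p p' z)
    (hq : HasDerivAt q q' z) (hr : HasDerivAt r r' z) (a b : Fin 4) :
    HasDerivAt (fun z => cot (p z) (q z) (r z) a b) (cot p' q' r' a b) z := by
  have h0 := hasDerivAt_const z (0 : ℝ)
  revert a b
  simp only [forall_fin_four]
  simp only [cot, Matrix.cons_val]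
  and_intros <;> first
    | exact h0 | exact hp | exact hq | exact hr
    | exact hp.neg | exact hq.neg | exact hr.neg | exact hq.const_mul _

theorem divg_cur (h : IsSmoothPair S F C) (hx : x ∈ region S) {T : Tensor 4}
    {p q r s m : ℝ → ℝ} {p' q' r' s' m' : ℝ}
    (hT : ∀ y ∈ region S, ∀ i, T i y = if i 3 = xr (i 0) (xr (i 1) (i 2)) then
      cur (p (Real.log ‖y‖)) (q (Real.log ‖y‖)) (r (Real.log ‖y‖)) (s (Real.log ‖y‖))
        (m (Real.log ‖y‖)) (i 0) (i 1) (i 2) else 0)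
    (hp : HasDerivAt p p' (Real.log ‖x‖)) (hq : HasDerivAt q q' (Real.log ‖x‖))
    (hr : HasDerivAt r r' (Real.log ‖x‖)) (hs : HasDerivAt s s' (Real.log ‖x‖))
    (hm : HasDerivAt m m' (Real.log ‖x‖)) (i : Fin 3 → Fin 4) {f f1 c k : ℝ}
    (hf : F (Real.log ‖x‖) = f) (hf1 : deriv F (Real.log ‖x‖) = f1) (hc : C (Real.log ‖x‖) = c)
    (hk : ld C (Real.log ‖x‖) = k) :
    divg (met F C) T i x = if i 2 = xr (i 0) (i 1) then
      cot ((k * r (Real.log ‖x‖)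
            + f * (-4 * p' + 6 * m (Real.log ‖x‖) + 4 * k * p (Real.log ‖x‖))) / c)
        ((r (Real.log ‖x‖) + 4 * f * m' - f * s (Real.log ‖x‖) - 2 * f * k * m (Real.log ‖x‖)) / c)
        ((f1 * r (Real.log ‖x‖) / (2 * f ^ 2) + k * r (Real.log ‖x‖) / (2 * f)
            - 3 * m (Real.log ‖x‖) + k * s (Real.log ‖x‖) / 2 - 6 * f1 * q (Real.log ‖x‖)
            - 4 * f * q' + 4 * f * k * q (Real.log ‖x‖)) / c) (i 0) (i 1) else 0 := by
  have hF0 := (h.pos_F _ hx.2).ne'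
  have hC0 := (h.pos_C _ hx.2).ne'
  have hD : ∀ (a : Fin 4) (i : Fin 4 → Fin 4), D a (T i) x = if a = 0 then
      if i 3 = xr (i 0) (xr (i 1) (i 2)) then cur p' q' r' s' m' (i 0) (i 1) (i 2) else 0
      else 0 := by
    intro a i
    refine D_radial h.isOpen hx (hT · · i) (φ := fun z => if i 3 = xr (i 0) (xr (i 1) (i 2)) then
      cur (p z) (q z) (r z) (s z) (m z) (i 0) (i 1) (i 2) else 0) ?_ a
    split_ifs
    · exact hasDerivAt_cur hp hq hr hs hm _ _ _
    · exact hasDerivAt_const _ _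
  have c1 : ∀ a : Fin 4, (Fin.cons a i : Fin 4 → Fin 4) 1 = i 0 := fun _ => rfl
  have c2 : ∀ a : Fin 4, (Fin.cons a i : Fin 4 → Fin 4) 2 = i 1 := fun _ => rfl
  have c3 : ∀ a : Fin 4, (Fin.cons a i : Fin 4 → Fin 4) 3 = i 2 := fun _ => rfl
  have hcov : ∀ a : Fin 4, covD (met F C) T (Fin.cons a (Fin.cons a i)) x =
      D a (T (Fin.cons a i)) x - ∑ j : Fin 4,
        gamAt F C (Real.log ‖x‖) a ((Fin.cons a i : Fin 4 → Fin 4) j) *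
          T (Function.update (Fin.cons a i) j (xr a ((Fin.cons a i : Fin 4 → Fin 4) j))) x :=
    fun a => covD_met h hx (k := 4) T a (Fin.cons a i)
  rw [divg_met h hx]
  simp only [hcov, hD, hT x hx, Fin.sum_univ_four, Function.update_apply, Fin.cons_zero,
    c1, c2, c3, Fin.reduceEq, if_true, if_false]
  simp only [gamAt, hf, hf1, hc, hk] at hF0 hC0 ⊢
  clear hT hD hcov hp hq hr hs hm c1 c2 c3 hf hf1 hc hk
  generalize p (Real.log ‖x‖) = p at *
  generalize q (Real.log ‖x‖) = q at *
  generalize r (Real.log ‖x‖) = r at *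
  generalize s (Real.log ‖x‖) = s at *
  generalize m (Real.log ‖x‖) = m at *
  generalize i 0 = a
  generalize i 1 = b
  generalize i 2 = d
  revert a b d
  simp only [forall_fin_four]
  simp only [xr, gv, gam, cur, cot, Matrix.cons_val, Fin.reduceEq, if_true, if_false]
  and_intros <;> first | (ring; done) | (field_simp; ring)

theorem contract_cot (h : IsSmoothPair S F C) (hx : x ∈ region S) {T : Tensor 3}
    {p q r : ℝ → ℝ} {p' q' r' : ℝ}
    (hT : ∀ y ∈ region S, ∀ i, T i y = if i 2 = xr (i 0) (i 1) then
      cot (p (Real.log ‖y‖)) (q (Real.log ‖y‖)) (r (Real.log ‖y‖)) (i 0) (i 1) else 0)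
    (hp : HasDerivAt p p' (Real.log ‖x‖)) (hq : HasDerivAt q q' (Real.log ‖x‖))
    (hr : HasDerivAt r r' (Real.log ‖x‖)) (b d : Fin 4) {f f1 c k : ℝ}
    (hf : F (Real.log ‖x‖) = f) (hf1 : deriv F (Real.log ‖x‖) = f1) (hc : C (Real.log ‖x‖) = c)
    (hk : ld C (Real.log ‖x‖) = k) :
    ∑ t, (gv (F (Real.log ‖x‖)) (C (Real.log ‖x‖)) t)⁻¹ *
      covD (met F C) T (Fin.cons t ![b, d, t]) x = if b = d then
      (![-(f1 + f * k) * p (Real.log ‖x‖) / (2 * f ^ 2) - k * r (Real.log ‖x‖),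
        2 * f1 * p (Real.log ‖x‖) - 4 * f * p' - 6 * f * q (Real.log ‖x‖)
          + 2 * f * k * p (Real.log ‖x‖),
        3 * q (Real.log ‖x‖) - 4 * f1 * r (Real.log ‖x‖) - 4 * f * r'
          + 2 * f * k * r (Real.log ‖x‖),
        3 * q (Real.log ‖x‖) - 4 * f1 * r (Real.log ‖x‖) - 4 * f * r'
          + 2 * f * k * r (Real.log ‖x‖)] : Fin 4 → ℝ) b / c else 0 := by
  have hF0 := (h.pos_F _ hx.2).ne'
  have hC0 := (h.pos_C _ hx.2).ne'
  have hD : ∀ (a : Fin 4) (i : Fin 3 → Fin 4), D a (T i) x = if a = 0 then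
      if i 2 = xr (i 0) (i 1) then cot p' q' r' (i 0) (i 1) else 0
      else 0 := by
    intro a i
    refine D_radial h.isOpen hx (hT · · i) (φ := fun z => if i 2 = xr (i 0) (i 1) then
      cot (p z) (q z) (r z) (i 0) (i 1) else 0) ?_ a
    split_ifs
    · exact hasDerivAt_cot hp hq hr _ _
    · exact hasDerivAt_const _ _
  simp only [covD_met h hx, hD, hT x hx, Fin.sum_univ_three, Function.update_apply,
    Matrix.cons_val, Fin.reduceEq, if_true, if_false]
  simp only [gamAt, hf, hf1, hc, hk] at hF0 hC0 ⊢
  clear hT hD hp hq hr hf hf1 hc hk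
  generalize p (Real.log ‖x‖) = p at *
  generalize q (Real.log ‖x‖) = q at *
  generalize r (Real.log ‖x‖) = r at *
  revert b d
  simp only [forall_fin_four, Fin.sum_univ_four]
  simp only [xr, gv, gam, cot, Matrix.cons_val, Fin.reduceEq, if_true, if_false]
  and_intros <;> first | (ring; done) | (field_simp; ring)

end

/-! ### The curvature conditions as differential equations -/

section

variable {S : Set ℝ} {F C : ℝ → ℝ} {x : ℍ[ℝ]}

/-- With `h = C' / C`, the expression `F'' + h F' - 2 F + 2`.  It vanishes for Einstein metrics, and its
vanishing is half of the equation `δW = 0`. -/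
noncomputable def alphaAt (F C : ℝ → ℝ) (z : ℝ) : ℝ :=
  deriv (deriv F) z + ld C z * deriv F z - 2 * F z + 2

/-- The expression whose vanishing is the other half of the equation `δW = 0`. -/
noncomputable def betaAt (F C : ℝ → ℝ) (z : ℝ) : ℝ :=
  2 * deriv (deriv (deriv F)) z - 5 * deriv F z + ld C z * wv F z

/-- The derivative of the scalar curvature, multiplied by `C`. -/
noncomputable def dscalAt (F C : ℝ → ℝ) (z : ℝ) : ℝ :=
  -4 * deriv (deriv (deriv F)) z - 8 * deriv (deriv F) z * ld C z
    - 24 * deriv F z * deriv (ld C) z - 2 * deriv F z + 6 * deriv F z * ld C z ^ 2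
    - 12 * F z * deriv (deriv (ld C)) z + 2 * F z * ld C z - 8 * ld C z + 6 * F z * ld C z ^ 3

theorem IsSmoothPair.hasDerivAt_C (h : IsSmoothPair S F C) {z : ℝ} (hz : z ∈ S) :
    HasDerivAt C (C z * ld C z) z :=
  (ContDiffOn.hasDerivAt_deriv h.isOpen h.smooth_C hz).congr_deriv
    (mul_div_cancel₀ _ (h.pos_C z hz).ne').symm

theorem IsSmoothPair.hasDerivAt_F (h : IsSmoothPair S F C) {z : ℝ} (hz : z ∈ S) :
    HasDerivAt F (deriv F z) z :=
  ContDiffOn.hasDerivAt_deriv h.isOpen h.smooth_F hz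

theorem IsSmoothPair.hasDerivAt_F1 (h : IsSmoothPair S F C) {z : ℝ} (hz : z ∈ S) :
    HasDerivAt (deriv F) (deriv (deriv F) z) z :=
  ContDiffOn.hasDerivAt_deriv h.isOpen (ContDiffOn.deriv_infty h.isOpen h.smooth_F) hz

theorem IsSmoothPair.hasDerivAt_F2 (h : IsSmoothPair S F C) {z : ℝ} (hz : z ∈ S) :
    HasDerivAt (deriv (deriv F)) (deriv (deriv (deriv F)) z) z :=
  ContDiffOn.hasDerivAt_deriv h.isOpen
    (ContDiffOn.deriv_infty h.isOpen (ContDiffOn.deriv_infty h.isOpen h.smooth_F)) hz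

theorem IsSmoothPair.hasDerivAt_F3 (h : IsSmoothPair S F C) {z : ℝ} (hz : z ∈ S) :
    HasDerivAt (deriv (deriv (deriv F))) (deriv (deriv (deriv (deriv F))) z) z :=
  ContDiffOn.hasDerivAt_deriv h.isOpen (ContDiffOn.deriv_infty h.isOpen
    (ContDiffOn.deriv_infty h.isOpen (ContDiffOn.deriv_infty h.isOpen h.smooth_F))) hz

theorem IsSmoothPair.hasDerivAt_ld (h : IsSmoothPair S F C) {z : ℝ} (hz : z ∈ S) :
    HasDerivAt (ld C) (deriv (ld C) z) z :=
  ContDiffOn.hasDerivAt_deriv h.isOpen h.smooth_ld hz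

theorem IsSmoothPair.hasDerivAt_ld1 (h : IsSmoothPair S F C) {z : ℝ} (hz : z ∈ S) :
    HasDerivAt (deriv (ld C)) (deriv (deriv (ld C)) z) z :=
  ContDiffOn.hasDerivAt_deriv h.isOpen (ContDiffOn.deriv_infty h.isOpen h.smooth_ld) hz

theorem IsSmoothPair.hasDerivAt_wv (h : IsSmoothPair S F C) {z : ℝ} (hz : z ∈ S) :
    HasDerivAt (wv F) (deriv (deriv (deriv F)) z + 2 * deriv F z) z :=
  ((h.hasDerivAt_F2 hz).add ((h.hasDerivAt_F hz).const_mul 2)).sub_const 2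

theorem divg_weyl_met (h : IsSmoothPair S F C) (hx : x ∈ region S) (i : Fin 3 → Fin 4) :
    divg (met F C) (weyl (met F C)) i x = if i 2 = xr (i 0) (i 1) then
      cot (-(F (Real.log ‖x‖) * betaAt F C (Real.log ‖x‖) / 3))
        (F (Real.log ‖x‖) * alphaAt F C (Real.log ‖x‖)) (betaAt F C (Real.log ‖x‖) / 6)
        (i 0) (i 1) else 0 := by
  have hF := h.hasDerivAt_F hx.2
  have hF1 := h.hasDerivAt_F1 hx.2
  have hC := h.hasDerivAt_C hx.2
  have hw := h.hasDerivAt_wv hx.2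
  have hF0 := (h.pos_F _ hx.2).ne'
  have hC0 := (h.pos_C _ hx.2).ne'
  rw [divg_cur h hx (fun y hy i => weyl_met h hy i) ((hC.mul hw).div_const 6)
    ((((hC.mul hw).div hF hF0).div_const 12).neg) ((((hC.mul hF).mul hw).div_const 3).neg)
    (((hC.const_mul 2).mul hw).div_const 3) ((hC.mul hF1).div_const 2) i rfl rfl rfl rfl]
  simp only [alphaAt, betaAt, wv, Pi.mul_apply, Pi.neg_apply, Pi.div_apply]
  congr 2
  · field_simp
    ring
  · field_simp
    ring
  · field_simp
    ring

theorem divg_rm_met (h : IsSmoothPair S F C) (hx : x ∈ region S) (i : Fin 3 → Fin 4) :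
    divg (met F C) (rm (met F C)) i x = if i 2 = xr (i 0) (i 1) then
      cot (F (Real.log ‖x‖) * (-4 * betaAt F C (Real.log ‖x‖) + dscalAt F C (Real.log ‖x‖)) / 6)
        (2 * F (Real.log ‖x‖) * alphaAt F C (Real.log ‖x‖))
        ((2 * betaAt F C (Real.log ‖x‖) + dscalAt F C (Real.log ‖x‖)) / 6) (i 0) (i 1) else 0 := by
  have hF := h.hasDerivAt_F hx.2
  have hF1 := h.hasDerivAt_F1 hx.2
  have hF2 := h.hasDerivAt_F2 hx.2
  have hC := h.hasDerivAt_C hx.2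
  have hh := h.hasDerivAt_ld hx.2
  have hh1 := h.hasDerivAt_ld1 hx.2
  have hF0 := (h.pos_F _ hx.2).ne'
  have hC0 := (h.pos_C _ hx.2).ne'
  rw [divg_cur h hx
    (p := fun z => C z * (deriv (deriv F) z + deriv F z * ld C z + F z * deriv (ld C) z) / 2)
    (q := fun z => C z * (deriv F z * ld C z / F z + 2 * deriv (ld C) z) / 4)
    (r := fun z => C z * F z * (deriv F z * ld C z - F z + F z * ld C z ^ 2))
    (s := fun z => C z * (-4 + 3 * F z + F z * ld C z ^ 2)) (m := fun z => C z * deriv F z / 2)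
    (fun y hy i => ?_) ((hC.mul ((hF2.add (hF1.mul hh)).add (hF.mul hh1))).div_const 2)
    ((hC.mul (((hF1.mul hh).div hF hF0).add (hh1.const_mul 2))).div_const 4)
    ((hC.mul hF).mul (((hF1.mul hh).sub hF).add (hF.mul (hh.pow 2))))
    (hC.mul (((hF.const_mul 3).const_add (-4)).add (hF.mul (hh.pow 2))))
    ((hC.mul hF1).div_const 2) i rfl rfl rfl rfl]
  · simp only [alphaAt, betaAt, wv, dscalAt, Pi.mul_apply, Pi.add_apply, Pi.div_apply]
    congr 2
    · field_simp
      ring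
    · field_simp
      ring
    · field_simp
      ring
  · rw [rm_met h hy]
    split_ifs with hi
    · rw [hi, riemAt_mul_gv h hy.2]
    · rfl

theorem isHarmonicWeyl_iff (h : IsSmoothPair S F C) : IsHarmonicWeyl S (met F C) ↔
    ∀ z ∈ S, alphaAt F C z = 0 ∧ betaAt F C z = 0 := by
  constructor
  · intro hW z hz
    have h1 := hW _ (exp_mem_region hz) ![2, 1, 3]
    have h2 := hW _ (exp_mem_region hz) ![2, 0, 2]
    rw [divg_weyl_met h (exp_mem_region hz), log_norm_exp] at h1 h2
    have hF0 := (h.pos_F z hz).ne'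
    simp [xr, cot, hF0] at h1 h2
    exact ⟨h1, h2⟩
  · intro hab x hx i
    rw [divg_weyl_met h hx, (hab _ hx.2).1, (hab _ hx.2).2]
    generalize i 0 = a
    generalize i 1 = b
    split_ifs
    · revert a b
      simp [forall_fin_four, cot]
    · rfl

theorem isHarmonicCurvature_iff (h : IsSmoothPair S F C) : IsHarmonicCurvature S (met F C) ↔
    ∀ z ∈ S, alphaAt F C z = 0 ∧ betaAt F C z = 0 ∧ dscalAt F C z = 0 := by
  constructor
  · intro hW z hz
    have h1 := hW _ (exp_mem_region hz) ![2, 1, 3]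
    have h2 := hW _ (exp_mem_region hz) ![2, 0, 2]
    have h3 := hW _ (exp_mem_region hz) ![1, 0, 1]
    rw [divg_rm_met h (exp_mem_region hz), log_norm_exp] at h1 h2 h3
    have hF0 := (h.pos_F z hz).ne'
    simp [xr, cot, hF0] at h1 h2 h3
    exact ⟨h1, by linarith, by linarith⟩
  · intro hab x hx i
    rw [divg_rm_met h hx, (hab _ hx.2).1, (hab _ hx.2).2.1, (hab _ hx.2).2.2]
    generalize i 0 = a
    generalize i 1 = b
    split_ifs
    · revert a b
      simp [forall_fin_four, cot]
    · rfl

theorem isWeylFlat_of_wv (h : IsSmoothPair S F C) (hw : ∀ z ∈ S, wv F z = 0)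
    (hF : ∀ z ∈ S, deriv F z = 0) : IsWeylFlat S (met F C) := by
  intro x hx i
  rw [weyl_met h hx, hw _ hx.2, hF _ hx.2]
  generalize i 0 = a
  generalize i 1 = b
  generalize i 2 = c
  split_ifs
  · revert a b c
    simp [forall_fin_four, cur]
  · rfl

theorem tfRic_met (h : IsSmoothPair S F C) (hx : x ∈ region S) (a b : Fin 4) :
    tfRic (met F C) a b x = if a = b then
      (ricAt F C (Real.log ‖x‖) a - scalAt F C (Real.log ‖x‖) / 4)
        * gv (F (Real.log ‖x‖)) (C (Real.log ‖x‖)) a / C (Real.log ‖x‖) else 0 := by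
  simp only [tfRic, ric_met h hx, scal_met h hx, met_apply]
  split_ifs
  · ring
  · simp

/-- The second Einstein equation says that `C ^ (-1/2)` is a combination of `e ^ (±z/2)`. -/
theorem isEinstein_iff (h : IsSmoothPair S F C) : IsEinstein S (met F C) ↔
    ∀ z ∈ S, alphaAt F C z = 0 ∧ 2 * deriv (ld C) z = ld C z ^ 2 - 1 := by
  constructor
  · intro hE z hz
    have hF0 := h.pos_F z hz
    have hC0 := h.pos_C z hz
    have key : ∀ a, ricAt F C z a - scalAt F C z / 4 = 0 := by
      intro a
      have h1 := hE _ (exp_mem_region hz) a a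
      rw [tfRic_met h (exp_mem_region hz), log_norm_exp, if_pos rfl] at h1
      simpa [hC0.ne', (gv_pos hF0 hC0 a).ne'] using h1
    have h0 := key 0
    have h1 := key 1
    have h2 := key 2
    simp only [ricAt, ricv, Matrix.cons_val] at h0 h1 h2
    refine ⟨by rw [alphaAt]; linarith, ?_⟩
    have : F z * (2 * deriv (ld C) z) = F z * (ld C z ^ 2 - 1) := by linarith
    exact mul_left_cancel₀ hF0.ne' this
  · intro hz x hx a b
    obtain ⟨h1, h2⟩ := hz _ hx.2
    have key : ∀ a, ricAt F C (Real.log ‖x‖) a - scalAt F C (Real.log ‖x‖) / 4 = 0 := by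
      have h2' : deriv (ld C) (Real.log ‖x‖) = (ld C (Real.log ‖x‖) ^ 2 - 1) / 2 := by linarith
      rw [alphaAt] at h1
      simp only [forall_fin_four, ricAt, ricv, scalAt, Matrix.cons_val, h2']
      and_intros <;> linarith
    rw [tfRic_met h hx, key, zero_mul, zero_div, ite_self]

/-- The linear one of the two expressions in `F` whose vanishing means that `met F C` is Bach-flat. -/
noncomputable def bachL (F : ℝ → ℝ) (z : ℝ) : ℝ :=
  deriv (deriv (deriv (deriv F))) z - 5 * deriv (deriv F) z + 4 * F z - 4

/-- The quadratic expression in `F` that vanishes together with `bachL F` if `met F C` is Bach-flat; it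
is a first integral of the equation `bachL F = 0`. -/
noncomputable def bachQ (F : ℝ → ℝ) (z : ℝ) : ℝ :=
  deriv (deriv F) z ^ 2 - 2 * deriv F z * deriv (deriv (deriv F)) z + 5 * deriv F z ^ 2
    - 4 * (F z - 1) ^ 2

theorem contDiffOn_cur {p q r s m : ℝ → ℝ} (hp : ContDiffOn ℝ ∞ p S) (hq : ContDiffOn ℝ ∞ q S)
    (hr : ContDiffOn ℝ ∞ r S) (hs : ContDiffOn ℝ ∞ s S) (hm : ContDiffOn ℝ ∞ m S)
    (a b c : Fin 4) :
    ContDiffOn ℝ ∞ (fun z => cur (p z) (q z) (r z) (s z) (m z) a b c) S := by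
  revert a b c
  simp only [forall_fin_four]
  simp only [cur, Matrix.cons_val]
  and_intros <;> first
    | exact contDiffOn_const | exact hp | exact hq | exact hr | exact hs | exact hm
    | exact hp.neg | exact hq.neg | exact hr.neg | exact hs.neg | exact hm.neg
    | exact contDiffOn_const.mul hm

theorem isRadial_weyl (h : IsSmoothPair S F C) : IsRadial S (weyl (met F C)) := by
  intro i
  refine ⟨fun z => if i 3 = xr (i 0) (xr (i 1) (i 2)) then cur (C z * wv F z / 6)
    (-(C z * wv F z / F z / 12)) (-(C z * F z * wv F z / 3)) (2 * C z * wv F z / 3)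
    (C z * deriv F z / 2) (i 0) (i 1) (i 2) else 0, ?_, fun x hx => weyl_met h hx i⟩
  have hF := h.smooth_F
  have hC := h.smooth_C
  have hF1 := ContDiffOn.deriv_infty h.isOpen hF
  have hF2 := ContDiffOn.deriv_infty h.isOpen hF1
  have hF0 : ∀ z ∈ S, F z ≠ 0 := fun z hz => (h.pos_F z hz).ne'
  have hw : ContDiffOn ℝ ∞ (wv F) S :=
    (hF2.add (contDiffOn_const.mul hF)).sub contDiffOn_const
  have hCw := hC.mul hw
  split_ifs
  · exact contDiffOn_cur (hCw.div_const 6) ((hCw.div hF hF0).div_const 12).neg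
      (((hC.mul hF).mul hw).div_const 3).neg (((contDiffOn_const.mul hC).mul hw).div_const 3)
      ((hC.mul hF1).div_const 2) _ _ _
  · exact contDiffOn_const

/-- The Bach tensor, through the divergence of `δW` and the contraction of the Weyl and Ricci tensors. -/
theorem bach_met (h : IsSmoothPair S F C) (hx : x ∈ region S) (b c : Fin 4) :
    bach (met F C) b c x = if b = c then
      (![bachQ F (Real.log ‖x‖) / (6 * F (Real.log ‖x‖)),
        2 / 3 * F (Real.log ‖x‖) * bachQ F (Real.log ‖x‖)
          - 8 / 3 * F (Real.log ‖x‖) ^ 2 * bachL F (Real.log ‖x‖),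
        -2 / 3 * bachQ F (Real.log ‖x‖) + 4 / 3 * F (Real.log ‖x‖) * bachL F (Real.log ‖x‖),
        -2 / 3 * bachQ F (Real.log ‖x‖) + 4 / 3 * F (Real.log ‖x‖) * bachL F (Real.log ‖x‖)]
        : Fin 4 → ℝ) b / C (Real.log ‖x‖) else 0 := by
  have hF := h.hasDerivAt_F hx.2
  have hF1 := h.hasDerivAt_F1 hx.2
  have hF2 := h.hasDerivAt_F2 hx.2
  have hF3 := h.hasDerivAt_F3 hx.2
  have hw := h.hasDerivAt_wv hx.2
  have hh := h.hasDerivAt_ld hx.2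
  have hα : HasDerivAt (alphaAt F C) _ (Real.log ‖x‖) :=
    ((hF2.add (hh.mul hF1)).sub (hF.const_mul 2)).add_const 2
  have hβ : HasDerivAt (betaAt F C) _ (Real.log ‖x‖) :=
    ((hF3.const_mul 2).sub (hF1.const_mul 5)).add (hh.mul hw)
  have hY := contract_cot h hx (T := divg (met F C) (weyl (met F C)))
    (fun y hy i => divg_weyl_met h hy i)
    ((hF.mul hβ).div_const 3).neg (hF.mul hα) (hβ.div_const 6) b c rfl rfl rfl rfl
  have hcomm : ∀ t : Fin 4, covD (met F C) (divg (met F C) (weyl (met F C)))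
      (Fin.cons t ![b, c, t]) x = -∑ s, (gv (F (Real.log ‖x‖)) (C (Real.log ‖x‖)) s)⁻¹ *
        covD (met F C) (covD (met F C) (weyl (met F C))) ![t, s, s, b, c, t] x :=
    fun t => covD_divg h hx (isRadial_weyl h) t ![b, c, t]
  have hb : bach (met F C) b c x =
      -(∑ t, (gv (F (Real.log ‖x‖)) (C (Real.log ‖x‖)) t)⁻¹ *
        covD (met F C) (divg (met F C) (weyl (met F C))) (Fin.cons t ![b, c, t]) x)
      + ∑ s, (gv (F (Real.log ‖x‖)) (C (Real.log ‖x‖)) s)⁻¹ * weyl (met F C) ![s, b, c, s] x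
        * ricAt F C (Real.log ‖x‖) s / C (Real.log ‖x‖) / 2 := by
    have hcol : bach (met F C) b c x = ∑ s, ∑ t,
        (gv (F (Real.log ‖x‖)) (C (Real.log ‖x‖)) s)⁻¹
          * (gv (F (Real.log ‖x‖)) (C (Real.log ‖x‖)) t)⁻¹ *
          (covD (met F C) (covD (met F C) (weyl (met F C))) ![t, s, s, b, c, t] x
            + weyl (met F C) ![s, b, c, t] x * ric (met F C) s t x / 2) := by
      simp only [bach, met_inv_apply (h.pos_F _ hx.2) (h.pos_C _ hx.2)]
      refine Finset.sum_congr rfl fun s _ => ?_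
      rw [Finset.sum_eq_single s (fun s' _ hs => by simp [hs.symm]) (by simp)]
      refine Finset.sum_congr rfl fun t _ => ?_
      rw [Finset.sum_eq_single t (fun t' _ ht => by simp [ht.symm]) (by simp), if_pos rfl,
        if_pos rfl]
    simp only [hcol, hcomm, mul_add, Finset.sum_add_distrib, ric_met h hx, mul_ite, mul_zero,
      ite_div, zero_div, mul_neg, Finset.sum_neg_distrib, neg_neg, Finset.mul_sum,
      Finset.sum_ite_eq, Finset.mem_univ, if_true]
    congr 1
    · rw [Finset.sum_comm]
      exact Finset.sum_congr rfl fun t _ => Finset.sum_congr rfl fun s _ => by ring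
    · refine Finset.sum_congr rfl fun s _ => ?_
      have := (gv_pos (h.pos_F _ hx.2) (h.pos_C _ hx.2) s).ne'
      field_simp
  rw [hb, hY]
  simp only [weyl_met h hx, Matrix.cons_val]
  have hF0 := (h.pos_F _ hx.2).ne'
  have hC0 := (h.pos_C _ hx.2).ne'
  clear hb hY hcomm hα hβ hF hF1 hF2 hF3 hw hh
  simp only [ricAt, alphaAt, betaAt, bachQ, bachL, wv, Pi.mul_apply, Pi.neg_apply]
  generalize Real.log ‖x‖ = z at *
  generalize deriv (deriv (deriv (deriv F))) z = f4
  generalize deriv (deriv (deriv F)) z = f3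
  generalize deriv (deriv F) z = f2
  generalize deriv F z = f1
  generalize deriv (ld C) z = k1
  generalize ld C z = k
  generalize C z = c0 at *
  generalize F z = f at *
  revert b c
  simp only [forall_fin_four, Fin.sum_univ_four]
  simp only [xr, gv, ricv, cur, Matrix.cons_val, Fin.reduceEq, if_true, if_false]
  and_intros <;> first | (ring; done) | (field_simp; ring)

theorem isBachFlat_iff (h : IsSmoothPair S F C) : IsBachFlat S (met F C) ↔
    ∀ z ∈ S, bachQ F z = 0 ∧ bachL F z = 0 := by
  constructor
  · intro hB z hz
    have hF0 := (h.pos_F z hz).ne'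
    have hC0 := (h.pos_C z hz).ne'
    have h0 := hB _ (exp_mem_region hz) 0 0
    have h1 := hB _ (exp_mem_region hz) 1 1
    rw [bach_met h (exp_mem_region hz), log_norm_exp] at h0 h1
    simp [hF0, hC0] at h0 h1
    rw [h0] at h1
    exact ⟨h0, by simpa [hF0] using h1⟩
  · intro hz x hx b c
    rw [bach_met h hx, (hz _ hx.2).1, (hz _ hx.2).2]
    split_ifs
    · revert b
      simp only [forall_fin_four, Matrix.cons_val]
      simp
    · rfl

end

/-! ### Solving the equations -/

theorem exists_eq_const_of_hasDerivAt_zero {I : Set ℝ} (hI : IsOpen I) (hc : I.OrdConnected)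
    {f : ℝ → ℝ} (hf : ∀ z ∈ I, HasDerivAt f 0 z) : ∃ c, ∀ z ∈ I, f z = c := by
  rcases I.eq_empty_or_nonempty with rfl | ⟨z₀, hz₀⟩
  · exact ⟨0, by simp⟩
  · refine ⟨f z₀, fun z hz => ?_⟩
    exact hI.is_const_of_deriv_eq_zero (isPreconnected_iff_ordConnected.2 hc)
      (fun y hy => (hf y hy).differentiableAt.differentiableWithinAt)
      (fun y hy => (hf y hy).deriv) hz hz₀

theorem exists_eq_exp_of_hasDerivAt {I : Set ℝ} (hI : IsOpen I) (hc : I.OrdConnected)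
    {f : ℝ → ℝ} {k : ℝ} (hf : ∀ z ∈ I, HasDerivAt f (k * f z) z) :
    ∃ c, ∀ z ∈ I, f z = c * Real.exp (k * z) := by
  obtain ⟨c, hc⟩ := exists_eq_const_of_hasDerivAt_zero hI hc
    (f := fun z => f z * Real.exp (-(k * z))) fun z hz => by
      refine ((hf z hz).mul (((hasDerivAt_id z).const_mul k).neg.exp)).congr_deriv ?_
      simp
      ring
  refine ⟨c, fun z hz => ?_⟩
  rw [← hc z hz, mul_assoc, ← Real.exp_add]
  simp

section

variable {S : Set ℝ} {F C : ℝ → ℝ}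

theorem hasDerivAt_zero_of_eqOn {f : ℝ → ℝ} (hS : IsOpen S) (hf : ∀ z ∈ S, f z = 0) {z : ℝ}
    (hz : z ∈ S) : HasDerivAt f 0 z :=
  (hasDerivAt_const z (0 : ℝ)).congr_of_eventuallyEq
    (by filter_upwards [hS.mem_nhds hz] with y hy using hf y hy)

theorem deriv_alpha (h : IsSmoothPair S F C) (hα : ∀ z ∈ S, alphaAt F C z = 0) {z : ℝ}
    (hz : z ∈ S) :
    deriv (deriv (deriv F)) z + (deriv (ld C) z * deriv F z + ld C z * deriv (deriv F) z)
      - 2 * deriv F z = 0 :=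
  ((((h.hasDerivAt_F2 hz).add ((h.hasDerivAt_ld hz).mul (h.hasDerivAt_F1 hz))).sub
    ((h.hasDerivAt_F hz).const_mul 2)).add_const 2).unique (hasDerivAt_zero_of_eqOn h.isOpen hα hz)

theorem deriv_deriv_alpha (h : IsSmoothPair S F C) (hα : ∀ z ∈ S, alphaAt F C z = 0) {z : ℝ}
    (hz : z ∈ S) :
    deriv (deriv (deriv (deriv F))) z + ((deriv (deriv (ld C)) z * deriv F z
      + deriv (ld C) z * deriv (deriv F) z) + (deriv (ld C) z * deriv (deriv F) z
      + ld C z * deriv (deriv (deriv F)) z)) - 2 * deriv (deriv F) z = 0 :=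
  (((h.hasDerivAt_F3 hz).add (((h.hasDerivAt_ld1 hz).mul (h.hasDerivAt_F1 hz)).add
    ((h.hasDerivAt_ld hz).mul (h.hasDerivAt_F2 hz)))).sub
    ((h.hasDerivAt_F1 hz).const_mul 2)).unique
      (hasDerivAt_zero_of_eqOn h.isOpen (fun _ hz => deriv_alpha h hα hz) hz)

/-- Differentiating the equation `2 h' = h² - 1`. -/
theorem deriv_riccati (h : IsSmoothPair S F C)
    (hr : ∀ z ∈ S, 2 * deriv (ld C) z = ld C z ^ 2 - 1) {z : ℝ} (hz : z ∈ S) :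
    deriv (deriv (ld C)) z = ld C z * deriv (ld C) z := by
  have h1 := (((h.hasDerivAt_ld1 hz).const_mul 2).sub
    (((h.hasDerivAt_ld hz).pow 2).sub_const 1)).unique
    (hasDerivAt_zero_of_eqOn h.isOpen (fun y hy => sub_eq_zero.2 (hr y hy)) hz)
  simp at h1
  linarith

theorem beta_of_einstein (h : IsSmoothPair S F C) (hE : IsEinstein S (met F C)) {z : ℝ}
    (hz : z ∈ S) : betaAt F C z = 0 := by
  rw [isEinstein_iff h] at hE
  have h1 := (hE z hz).1
  have h2 := (hE z hz).2
  have h3 := deriv_alpha h (fun y hy => (hE y hy).1) hz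
  simp only [alphaAt, betaAt, wv] at *
  linear_combination 2 * h3 - ld C z * h1 - deriv F z * h2

theorem IsEinstein.isHarmonicCurvature (h : IsSmoothPair S F C) (hE : IsEinstein S (met F C)) :
    IsHarmonicCurvature S (met F C) := by
  rw [isHarmonicCurvature_iff h]
  intro z hz
  have hb := beta_of_einstein h hE hz
  rw [isEinstein_iff h] at hE
  refine ⟨(hE z hz).1, hb, ?_⟩
  have h1 := (hE z hz).1
  have h2 := (hE z hz).2
  have h3 := deriv_alpha h (fun y hy => (hE y hy).1) hz
  have h4 := deriv_riccati h (fun y hy => (hE y hy).2) hz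
  simp only [alphaAt, dscalAt] at *
  rw [h4]
  linear_combination -4 * h3 - 4 * ld C z * h1
    + (-6 * F z * ld C z - 10 * deriv F z) * h2

theorem IsEinstein.isBachFlat (h : IsSmoothPair S F C) (hE : IsEinstein S (met F C)) {z : ℝ}
    (hz : z ∈ S) : bachQ F z = 0 ∧ bachL F z = 0 := by
  rw [isEinstein_iff h] at hE
  have h1 := (hE z hz).1
  have h2 := (hE z hz).2
  have h3 := deriv_alpha h (fun y hy => (hE y hy).1) hz
  have h4 := deriv_riccati h (fun y hy => (hE y hy).2) hz
  have h5 := deriv_deriv_alpha h (fun y hy => (hE y hy).1) hz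
  have e1 : deriv (ld C) z = (ld C z ^ 2 - 1) / 2 := by linarith
  rw [h4, e1] at h5
  rw [e1] at h3
  have e2 : deriv (deriv F) z = -ld C z * deriv F z + 2 * F z - 2 := by
    rw [alphaAt] at h1; linarith
  rw [e2] at h3 h5
  have e3 : deriv (deriv (deriv F)) z = -((ld C z ^ 2 - 1) / 2 * deriv F z
    + ld C z * (-ld C z * deriv F z + 2 * F z - 2)) + 2 * deriv F z := by linarith
  rw [e3] at h5
  simp only [bachQ, bachL, e2, e3]
  refine ⟨by ring, ?_⟩
  linear_combination h5

/-- The two halves of the Weyl tensor are determined by `w ± 3 F'`.  If `δW = 0` then each of these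
functions satisfies a linear equation of first order. -/
theorem weyl_halves {I : Set ℝ} (h : IsSmoothPair I F C) (hI : I.OrdConnected)
    (hα : ∀ z ∈ I, alphaAt F C z = 0) (hβ : ∀ z ∈ I, betaAt F C z = 0) :
    ∃ A B : ℝ, ∀ z ∈ I,
      (wv F z + 3 * deriv F z) * √(C z) = A * Real.exp (3 / 2 * z) ∧
      (wv F z - 3 * deriv F z) * √(C z) = B * Real.exp (-(3 / 2) * z) := by
  have hs : ∀ z ∈ I, HasDerivAt (fun z => √(C z)) (ld C z / 2 * √(C z)) z := by
    intro z hz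
    refine ((h.hasDerivAt_C hz).sqrt (h.pos_C z hz).ne').congr_deriv ?_
    have h1 := Real.sq_sqrt (h.pos_C z hz).le
    have h2 := (Real.sqrt_pos.2 (h.pos_C z hz)).ne'
    field_simp
    rw [h1]
    ring
  have hA := exists_eq_exp_of_hasDerivAt h.isOpen hI (k := 3 / 2)
    (f := fun z => (wv F z + 3 * deriv F z) * √(C z)) fun z hz => by
      refine (((h.hasDerivAt_wv hz).add ((h.hasDerivAt_F1 hz).const_mul 3)).mul
        (hs z hz)).congr_deriv ?_
      have h1 := hα z hz
      have h2 := hβ z hz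
      simp only [alphaAt, betaAt, wv, Pi.add_apply] at *
      linear_combination (√(C z) / 2) * h2 + (3 / 2 * √(C z)) * h1
  have hB := exists_eq_exp_of_hasDerivAt h.isOpen hI (k := -(3 / 2))
    (f := fun z => (wv F z - 3 * deriv F z) * √(C z)) fun z hz => by
      refine (((h.hasDerivAt_wv hz).sub ((h.hasDerivAt_F1 hz).const_mul 3)).mul
        (hs z hz)).congr_deriv ?_
      have h1 := hα z hz
      have h2 := hβ z hz
      simp only [alphaAt, betaAt, wv, Pi.sub_apply] at *
      linear_combination (√(C z) / 2) * h2 - (3 / 2 * √(C z)) * h1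
  obtain ⟨A, hA⟩ := hA
  obtain ⟨B, hB⟩ := hB
  exact ⟨A, B, fun z hz => ⟨hA z hz, hB z hz⟩⟩

/-- The equations `δW = 0` imply `F' (1 + 2 h' - h²) = 0`, where the second factor is the missing Einstein
equation.  If it fails somewhere, then `F'` vanishes on an interval, and both halves of the Weyl tensor
vanish. -/
theorem isEinstein_of_isHarmonicWeyl {I : Set ℝ} (h : IsSmoothPair I F C) (hI : I.OrdConnected)
    (hW : IsHarmonicWeyl I (met F C)) (hne : ¬ IsWeylFlat I (met F C)) :
    IsEinstein I (met F C) := by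
  rw [isHarmonicWeyl_iff h] at hW
  rw [isEinstein_iff h]
  obtain ⟨A, B, hAB⟩ := weyl_halves h hI (fun z hz => (hW z hz).1) fun z hz => (hW z hz).2
  have key : ∀ z ∈ I, deriv F z = 0 ∨ 1 + 2 * deriv (ld C) z - ld C z ^ 2 = 0 := by
    intro z hz
    have h1 := (hW z hz).1
    have h2 := (hW z hz).2
    have h3 := deriv_alpha h (fun y hy => (hW y hy).1) hz
    simp only [alphaAt, betaAt, wv] at *
    rw [← mul_eq_zero]
    linear_combination 2 * h3 - h2 - ld C z * h1
  have hzero : ∀ z ∈ I, deriv F z = 0 → A * Real.exp (3 * z) = B := by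
    intro z hz hz0
    obtain ⟨h1, h2⟩ := hAB z hz
    rw [hz0] at h1 h2
    have h3 : A * Real.exp (3 / 2 * z) = B * Real.exp (-(3 / 2) * z) := by linarith
    have h4 : Real.exp (3 * z) = Real.exp (3 / 2 * z) * Real.exp (3 / 2 * z) := by
      rw [← Real.exp_add]; ring_nf
    have h5 : Real.exp (-(3 / 2) * z) * Real.exp (3 / 2 * z) = 1 := by
      rw [← Real.exp_add]; simp
    rw [h4, ← mul_assoc, h3, mul_assoc, h5, mul_one]
  refine fun z hz => ⟨(hW z hz).1, ?_⟩
  by_contra hcon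
  -- Otherwise `F' = 0` near `z`, and then both halves of the Weyl tensor vanish identically.
  have hcont : ContinuousOn (fun z => 1 + 2 * deriv (ld C) z - ld C z ^ 2) I :=
    (continuousOn_const.add (continuousOn_const.mul
      (ContDiffOn.deriv_infty h.isOpen h.smooth_ld).continuousOn)).sub
        (h.smooth_ld.continuousOn.pow 2)
  have hev : ∀ᶠ y in nhds z, y ∈ I ∧ deriv F y = 0 := by
    have h1 := (hcont.continuousAt (h.isOpen.mem_nhds hz)).eventually_ne
      (show _ ≠ (0 : ℝ) from fun h0 => hcon (by linarith))
    filter_upwards [h1, h.isOpen.mem_nhds hz] with y hy hyI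
    exact ⟨hyI, (key y hyI).resolve_right hy⟩
  obtain ⟨y, ⟨hyI, hy0⟩, hyz⟩ := (hev.filter_mono nhdsWithin_le_nhds).and
    (self_mem_nhdsWithin : {z}ᶜ ∈ nhdsWithin z {z}ᶜ) |>.exists
  obtain ⟨-, hz0⟩ := hev.self_of_nhds
  have h1 := hzero z hz hz0
  have h2 := hzero y hyI hy0
  have hA : A = 0 := by
    by_contra hA
    have h3 : Real.exp (3 * y) = Real.exp (3 * z) := mul_left_cancel₀ hA (h2.trans h1.symm)
    exact hyz (by simpa using Real.exp_injective h3)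
  have hB : B = 0 := by rw [← h1, hA, zero_mul]
  refine hne (isWeylFlat_of_wv h ?_ ?_) <;> intro x hx <;> obtain ⟨h3, h4⟩ := hAB x hx <;>
    rw [hA, zero_mul] at h3 <;> rw [hB, zero_mul] at h4 <;>
    have h5 := (Real.sqrt_pos.2 (h.pos_C x hx)).ne' <;>
    have h6 := (mul_eq_zero.1 h3).resolve_right h5 <;>
    have h7 := (mul_eq_zero.1 h4).resolve_right h5 <;> linarith

end

/-! ### The explicit solutions -/

section

variable {S : Set ℝ} {F C : ℝ → ℝ}

theorem exp_neg_two_mul (z : ℝ) : Real.exp (-2 * z) = Real.exp (-z) ^ 2 := by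
  rw [← Real.exp_nat_mul]; congr 1; push_cast; ring

theorem exp_two_mul (z : ℝ) : Real.exp (2 * z) = Real.exp z ^ 2 := by
  rw [← Real.exp_nat_mul]; congr 1

theorem exp_eq_inv (z : ℝ) : Real.exp z = (Real.exp (-z))⁻¹ := by
  rw [Real.exp_neg, inv_inv]

theorem deriv_eqOn (hS : IsOpen S) {f g : ℝ → ℝ} (hfg : ∀ z ∈ S, f z = g z) {z g' : ℝ}
    (hz : z ∈ S) (hg : HasDerivAt g g' z) : deriv f z = g' :=
  (hg.congr_of_eventuallyEq (by filter_upwards [hS.mem_nhds hz] with y hy using hfg y hy)).deriv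

/-- The combinations of the exponentials that occur in the solutions are closed under derivation. -/
theorem hasDerivAt_expSum (a₀ a₁ a₂ a₃ a₄ z : ℝ) :
    HasDerivAt (fun z => a₀ + a₁ * Real.exp (-2 * z) + a₂ * Real.exp (-z) + a₃ * Real.exp z
      + a₄ * Real.exp (2 * z))
      (0 + (-2 * a₁) * Real.exp (-2 * z) + (-a₂) * Real.exp (-z) + a₃ * Real.exp z
      + (2 * a₄) * Real.exp (2 * z)) z := by
  have h1 := (((hasDerivAt_id z).const_mul (-2)).exp).const_mul a₁
  have h2 := (((hasDerivAt_id z).neg).exp).const_mul a₂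
  have h3 := (Real.hasDerivAt_exp z).const_mul a₃
  have h4 := (((hasDerivAt_id z).const_mul 2).exp).const_mul a₄
  refine (((((hasDerivAt_const z a₀).add h1).add h2).add h3).add h4).congr_deriv ?_
  simp
  ring

theorem deriv_expSum_of_eqOn (hS : IsOpen S) {a₀ a₁ a₂ a₃ a₄ : ℝ}
    (hF : ∀ z ∈ S, F z = a₀ + a₁ * Real.exp (-2 * z) + a₂ * Real.exp (-z) + a₃ * Real.exp z
      + a₄ * Real.exp (2 * z)) :
    ∀ z ∈ S, deriv F z = 0 + (-2 * a₁) * Real.exp (-2 * z) + (-a₂) * Real.exp (-z)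
      + a₃ * Real.exp z + (2 * a₄) * Real.exp (2 * z) :=
  fun _ hz => deriv_eqOn hS hF hz (hasDerivAt_expSum _ _ _ _ _ _)

theorem HasEinsteinForm.ne_zero (h : IsSmoothPair S F C) {c₁ c₂ c₃ c₄ c₅ c₆ : ℝ}
    (hf : HasEinsteinForm S F C c₁ c₂ c₃ c₄ c₅ c₆) {z : ℝ} (hz : z ∈ S) :
    c₅ + c₆ * Real.exp (-z) ≠ 0 := by
  intro h0
  have := h.pos_C z hz
  rw [hf.2.1 z hz, h0] at this
  simp at this

theorem HasEinsteinForm.ld_eq (h : IsSmoothPair S F C) {c₁ c₂ c₃ c₄ c₅ c₆ : ℝ}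
    (hf : HasEinsteinForm S F C c₁ c₂ c₃ c₄ c₅ c₆) {z : ℝ} (hz : z ∈ S) :
    ld C z = -1 + 2 * c₆ * Real.exp (-z) / (c₅ + c₆ * Real.exp (-z)) := by
  have h0 := hf.ne_zero h hz
  have he := (hasDerivAt_id z).neg.exp
  have h1 := deriv_eqOn h.isOpen hf.2.1 hz
    (he.div (((he.const_mul c₆).const_add c₅).pow 2) (pow_ne_zero 2 h0))
  rw [ld, h1, hf.2.1 z hz]
  have hX := (Real.exp_pos (-z)).ne'
  simp only [Pi.neg_apply, id]
  generalize c₅ + c₆ * Real.exp (-z) = d at *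
  simp
  field_simp

theorem HasEinsteinForm.deriv_ld (h : IsSmoothPair S F C) {c₁ c₂ c₃ c₄ c₅ c₆ : ℝ}
    (hf : HasEinsteinForm S F C c₁ c₂ c₃ c₄ c₅ c₆) {z : ℝ} (hz : z ∈ S) :
    2 * deriv (ld C) z = ld C z ^ 2 - 1 := by
  have h0 := hf.ne_zero h hz
  have he := (hasDerivAt_id z).neg.exp
  have h1 := deriv_eqOn h.isOpen (fun y hy => hf.ld_eq h hy) hz
    (((he.const_mul (2 * c₆)).div ((he.const_mul c₆).const_add c₅) h0).const_add (-1))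
  rw [h1, hf.ld_eq h hz]
  simp
  field_simp
  ring

theorem HasEinsteinForm.derivs (h : IsSmoothPair S F C) {c₁ c₂ c₃ c₄ c₅ c₆ : ℝ}
    (hf : HasEinsteinForm S F C c₁ c₂ c₃ c₄ c₅ c₆) {z : ℝ} (hz : z ∈ S) :
    F z = 1 + c₁ / 2 * Real.exp (-z) ^ 2 + c₂ * Real.exp (-z) + c₃ * (Real.exp (-z))⁻¹
      + c₄ / 2 * (Real.exp (-z))⁻¹ ^ 2 ∧
    deriv F z = -c₁ * Real.exp (-z) ^ 2 - c₂ * Real.exp (-z) + c₃ * (Real.exp (-z))⁻¹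
      + c₄ * (Real.exp (-z))⁻¹ ^ 2 ∧
    deriv (deriv F) z = 2 * c₁ * Real.exp (-z) ^ 2 + c₂ * Real.exp (-z) + c₃ * (Real.exp (-z))⁻¹
      + 2 * c₄ * (Real.exp (-z))⁻¹ ^ 2 := by
  have h1 := deriv_expSum_of_eqOn h.isOpen hf.1
  have h2 := deriv_expSum_of_eqOn h.isOpen h1
  rw [hf.1 z hz, h1 z hz, h2 z hz, exp_neg_two_mul, exp_two_mul, exp_eq_inv z]
  refine ⟨by ring, by ring, by ring⟩

theorem HasEinsteinForm.isEinstein (h : IsSmoothPair S F C) {c₁ c₂ c₃ c₄ c₅ c₆ : ℝ}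
    (hf : HasEinsteinForm S F C c₁ c₂ c₃ c₄ c₅ c₆) : IsEinstein S (met F C) := by
  rw [isEinstein_iff h]
  intro z hz
  refine ⟨?_, hf.deriv_ld h hz⟩
  obtain ⟨e0, e1, e2⟩ := hf.derivs h hz
  have h0 := hf.ne_zero h hz
  have h1 := hf.2.2.1
  have h2 := hf.2.2.2
  refine (mul_eq_zero.1 (?_ : alphaAt F C z * (c₅ + c₆ * Real.exp (-z)) = 0)).resolve_right h0
  have e3 : ld C z * (c₅ + c₆ * Real.exp (-z)) = -c₅ + c₆ * Real.exp (-z) := by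
    rw [hf.ld_eq h hz]; field_simp; ring
  have e4 : alphaAt F C z * (c₅ + c₆ * Real.exp (-z)) =
      (deriv (deriv F) z - 2 * F z + 2) * (c₅ + c₆ * Real.exp (-z))
        + deriv F z * (ld C z * (c₅ + c₆ * Real.exp (-z))) := by rw [alphaAt]; ring
  rw [e4, e3, e0, e1, e2]
  have hX := (Real.exp_pos (-z)).ne'
  generalize Real.exp (-z) = X at *
  field_simp
  linear_combination (2 * X ^ 4) * h1 - (2 * X) * h2

theorem HasEinsteinForm.scal_eq (h : IsSmoothPair S F C) {c₁ c₂ c₃ c₄ c₅ c₆ : ℝ}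
    (hf : HasEinsteinForm S F C c₁ c₂ c₃ c₄ c₅ c₆) {x : ℍ[ℝ]} (hx : x ∈ region S) :
    scal (met F C) x = -24 * (c₂ * c₅ ^ 2 - 2 * c₅ * c₆ + c₃ * c₆ ^ 2) := by
  have hz := hx.2
  rw [scal_met h hx]
  generalize Real.log ‖x‖ = z at hz
  obtain ⟨e0, e1, e2⟩ := hf.derivs h hz
  have h0 := hf.ne_zero h hz
  have h1 := hf.2.2.1
  have h2 := hf.2.2.2
  have h3 : deriv (ld C) z = (ld C z ^ 2 - 1) / 2 := by linarith [hf.deriv_ld h hz]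
  have e3 : ld C z * (c₅ + c₆ * Real.exp (-z)) = -c₅ + c₆ * Real.exp (-z) := by
    rw [hf.ld_eq h hz]; field_simp; ring
  have e4 : scalAt F C z * (c₅ + c₆ * Real.exp (-z)) ^ 2 =
      (8 - 4 * deriv (deriv F) z + 4 * F z) * (c₅ + c₆ * Real.exp (-z)) ^ 2
        - 12 * deriv F z * (ld C z * (c₅ + c₆ * Real.exp (-z))) * (c₅ + c₆ * Real.exp (-z))
        - 12 * F z * (ld C z * (c₅ + c₆ * Real.exp (-z))) ^ 2 := by rw [scalAt, h3]; ring
  have hX := (Real.exp_pos (-z)).ne'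
  rw [hf.2.1 z hz, div_div_eq_mul_div, e4, e3, e0, e1, e2, div_eq_iff hX]
  generalize Real.exp (-z) = X at *
  field_simp
  linear_combination 2 * X ^ 2 * (-24 * c₅ * X ^ 2 * h1 + 24 * c₆ * h2)

/-- Integrating the Einstein equations: with `u = C ^ (-1/2)`, the functions `u`, `u'` and the products of
`w ± 3 F'` with `u⁻¹` are combinations of exponentials, and `F` is a linear combination of `1`, of
`w ± 3 F'` and of `h` times these. -/
theorem IsEinstein.exists_form {I : Set ℝ} (h : IsSmoothPair I F C) (hI : I.OrdConnected)
    (hE : IsEinstein I (met F C)) :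
    ∃ c₁ c₂ c₃ c₄ c₅ c₆ : ℝ, HasEinsteinForm I F C c₁ c₂ c₃ c₄ c₅ c₆ := by
  obtain ⟨A, B, hAB⟩ := weyl_halves h hI (fun z hz => ((isEinstein_iff h).1 hE z hz).1)
    fun z hz => beta_of_einstein h hE hz
  have hβ := fun z hz => beta_of_einstein h hE (z := z) hz
  rw [isEinstein_iff h] at hE
  -- `u = C ^ (-1/2)` satisfies `u'' = u / 4`.
  have hu : ∀ z ∈ I, HasDerivAt (fun z => (√(C z))⁻¹) (-ld C z / 2 * (√(C z))⁻¹) z := by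
    intro z hz
    have h2 := (Real.sqrt_pos.2 (h.pos_C z hz)).ne'
    refine (((h.hasDerivAt_C hz).sqrt (h.pos_C z hz).ne').inv h2).congr_deriv ?_
    have h1 := Real.sq_sqrt (h.pos_C z hz).le
    field_simp
    rw [h1]
    ring
  have ha := exists_eq_exp_of_hasDerivAt h.isOpen hI (k := 1 / 2)
    (f := fun z => (-ld C z / 2 + 1 / 2) * (√(C z))⁻¹) fun z hz => by
      refine ((((h.hasDerivAt_ld hz).neg.div_const 2).add_const (1 / 2)).mul
        (hu z hz)).congr_deriv ?_
      have h1 := (hE z hz).2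
      simp only [Pi.neg_apply]
      linear_combination (-(√(C z))⁻¹ / 4) * h1
  have hb := exists_eq_exp_of_hasDerivAt h.isOpen hI (k := -(1 / 2))
    (f := fun z => (-ld C z / 2 - 1 / 2) * (√(C z))⁻¹) fun z hz => by
      refine ((((h.hasDerivAt_ld hz).neg.div_const 2).sub_const (1 / 2)).mul
        (hu z hz)).congr_deriv ?_
      have h1 := (hE z hz).2
      simp only [Pi.neg_apply]
      linear_combination (-(√(C z))⁻¹ / 4) * h1
  obtain ⟨a, ha⟩ := ha
  obtain ⟨b, hb⟩ := hb
  refine ⟨-(B * b) / 6, B * a / 6, -(A * b) / 6, A * a / 6, a, -b, fun z hz => ?_, fun z hz => ?_,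
    by ring, by ring⟩
  · obtain ⟨h1, h2⟩ := hAB z hz
    have h3 := ha z hz
    have h4 := hb z hz
    have h5 := (hE z hz).1
    have h6 := hβ z hz
    have hs := (Real.sqrt_pos.2 (h.pos_C z hz)).ne'
    have e1 : Real.exp (3 / 2 * z) = Real.exp (z / 2) ^ 3 := by
      rw [← Real.exp_nat_mul]; congr 1; push_cast; ring
    have e2 : Real.exp (-(3 / 2) * z) = (Real.exp (z / 2) ^ 3)⁻¹ := by
      rw [← e1, ← Real.exp_neg]; congr 1; ring
    have e3 : Real.exp (1 / 2 * z) = Real.exp (z / 2) := by congr 1; ring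
    have e4 : Real.exp (-(1 / 2) * z) = (Real.exp (z / 2))⁻¹ := by
      rw [← Real.exp_neg]; congr 1; ring
    have e5 : Real.exp (-z) = (Real.exp (z / 2) ^ 2)⁻¹ := by
      rw [← Real.exp_nat_mul, ← Real.exp_neg]; congr 1; push_cast; ring
    have hE0 := (Real.exp_pos (z / 2)).ne'
    rw [exp_neg_two_mul, exp_two_mul, exp_eq_inv z, e5]
    rw [e1] at h1
    rw [e2] at h2
    rw [e3] at h3
    rw [e4] at h4
    simp only [alphaAt, wv] at h1 h2 h5
    generalize Real.exp (z / 2) = E at *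
    have hu0 : (√(C z))⁻¹ = a * E - b * E⁻¹ := by linear_combination h3 - h4
    have hv0 : -ld C z * (√(C z))⁻¹ = a * E + b * E⁻¹ := by linear_combination h3 + h4
    have hP : wv F z + 3 * deriv F z = A * E ^ 3 * (√(C z))⁻¹ := by
      rw [← h1, wv]; field_simp
    have hM : wv F z - 3 * deriv F z = B * (E ^ 3)⁻¹ * (√(C z))⁻¹ := by
      rw [← h2, wv]; field_simp
    have hPh : (wv F z + 3 * deriv F z) * (-ld C z) = A * E ^ 3 * (a * E + b * E⁻¹) := by
      rw [hP, ← hv0]; ring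
    have hMh : (wv F z - 3 * deriv F z) * (-ld C z) = B * (E ^ 3)⁻¹ * (a * E + b * E⁻¹) := by
      rw [hM, ← hv0]; ring
    rw [hu0] at hP hM
    rw [wv] at hP hM hPh hMh
    have : F z = 1 + (A * E ^ 3 * (a * E - b * E⁻¹) + B * (E ^ 3)⁻¹ * (a * E - b * E⁻¹)) / 8
        - (A * E ^ 3 * (a * E + b * E⁻¹) - B * (E ^ 3)⁻¹ * (a * E + b * E⁻¹)) / 24 := by
      linear_combination (hP + hM) / 8 - (hPh - hMh) / 24 - h5 / 4
    rw [this]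
    field_simp
    ring
  · have h3 := ha z hz
    have h4 := hb z hz
    have hs := Real.sq_sqrt (h.pos_C z hz).le
    have hs0 := (Real.sqrt_pos.2 (h.pos_C z hz)).ne'
    have hu0 : (√(C z))⁻¹ = a * Real.exp (1 / 2 * z) - b * Real.exp (-(1 / 2) * z) := by
      linear_combination h3 - h4
    have e5 : Real.exp (-z) = (Real.exp (1 / 2 * z) ^ 2)⁻¹ := by
      rw [← Real.exp_nat_mul, ← Real.exp_neg]; congr 1; push_cast; ring
    have e4 : Real.exp (-(1 / 2) * z) = (Real.exp (1 / 2 * z))⁻¹ := by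
      rw [← Real.exp_neg]; congr 1; ring
    have hE0 := (Real.exp_pos (1 / 2 * z)).ne'
    have hE1 : a + -b * Real.exp (-z) = (√(C z))⁻¹ * (Real.exp (1 / 2 * z))⁻¹ := by
      rw [hu0, e4, e5]; field_simp; ring
    rw [hE1, e5, mul_pow, inv_pow (√(C z)), hs]
    have := (h.pos_C z hz).ne'
    field_simp

end

/-! ### Bach-flat metrics are conformally Einstein -/

section

variable {S : Set ℝ} {F C : ℝ → ℝ}

/-- Integrating the Bach equations: the linear equation gives the exponential form of `F`, and the
quadratic one the relation between the constants. -/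
theorem exists_form_of_bach {I : Set ℝ} (h : IsSmoothPair I F C) (hI : I.OrdConnected)
    (hne : I.Nonempty) (hB : ∀ z ∈ I, bachQ F z = 0 ∧ bachL F z = 0) :
    ∃ c₁ c₂ c₃ c₄ : ℝ, (∀ z ∈ I, F z = 1 + c₁ / 2 * Real.exp (-2 * z) + c₂ * Real.exp (-z)
      + c₃ * Real.exp z + c₄ / 2 * Real.exp (2 * z)) ∧ c₁ * c₄ = c₂ * c₃ := by
  have hk : ∀ k p q r : ℝ, (∀ z ∈ I, k * (deriv (deriv (deriv F)) z + p * deriv (deriv F) z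
      + q * deriv F z + r * (F z - 1)) = 5 * deriv (deriv F) z - 4 * F z + 4
        + p * deriv (deriv (deriv F)) z + q * deriv (deriv F) z + r * deriv F z) →
      ∃ c, ∀ z ∈ I, deriv (deriv (deriv F)) z + p * deriv (deriv F) z + q * deriv F z
        + r * (F z - 1) = c * Real.exp (k * z) := by
    intro k p q r hpqr
    refine exists_eq_exp_of_hasDerivAt h.isOpen hI fun z hz => ?_
    refine ((((h.hasDerivAt_F3 hz).add ((h.hasDerivAt_F2 hz).const_mul p)).add
      ((h.hasDerivAt_F1 hz).const_mul q)).add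
      (((h.hasDerivAt_F hz).sub_const 1).const_mul r)).congr_deriv ?_
    have h1 := (hB z hz).2
    rw [bachL] at h1
    linear_combination h1 - hpqr z hz
  -- the four roots of the characteristic polynomial `k⁴ - 5 k² + 4`, with the cofactors
  obtain ⟨y₁, h₁⟩ := hk 1 1 (-4) (-4) fun z _ => by ring
  obtain ⟨y₂, h₂⟩ := hk (-1) (-1) (-4) 4 fun z _ => by ring
  obtain ⟨y₃, h₃⟩ := hk 2 2 (-1) (-2) fun z _ => by ring
  obtain ⟨y₄, h₄⟩ := hk (-2) (-2) (-1) 2 fun z _ => by ring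
  refine ⟨-y₄ / 6, y₂ / 6, -y₁ / 6, y₃ / 6, fun z hz => ?_, ?_⟩
  · have e1 := h₁ z hz
    have e2 := h₂ z hz
    have e3 := h₃ z hz
    have e4 := h₄ z hz
    simp only [one_mul] at e1
    simp only [neg_mul, one_mul] at e2 e4 ⊢
    linear_combination (e3 - e4 - 2 * (e1 - e2)) / 12
  · obtain ⟨z, hz⟩ := hne
    have e1 := h₁ z hz
    have e2 := h₂ z hz
    have e3 := h₃ z hz
    have e4 := h₄ z hz
    have hq := (hB z hz).1
    have m1 : Real.exp (1 * z) * Real.exp (-1 * z) = 1 := by rw [← Real.exp_add]; simp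
    have m2 : Real.exp (2 * z) * Real.exp (-2 * z) = 1 := by rw [← Real.exp_add]; simp
    have p1 : y₁ * y₂ = (deriv (deriv (deriv F)) z + 1 * deriv (deriv F) z + -4 * deriv F z
        + -4 * (F z - 1)) * (deriv (deriv (deriv F)) z + -1 * deriv (deriv F) z + -4 * deriv F z
        + 4 * (F z - 1)) := by
      rw [e1, e2]; linear_combination -(y₁ * y₂) * m1
    have p2 : y₃ * y₄ = (deriv (deriv (deriv F)) z + 2 * deriv (deriv F) z + -1 * deriv F z
        + -2 * (F z - 1)) * (deriv (deriv (deriv F)) z + -2 * deriv (deriv F) z + -1 * deriv F z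
        + 2 * (F z - 1)) := by
      rw [e3, e4]; linear_combination -(y₃ * y₄) * m2
    rw [bachQ] at hq
    linear_combination (p1 - p2) / 36 + hq / 12

theorem subsingleton_pole {c₅ c₆ : ℝ} (hc : c₅ ≠ 0 ∨ c₆ ≠ 0) :
    {z : ℝ | c₅ + c₆ * Real.exp (-z) = 0}.Subsingleton := by
  intro z hz y hy
  simp only [Set.mem_ofPred_eq] at hz hy
  have h6 : c₆ ≠ 0 := by
    rintro rfl
    rcases hc with hc | hc
    · exact hc (by simpa using hz)
    · exact hc rfl
  have h1 : Real.exp (-z) = Real.exp (-y) := mul_left_cancel₀ h6 (by linarith)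
  linarith [Real.exp_injective h1]

/-- The relation `c₁ c₄ = c₂ c₃` provides constants `c₅, c₆`, not both zero, for a conformal factor; the
slice to be removed is the zero of `c₅ + c₆ e ^ (-z)`. -/
theorem IsBachFlat.exists_conformal (h : IsSmoothPair S F C) (hI : S.OrdConnected)
    (hne : S.Nonempty) (hB : IsBachFlat S (met F C)) :
    ∃ (Z : Set ℝ) (K : ℝ → ℝ), Z.Subsingleton ∧ ContDiffOn ℝ ∞ K (S \ Z) ∧
      (∀ z ∈ S \ Z, 0 < K z) ∧ IsEinstein (S \ Z) (met F K) := by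
  obtain ⟨c₁, c₂, c₃, c₄, hF, hdet⟩ := exists_form_of_bach h hI hne ((isBachFlat_iff h).1 hB)
  obtain ⟨c₅, c₆, hc, h1, h2⟩ : ∃ c₅ c₆ : ℝ, (c₅ ≠ 0 ∨ c₆ ≠ 0) ∧ c₁ * c₅ - c₂ * c₆ = 0 ∧
      c₃ * c₅ - c₄ * c₆ = 0 := by
    by_cases h12 : c₂ ≠ 0 ∨ c₁ ≠ 0
    · exact ⟨c₂, c₁, h12, by ring, by linarith⟩
    · push Not at h12
      by_cases h34 : c₄ ≠ 0 ∨ c₃ ≠ 0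
      · exact ⟨c₄, c₃, h34, by rw [h12.1, h12.2]; ring, by ring⟩
      · push Not at h34
        exact ⟨1, 0, by simp, by simp [h12], by simp [h34]⟩
  have hcl : IsClosed {z : ℝ | c₅ + c₆ * Real.exp (-z) = 0} :=
    isClosed_eq (by fun_prop) continuous_const
  have hK : ContDiffOn ℝ ∞ (fun z => Real.exp (-z) / (c₅ + c₆ * Real.exp (-z)) ^ 2)
      (S \ {z : ℝ | c₅ + c₆ * Real.exp (-z) = 0}) :=
    ContDiffOn.div (by fun_prop) (by fun_prop) fun z hz => pow_ne_zero 2 hz.2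
  have hK0 : ∀ z ∈ S \ {z : ℝ | c₅ + c₆ * Real.exp (-z) = 0},
      0 < Real.exp (-z) / (c₅ + c₆ * Real.exp (-z)) ^ 2 := fun z hz =>
    div_pos (Real.exp_pos _) (sq_pos_of_ne_zero hz.2)
  refine ⟨_, _, subsingleton_pole hc, hK, hK0, ?_⟩
  have h' : IsSmoothPair (S \ {z : ℝ | c₅ + c₆ * Real.exp (-z) = 0}) F
      fun z => Real.exp (-z) / (c₅ + c₆ * Real.exp (-z)) ^ 2 :=
    ⟨h.isOpen.sdiff hcl, h.smooth_F.mono Set.sdiff_subset, hK, fun z hz => h.pos_F z hz.1, hK0⟩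
  exact HasEinsteinForm.isEinstein h' ⟨fun z hz => hF z hz.1, fun _ _ => rfl, h1, h2⟩

/-- The Bach equations only involve `F`, and extend to the removed slice by continuity. -/
theorem isBachFlat_of_conformal (h : IsSmoothPair S F C) {Z : Set ℝ} {K : ℝ → ℝ}
    (hZ : Z.Subsingleton) (hK : ContDiffOn ℝ ∞ K (S \ Z)) (hK0 : ∀ z ∈ S \ Z, 0 < K z)
    (hE : IsEinstein (S \ Z) (met F K)) : IsBachFlat S (met F C) := by
  have h' : IsSmoothPair (S \ Z) F K :=
    ⟨h.isOpen.sdiff hZ.isClosed, h.smooth_F.mono Set.sdiff_subset, hK,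
      fun z hz => h.pos_F z hz.1, hK0⟩
  have hB := fun z hz => hE.isBachFlat h' (z := z) hz
  have h1 := ContDiffOn.deriv_infty h.isOpen h.smooth_F
  have h2 := ContDiffOn.deriv_infty h.isOpen h1
  have h3 := ContDiffOn.deriv_infty h.isOpen h2
  have h4 := ContDiffOn.deriv_infty h.isOpen h3
  have h0 := h.smooth_F
  have hQ : ContinuousOn (bachQ F) S := by
    have := h0.continuousOn
    have := h1.continuousOn
    have := h2.continuousOn
    have := h3.continuousOn
    unfold bachQ
    fun_prop
  have hL : ContinuousOn (bachL F) S := by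
    have := h0.continuousOn
    have := h2.continuousOn
    have := h4.continuousOn
    unfold bachL
    fun_prop
  have ext : ∀ f : ℝ → ℝ, ContinuousOn f S → (∀ z ∈ S \ Z, f z = 0) → ∀ z ∈ S, f z = 0 := by
    intro f hf hf0 z hz
    -- `S \ Z` is dense in `S`
    by_contra hne
    have hev := (hf.continuousAt (h.isOpen.mem_nhds hz)).eventually_ne hne
    obtain ⟨y, ⟨hy0, hyS⟩, hyz⟩ := (((hev.and (h.isOpen.mem_nhds hz)).filter_mono
      nhdsWithin_le_nhds).and (self_mem_nhdsWithin : {z}ᶜ ∈ nhdsWithin z {z}ᶜ)).exists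
    have hzZ : z ∈ Z := by_contra fun hzZ => hne (hf0 z ⟨hz, hzZ⟩)
    exact hy0 (hf0 y ⟨hyS, fun hyZ => hyz (hZ hyZ hzZ)⟩)
  rw [isBachFlat_iff h]
  exact fun z hz => ⟨ext _ hQ (fun y hy => (hB y hy).1) z hz,
    ext _ hL (fun y hy => (hB y hy).2) z hz⟩

end

/-! ### Averaging over the unit sphere -/

section

variable {S : Set ℝ}

theorem ContDiffOn.D (hS : IsOpen S) {k : ℍ[ℝ] → ℝ} (hk : ContDiffOn ℝ ∞ k (region S))
    (a : Fin 4) : ContDiffOn ℝ ∞ (U2.D a k) (region S) :=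
  (hk.fderiv_of_isOpen (isOpen_region hS) (by simp)).clm_apply
    (contDiff_id.mul contDiff_const).contDiffOn

/-- The flow of the frame field `E_a`: right multiplication by `flow a t` for time `t`. -/
noncomputable def flow (a : Fin 4) (t : ℝ) : ℍ[ℝ] :=
  if a = 0 then ((Real.exp t : ℝ) : ℍ[ℝ]) else ((Real.cos t : ℝ) : ℍ[ℝ]) + Real.sin t • fr a

theorem flow_zero (a : Fin 4) : flow a 0 = 1 := by
  simp [flow]

theorem fr_mul_self {a : Fin 4} (ha : a ≠ 0) : fr a * fr a = -1 := by
  revert a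
  simp only [forall_fin_four]
  refine ⟨fun h => absurd rfl h, ?_, ?_, ?_⟩ <;> intro _ <;> ext <;>
    simp only [Quaternion.re_mul, Quaternion.imI_mul, Quaternion.imJ_mul, Quaternion.imK_mul] <;>
    simp [fr]

theorem fr_zero : fr 0 = 1 := by
  ext <;> simp [fr]

theorem hasDerivAt_coe_real {f : ℝ → ℝ} {f' t : ℝ} (h : HasDerivAt f f' t) :
    HasDerivAt (fun t => ((f t : ℝ) : ℍ[ℝ])) ((f' : ℝ) : ℍ[ℝ]) t := by
  have h1 := h.smul_const (1 : ℍ[ℝ])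
  simpa [← Quaternion.coe_mul_eq_smul] using h1

theorem hasDerivAt_flow (a : Fin 4) (t : ℝ) : HasDerivAt (flow a) (flow a t * fr a) t := by
  by_cases ha : a = 0
  · subst ha
    simp only [flow, if_true, fr_zero, mul_one]
    exact hasDerivAt_coe_real (Real.hasDerivAt_exp t)
  · have h1 := (hasDerivAt_coe_real (Real.hasDerivAt_cos t)).add
      ((Real.hasDerivAt_sin t).smul_const (fr a))
    have h2 : flow a = fun t => ((Real.cos t : ℝ) : ℍ[ℝ]) + Real.sin t • fr a := by
      funext t; simp [flow, ha]
    rw [h2]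
    refine h1.congr_deriv ?_
    rw [add_mul, smul_mul_assoc, fr_mul_self ha, Quaternion.coe_mul_eq_smul]
    simp only [Quaternion.coe_neg, smul_neg]
    rw [← mul_one ((Real.sin t : ℝ) : ℍ[ℝ]), Quaternion.coe_mul_eq_smul, add_comm]

theorem hasDerivAt_mul_flow (x : ℍ[ℝ]) (a : Fin 4) (t : ℝ) :
    HasDerivAt (fun t => x * flow a t) (x * flow a t * fr a) t := by
  rw [mul_assoc]
  exact (hasDerivAt_flow a t).const_mul x

theorem norm_flow {a : Fin 4} (ha : a ≠ 0) (t : ℝ) : ‖flow a t‖ = 1 := by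
  have h : ‖flow a t‖ * ‖flow a t‖ = 1 := by
    rw [← Quaternion.normSq_eq_norm_mul_self, Quaternion.normSq_def']
    revert a
    simp only [forall_fin_four]
    refine ⟨fun h => absurd rfl h, ?_, ?_, ?_⟩ <;> intro _ <;>
      simp [flow, Quaternion.re_smul, Quaternion.imI_smul, Quaternion.imJ_smul,
        Quaternion.imK_smul] <;>
      simp [fr]
  nlinarith [norm_nonneg (flow a t)]

theorem log_norm_mul_flow {x : ℍ[ℝ]} (hx : x ≠ 0) (a : Fin 4) (t : ℝ) :
    Real.log ‖x * flow a t‖ = Real.log ‖x‖ + if a = 0 then t else 0 := by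
  rw [norm_mul]
  by_cases ha : a = 0
  · subst ha
    simp only [flow, if_true]
    rw [Quaternion.norm_coe, Real.norm_eq_abs, abs_of_pos (Real.exp_pos t),
      Real.log_mul (norm_ne_zero_iff.2 hx) (Real.exp_pos t).ne', Real.log_exp]
  · simp [norm_flow ha, ha]

theorem flow_ne_zero (a : Fin 4) (t : ℝ) : flow a t ≠ 0 := by
  by_cases ha : a = 0
  · simp only [flow, ha, if_true]
    rw [← norm_ne_zero_iff, Quaternion.norm_coe, norm_ne_zero_iff]
    exact (Real.exp_pos t).ne'
  · rw [← norm_ne_zero_iff, norm_flow ha]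
    exact one_ne_zero

/-- Differentiating along the flow of `E_a`. -/
theorem hasDerivAt_comp_flow (hS : IsOpen S) {k : ℍ[ℝ] → ℝ} (hk : ContDiffOn ℝ ∞ k (region S))
    {x : ℍ[ℝ]} (a : Fin 4) {t : ℝ} (hx : x * flow a t ∈ region S) :
    HasDerivAt (fun t => k (x * flow a t)) (D a k (x * flow a t)) t :=
  ((hk.differentiableOn (by simp)).differentiableAt
    ((isOpen_region hS).mem_nhds hx)).hasFDerivAt.comp_hasDerivAt t (hasDerivAt_mul_flow x a t)

/-- The group of unit quaternions, with its Borel sets. -/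
noncomputable instance instMeasurableSpaceUnit :
    MeasurableSpace (Metric.sphere (0 : ℍ[ℝ]) 1) := borel _

instance instBorelSpaceUnit : BorelSpace (Metric.sphere (0 : ℍ[ℝ]) 1) := ⟨rfl⟩

/-- The point of the sphere of radius `e ^ z` parametrised by the unit quaternion `q`; the inverse
turns right multiplication by unit quaternions into left multiplication on the parameter. -/
noncomputable def pt (z : ℝ) (q : Metric.sphere (0 : ℍ[ℝ]) 1) : ℍ[ℝ] :=
  Real.exp z • ((q⁻¹ : Metric.sphere (0 : ℍ[ℝ]) 1) : ℍ[ℝ])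

theorem norm_pt (z : ℝ) (q : Metric.sphere (0 : ℍ[ℝ]) 1) : ‖pt z q‖ = Real.exp z := by
  rw [pt, norm_smul, norm_eq_of_mem_sphere, mul_one, Real.norm_eq_abs, abs_of_pos (Real.exp_pos z)]

theorem pt_ne_zero (z : ℝ) (q : Metric.sphere (0 : ℍ[ℝ]) 1) : pt z q ≠ 0 := by
  rw [← norm_ne_zero_iff, norm_pt]
  exact (Real.exp_pos z).ne'

theorem log_norm_pt (z : ℝ) (q : Metric.sphere (0 : ℍ[ℝ]) 1) : Real.log ‖pt z q‖ = z := by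
  rw [norm_pt, Real.log_exp]

theorem continuous_pt (z : ℝ) : Continuous (pt z) := by
  exact (continuous_subtype_val.comp continuous_inv).const_smul (Real.exp z)

theorem pt_mem_region {z : ℝ} (hz : z ∈ S) (q : Metric.sphere (0 : ℍ[ℝ]) 1) :
    pt z q ∈ region S :=
  ⟨pt_ne_zero z q, by rwa [log_norm_pt]⟩

theorem pt_mul_flow_mem (a : Fin 4) {z t : ℝ} (hz : z + (if a = 0 then t else 0) ∈ S)
    (q : Metric.sphere (0 : ℍ[ℝ]) 1) : pt z q * flow a t ∈ region S :=
  ⟨mul_ne_zero (pt_ne_zero z q) (flow_ne_zero a t), by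
    rwa [log_norm_mul_flow (pt_ne_zero z q), log_norm_pt]⟩

/-- The average of a function over the sphere of radius `e ^ z`, up to normalisation. -/
noncomputable def avg (k : ℍ[ℝ] → ℝ) (z : ℝ) : ℝ :=
  ∫ q : Metric.sphere (0 : ℍ[ℝ]) 1, k (pt z q) ∂MeasureTheory.Measure.haar

theorem continuous_comp_pt {k : ℍ[ℝ] → ℝ} (hk : ContinuousOn k (region S)) {z : ℝ} (hz : z ∈ S) :
    Continuous fun q => k (pt z q) :=
  hk.comp_continuous (continuous_pt z) fun q => pt_mem_region hz q

theorem integrable_comp_pt {k : ℍ[ℝ] → ℝ} (hk : ContinuousOn k (region S)) {z : ℝ} (hz : z ∈ S) :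
    MeasureTheory.Integrable (fun q => k (pt z q)) MeasureTheory.Measure.haar :=
  (continuous_comp_pt hk hz).integrable_of_hasCompactSupport (HasCompactSupport.of_compactSpace _)

theorem hasDerivAt_integral_flow (hS : IsOpen S) {k : ℍ[ℝ] → ℝ}
    (hk : ContDiffOn ℝ ∞ k (region S)) (a : Fin 4) {z : ℝ} (hz : z ∈ S) :
    HasDerivAt (fun t => ∫ q : Metric.sphere (0 : ℍ[ℝ]) 1, k (pt z q * flow a t)
      ∂MeasureTheory.Measure.haar) (avg (D a k) z) 0 := by
  obtain ⟨δ, hδ, hball⟩ := Metric.isOpen_iff.1 hS z hz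
  have hmem : ∀ t ∈ Metric.closedBall (0 : ℝ) (δ / 2), z + (if a = 0 then t else 0) ∈ S := by
    intro t ht
    refine hball ?_
    rw [Metric.mem_closedBall, dist_zero_right] at ht
    rw [Metric.mem_ball, Real.dist_eq]
    split_ifs
    · simpa using ht.trans_lt (half_lt_self hδ)
    · simpa using hδ
  have hmem' : ∀ t ∈ Metric.ball (0 : ℝ) (δ / 2), ∀ q, pt z q * flow a t ∈ region S :=
    fun t ht q => pt_mul_flow_mem a (hmem t (Metric.ball_subset_closedBall ht)) q
  have hDk := (ContDiffOn.D hS hk a).continuousOn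
  have hflow : Continuous (flow a) :=
    continuous_iff_continuousAt.2 fun t => (hasDerivAt_flow a t).continuousAt
  have hcont : ContinuousOn (fun p : ℝ × Metric.sphere (0 : ℍ[ℝ]) 1 =>
      D a k (pt z p.2 * flow a p.1)) (Metric.closedBall 0 (δ / 2) ×ˢ Set.univ) := by
    refine hDk.comp ?_ fun p hp => pt_mul_flow_mem a (hmem p.1 hp.1) p.2
    exact (((continuous_pt z).comp continuous_snd).mul (hflow.comp continuous_fst)).continuousOn
  obtain ⟨M, hM⟩ := ((isCompact_closedBall (0 : ℝ) (δ / 2)).prod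
    isCompact_univ).exists_bound_of_continuousOn hcont
  have hcomp : ∀ t ∈ Metric.ball (0 : ℝ) (δ / 2), ∀ k' : ℍ[ℝ] → ℝ, ContinuousOn k' (region S) →
      Continuous fun q => k' (pt z q * flow a t) := fun t ht k' hk' =>
    hk'.comp_continuous ((continuous_pt z).mul continuous_const) fun q => hmem' t ht q
  have hb := Metric.ball_mem_nhds (0 : ℝ) (half_pos hδ)
  have h0 := Metric.mem_ball_self (x := (0 : ℝ)) (half_pos hδ)
  have key := hasDerivAt_integral_of_dominated_loc_of_deriv_le
    (μ := (MeasureTheory.Measure.haar : MeasureTheory.Measure (Metric.sphere (0 : ℍ[ℝ]) 1)))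
    (F := fun t q => k (pt z q * flow a t)) (F' := fun t q => D a k (pt z q * flow a t))
    (x₀ := 0) (s := Metric.ball 0 (δ / 2)) (bound := fun _ => M) hb
    (by filter_upwards [hb] with t ht
        exact (hcomp t ht k hk.continuousOn).aestronglyMeasurable)
    ((hcomp 0 h0 k hk.continuousOn).integrable_of_hasCompactSupport
      (HasCompactSupport.of_compactSpace _))
    (hcomp 0 h0 _ hDk).aestronglyMeasurable
    (Filter.Eventually.of_forall fun q t ht =>
      hM (t, q) ⟨Metric.ball_subset_closedBall ht, Set.mem_univ _⟩)
    (MeasureTheory.integrable_const M)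
    (Filter.Eventually.of_forall fun q t ht =>
      hasDerivAt_comp_flow hS hk a (hmem' t ht q))
  simpa [avg, flow_zero] using key.2

theorem hasDerivAt_avg (hS : IsOpen S) {k : ℍ[ℝ] → ℝ} (hk : ContDiffOn ℝ ∞ k (region S)) {z : ℝ}
    (hz : z ∈ S) : HasDerivAt (avg k) (avg (D 0 k) z) z := by
  have h1 := hasDerivAt_integral_flow hS hk 0 hz
  have h2 : (fun t => ∫ q : Metric.sphere (0 : ℍ[ℝ]) 1, k (pt z q * flow 0 t)
      ∂MeasureTheory.Measure.haar) = fun t => avg k (z + t) := by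
    funext t
    refine MeasureTheory.integral_congr_ae (Filter.Eventually.of_forall fun q => ?_)
    simp only [pt, flow, if_true]
    congr 1
    rw [Real.exp_add, ← Quaternion.coe_commutes, Quaternion.coe_mul_eq_smul, smul_smul, mul_comm]
  rw [h2] at h1
  have h3 : HasDerivAt (fun y => y - z) 1 z := (hasDerivAt_id z).sub_const z
  have h4 := HasDerivAt.comp (h := fun y => y - z) (h₂ := fun t => avg k (z + t)) z
    (by simpa using h1) h3
  simpa [Function.comp_def] using h4

/-- Averages kill derivatives along the spheres, because right multiplication by unit quaternions
preserves the measure. -/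
theorem avg_D (hS : IsOpen S) {k : ℍ[ℝ] → ℝ} (hk : ContDiffOn ℝ ∞ k (region S)) {a : Fin 4}
    (ha : a ≠ 0) {z : ℝ} (hz : z ∈ S) : avg (D a k) z = 0 := by
  have h1 := hasDerivAt_integral_flow hS hk a hz
  have h2 : (fun t => ∫ q : Metric.sphere (0 : ℍ[ℝ]) 1, k (pt z q * flow a t)
      ∂MeasureTheory.Measure.haar) = fun _ => avg k z := by
    funext t
    let s : Metric.sphere (0 : ℍ[ℝ]) 1 := ⟨flow a t, by simp [norm_flow ha]⟩
    refine Eq.trans ?_ (MeasureTheory.integral_mul_left_eq_self (fun q => k (pt z q)) s⁻¹)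
    refine MeasureTheory.integral_congr_ae (Filter.Eventually.of_forall fun q => ?_)
    simp only [pt, mul_inv_rev, inv_inv]
    congr 1
    rw [smul_mul_assoc]
    rfl
  rw [h2] at h1
  exact h1.unique (hasDerivAt_const _ _)

theorem contDiffOn_avg (hS : IsOpen S) {k : ℍ[ℝ] → ℝ} (hk : ContDiffOn ℝ ∞ k (region S)) :
    ContDiffOn ℝ ∞ (avg k) S := by
  rw [contDiffOn_infty]
  intro n
  induction n generalizing k with
  | zero =>
    rw [Nat.cast_zero, contDiffOn_zero]
    exact fun z hz => (hasDerivAt_avg hS hk hz).continuousAt.continuousWithinAt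
  | succ n ih =>
    rw [Nat.cast_succ, contDiffOn_succ_iff_deriv_of_isOpen hS]
    refine ⟨fun z hz => (hasDerivAt_avg hS hk hz).differentiableAt.differentiableWithinAt,
      by simp, ?_⟩
    exact (ih (ContDiffOn.D hS hk 0)).congr fun z hz => (hasDerivAt_avg hS hk hz).deriv

theorem avg_pos {k : ℍ[ℝ] → ℝ} (hk : ContinuousOn k (region S)) (hpos : ∀ x ∈ region S, 0 < k x)
    {z : ℝ} (hz : z ∈ S) : 0 < avg k z := by
  refine (continuous_comp_pt hk hz).integral_pos_of_hasCompactSupport_nonneg_nonzero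
    (HasCompactSupport.of_compactSpace _) (fun q => (hpos _ (pt_mem_region hz q)).le)
    (x := 1) (hpos _ (pt_mem_region hz 1)).ne'

end

/-! ### Conformal changes of the metric -/

section

variable {S : Set ℝ} {F C : ℝ → ℝ} {x : ℍ[ℝ]}

theorem D_mul {f k : ℍ[ℝ] → ℝ} (hf : DifferentiableAt ℝ f x) (hk : DifferentiableAt ℝ k x)
    (a : Fin 4) : D a (fun y => f y * k y) x = D a f x * k x + f x * D a k x := by
  rw [D, D, D, (hf.hasFDerivAt.fun_mul hk.hasFDerivAt).fderiv]
  simp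
  ring

theorem D_add {f k : ℍ[ℝ] → ℝ} (hf : DifferentiableAt ℝ f x) (hk : DifferentiableAt ℝ k x)
    (a : Fin 4) : D a (fun y => f y + k y) x = D a f x + D a k x := by
  rw [D, D, D, (hf.hasFDerivAt.fun_add hk.hasFDerivAt).fderiv]
  simp

theorem D_sub {f k : ℍ[ℝ] → ℝ} (hf : DifferentiableAt ℝ f x) (hk : DifferentiableAt ℝ k x)
    (a : Fin 4) : D a (fun y => f y - k y) x = D a f x - D a k x := by
  rw [D, D, D, (hf.hasFDerivAt.fun_sub hk.hasFDerivAt).fderiv]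
  simp

theorem D_exp {f : ℍ[ℝ] → ℝ} (hf : DifferentiableAt ℝ f x) (r : ℝ) (a : Fin 4) :
    D a (fun y => Real.exp (r * f y)) x = Real.exp (r * f x) * (r * D a f x) := by
  rw [D, D, ((hf.hasFDerivAt.const_mul r).exp).fderiv]
  simp

theorem ContDiffOn.differentiableAt_region (hS : IsOpen S) {k : ℍ[ℝ] → ℝ}
    (hk : ContDiffOn ℝ ∞ k (region S)) (hx : x ∈ region S) : DifferentiableAt ℝ k x :=
  (hk.differentiableOn (by simp)).differentiableAt ((isOpen_region hS).mem_nhds hx)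

theorem differentiableAt_radial {φ : ℝ → ℝ} (hx : x ≠ 0) (h : DifferentiableAt ℝ φ (Real.log ‖x‖)) :
    DifferentiableAt ℝ (fun y : ℍ[ℝ] => φ (Real.log ‖y‖)) x :=
  (hasFDerivAt_radial hx h.hasDerivAt).differentiableAt

theorem differentiableAt_met (h : IsSmoothPair S F C) (hx : x ∈ region S) (a b : Fin 4) :
    DifferentiableAt ℝ (fun y => met F C y a b) x := by
  simp only [met_apply]
  split_ifs
  · exact differentiableAt_radial hx.1 (hasDerivAt_gv h hx.2 a).differentiableAt
  · exact differentiableAt_const _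

variable {g : Metric} {p : ℍ[ℝ] → ℝ}

theorem koszul_conformal (h : IsSmoothPair S F C) (hp : ContDiffOn ℝ ∞ p (region S))
    (hg : ∀ y ∈ region S, g y = Real.exp (2 * p y) • met F C y) (hx : x ∈ region S)
    (a b d : Fin 4) :
    koszul g a b d x = Real.exp (2 * p x) * (koszul (met F C) a b d x + D a p x * met F C x b d
      + D b p x * met F C x a d - D d p x * met F C x a b) := by
  have hpx := ContDiffOn.differentiableAt_region h.isOpen hp hx
  have hD : ∀ a b d, D a (fun y => g y b d) x = Real.exp (2 * p x) *
      (2 * D a p x * met F C x b d + D a (fun y => met F C y b d) x) := by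
    intro a b d
    have h1 : (fun y => g y b d) =ᶠ[nhds x] fun y => Real.exp (2 * p y) * met F C y b d := by
      filter_upwards [(isOpen_region h.isOpen).mem_nhds hx] with y hy
      rw [hg y hy]; rfl
    rw [D_congr h1, D_mul ((hpx.const_mul 2).exp) (differentiableAt_met h hx b d), D_exp hpx]
    ring
  simp only [koszul, hD, hg x hx, Matrix.smul_apply, smul_eq_mul]
  have hs : ∀ e, str a b e * (Real.exp (2 * p x) * met F C x e d)
      - str a d e * (Real.exp (2 * p x) * met F C x e b)
      - str b d e * (Real.exp (2 * p x) * met F C x e a) = Real.exp (2 * p x) *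
      (str a b e * met F C x e d - str a d e * met F C x e b - str b d e * met F C x e a) :=
    fun e => by ring
  simp only [hs, ← Finset.mul_sum]
  ring

theorem chr_conformal (h : IsSmoothPair S F C) (hp : ContDiffOn ℝ ∞ p (region S))
    (hg : ∀ y ∈ region S, g y = Real.exp (2 * p y) • met F C y) (hx : x ∈ region S)
    (a b d : Fin 4) :
    chr g a b d x = chr (met F C) a b d x + (if b = d then D a p x else 0)
      + (if a = d then D b p x else 0) - (if a = b then
        gv (F (Real.log ‖x‖)) (C (Real.log ‖x‖)) a / gv (F (Real.log ‖x‖)) (C (Real.log ‖x‖)) d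
          * D d p x else 0) := by
  have hF := h.pos_F _ hx.2
  have hC := h.pos_C _ hx.2
  have hinv : (g x)⁻¹ = (Real.exp (2 * p x))⁻¹ • (met F C x)⁻¹ := by
    have hdet : IsUnit (met F C x).det := by
      have : met F C x = Matrix.diagonal (gv (F (Real.log ‖x‖)) (C (Real.log ‖x‖))) := rfl
      rw [this, Matrix.det_diagonal, isUnit_iff_ne_zero]
      exact Finset.prod_ne_zero_iff.2 fun i _ => (gv_pos hF hC i).ne'
    refine Matrix.inv_eq_left_inv ?_
    rw [hg x hx, smul_mul_smul_comm, inv_mul_cancel₀ (Real.exp_pos _).ne', one_smul,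
      Matrix.nonsing_inv_mul _ hdet]
  have he := (Real.exp_pos (2 * p x)).ne'
  have hgd := (gv_pos hF hC d).ne'
  simp only [chr, koszul_conformal h hp hg hx, hinv, Matrix.smul_apply, smul_eq_mul,
    met_inv_apply hF hC, mul_ite, mul_zero, Finset.sum_ite_eq', Finset.mem_univ, if_true, met_apply]
  field_simp
  split_ifs <;> first | (subst_vars; field_simp; done) | (subst_vars; field_simp; ring)

theorem differentiableAt_chr_met (h : IsSmoothPair S F C) (hx : x ∈ region S) (a b d : Fin 4) :
    DifferentiableAt ℝ (chr (met F C) a b d) x := by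
  have h1 : chr (met F C) a b d =ᶠ[nhds x] fun y => if d = xr a b then
      gamAt F C (Real.log ‖y‖) a b else 0 := by
    filter_upwards [(isOpen_region h.isOpen).mem_nhds hx] with y hy using chr_met' h hy a b d
  refine DifferentiableAt.congr_of_eventuallyEq ?_ h1
  split_ifs
  · exact differentiableAt_radial hx.1 (hasDerivAt_gamAt h hx.2 a b).differentiableAt
  · exact differentiableAt_const _

/-- The derivative of `gv F C a / gv F C d`. -/
noncomputable def dquot (F C : ℝ → ℝ) (z : ℝ) (a d : Fin 4) : ℝ :=
  (dgv (F z) (C z) (deriv F z) (ld C z) a * gv (F z) (C z) d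
    - gv (F z) (C z) a * dgv (F z) (C z) (deriv F z) (ld C z) d) / gv (F z) (C z) d ^ 2

theorem D_chr_conformal (h : IsSmoothPair S F C) (hp : ContDiffOn ℝ ∞ p (region S))
    (hg : ∀ y ∈ region S, g y = Real.exp (2 * p y) • met F C y) (hx : x ∈ region S)
    (e a b d : Fin 4) :
    D e (chr g a b d) x = (if d = xr a b then if e = 0 then dgamAt F C (Real.log ‖x‖) a b else 0
        else 0) + (if b = d then D e (D a p) x else 0) + (if a = d then D e (D b p) x else 0)
      - (if a = b then (if e = 0 then dquot F C (Real.log ‖x‖) a d else 0) * D d p x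
        + gv (F (Real.log ‖x‖)) (C (Real.log ‖x‖)) a / gv (F (Real.log ‖x‖)) (C (Real.log ‖x‖)) d
          * D e (D d p) x else 0) := by
  have hP : ∀ a, DifferentiableAt ℝ (D a p) x := fun a =>
    ContDiffOn.differentiableAt_region h.isOpen (ContDiffOn.D h.isOpen hp a) hx
  have hq := (hasDerivAt_gv h hx.2 a).div (hasDerivAt_gv h hx.2 d)
    (gv_pos (h.pos_F _ hx.2) (h.pos_C _ hx.2) d).ne'
  have hqD := D_radial h.isOpen (f := fun y => gv (F (Real.log ‖y‖)) (C (Real.log ‖y‖)) a /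
    gv (F (Real.log ‖y‖)) (C (Real.log ‖y‖)) d) hx (fun y _ => rfl) hq e
  have hqd : DifferentiableAt ℝ (fun y : ℍ[ℝ] => gv (F (Real.log ‖y‖)) (C (Real.log ‖y‖)) a /
    gv (F (Real.log ‖y‖)) (C (Real.log ‖y‖)) d) x := differentiableAt_radial hx.1 hq.differentiableAt
  have h0 := differentiableAt_chr_met h hx a b d
  have hite : ∀ (c : Prop) [Decidable c] (f : ℍ[ℝ] → ℝ), DifferentiableAt ℝ f x →
      DifferentiableAt ℝ (fun y => if c then f y else 0) x ∧
        D e (fun y => if c then f y else 0) x = if c then D e f x else 0 := by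
    intro c _ f hf
    split_ifs
    · exact ⟨hf, rfl⟩
    · exact ⟨differentiableAt_const _, D_const _ _ _⟩
  have h1 : chr g a b d =ᶠ[nhds x] fun y => chr (met F C) a b d y + (if b = d then D a p y else 0)
      + (if a = d then D b p y else 0) - (if a = b then
        gv (F (Real.log ‖y‖)) (C (Real.log ‖y‖)) a / gv (F (Real.log ‖y‖)) (C (Real.log ‖y‖)) d
          * D d p y else 0) := by
    filter_upwards [(isOpen_region h.isOpen).mem_nhds hx] with y hy
      using chr_conformal h hp hg hy a b d
  have i1 := hite (b = d) _ (hP a)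
  have i2 := hite (a = d) _ (hP b)
  have i3 := hite (a = b) _ (hqd.mul (hP d))
  refine (D_congr h1 e).trans ((D_sub ((h0.add i1.1).add i2.1) i3.1 e).trans ?_)
  refine congrArg₂ HSub.hSub ((D_add (h0.add i1.1) i2.1 e).trans (congrArg₂ HAdd.hAdd
    ((D_add h0 i1.1 e).trans (congrArg₂ HAdd.hAdd (D_chr_met h hx e a b d) i1.2)) i2.2))
    (i3.2.trans ?_)
  split_ifs with h3 h4
  · refine (D_mul hqd (hP d) e).trans ?_
    rw [hqD, if_pos h4]; rfl
  · refine (D_mul hqd (hP d) e).trans ?_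
    rw [hqD, if_neg h4]
  · rfl

/-- The diagonal components of the Ricci tensor of `e ^ (2 p) g`, up to a multiple `r` of the metric:
with `∇² p` the Hessian, they are `Ric - 2 (∇² p - dp ⊗ dp)`. -/
theorem ric_conformal (h : IsSmoothPair S F C) (hp : ContDiffOn ℝ ∞ p (region S))
    (hg : ∀ y ∈ region S, g y = Real.exp (2 * p y) • met F C y) (hx : x ∈ region S) :
    ∃ r, ∀ b, ric g b b x = gv (F (Real.log ‖x‖)) (C (Real.log ‖x‖)) b *
      (ricAt F C (Real.log ‖x‖) b / C (Real.log ‖x‖) - 2 * (D b (D b p) x - D b p x ^ 2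
        - gamAt F C (Real.log ‖x‖) b b * D 0 p x) / gv (F (Real.log ‖x‖)) (C (Real.log ‖x‖)) b
        + r) := by
  have hF0 := (h.pos_F _ hx.2).ne'
  have hC0 := (h.pos_C _ hx.2).ne'
  refine ⟨-∑ a, (D a (D a p) x + 2 * D a p x ^ 2 - gamAt F C (Real.log ‖x‖) a a * D 0 p x) /
    gv (F (Real.log ‖x‖)) (C (Real.log ‖x‖)) a, fun b => ?_⟩
  simp only [ric, riem, D_chr_conformal h hp hg hx, chr_conformal h hp hg hx, chr_met' h hx, str_eq]
  simp only [gamAt, dgamAt, ricAt, dquot]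
  generalize Real.log ‖x‖ = z at *
  generalize deriv (deriv F) z = f2
  generalize deriv F z = f1
  generalize deriv (ld C) z = k1
  generalize ld C z = k
  generalize C z = c0 at *
  generalize F z = f at *
  revert b
  simp only [forall_fin_four, Fin.sum_univ_four]
  simp only [xr, gv, dgv, gam, dgam, strc, ricv, Matrix.cons_val, Fin.reduceEq, if_true, if_false]
  and_intros <;> (field_simp; ring)

/-- In terms of `f = e ^ (-p)` the metric `e ^ (2 p) g` is Einstein if and only if `f Ric + 2 ∇² f` is a
multiple of `g`.  This is linear in `f`, so that the average `k` of `f` over the spheres satisfies the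
diagonal part of this equation too. -/
theorem IsEinstein.avg_eq (h : IsSmoothPair S F C) (hp : ContDiffOn ℝ ∞ p (region S))
    (hg : ∀ y ∈ region S, g y = Real.exp (2 * p y) • met F C y) (hE : IsEinstein S g) {z : ℝ}
    (hz : z ∈ S) (b c : Fin 4) {k : ℝ → ℝ} (hk : k = avg fun x => Real.exp (-1 * p x)) :
    k z * (ricAt F C z b / C z) + 2 / gv (F z) (C z) b *
      ((if b = 0 then deriv (deriv k) z else 0) - gamAt F C z b b * deriv k z) =
    k z * (ricAt F C z c / C z) + 2 / gv (F z) (C z) c *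
      ((if c = 0 then deriv (deriv k) z else 0) - gamAt F C z c c * deriv k z) := by
  set f : ℍ[ℝ] → ℝ := fun x => Real.exp (-1 * p x) with hfdef
  have hf : ContDiffOn ℝ ∞ f (region S) := (contDiffOn_const.mul hp).exp
  have hD := fun a => ContDiffOn.D h.isOpen hf a
  have hDp := fun a => ContDiffOn.D h.isOpen hp a
  have hpd : ∀ {x}, x ∈ region S → DifferentiableAt ℝ p x := fun hx =>
    ContDiffOn.differentiableAt_region h.isOpen hp hx
  have h1 : ∀ a, ∀ x ∈ region S, D a f x = f x * (-1 * D a p x) := fun a x hx =>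
    D_exp (hpd hx) (-1) a
  have h2 : ∀ a, ∀ x ∈ region S, D a (D a f) x = f x * (D a p x ^ 2 - D a (D a p) x) := by
    intro a x hx
    have e1 : D a f =ᶠ[nhds x] fun y => f y * (-1 * D a p y) := by
      filter_upwards [(isOpen_region h.isOpen).mem_nhds hx] with y hy using h1 a y hy
    have e2 : DifferentiableAt ℝ (D a p) x :=
      ContDiffOn.differentiableAt_region h.isOpen (hDp a) hx
    have e3 : D a (fun y => -1 * D a p y) x = -1 * D a (D a p) x := by
      rw [D_mul (differentiableAt_const _) e2, D_const]; ring
    rw [D_congr e1, D_mul (ContDiffOn.differentiableAt_region h.isOpen hf hx) (e2.const_mul _), e3,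
      h1 a x hx]
    ring
  have h3 : ∀ x ∈ region S, Real.log ‖x‖ = z → ∀ b c,
      f x * (ricAt F C z b / C z) + 2 / gv (F z) (C z) b *
        (D b (D b f) x - gamAt F C z b b * D 0 f x) =
      f x * (ricAt F C z c / C z) + 2 / gv (F z) (C z) c *
        (D c (D c f) x - gamAt F C z c c * D 0 f x) := by
    intro x hx hxz
    obtain ⟨r, hr⟩ := ric_conformal h hp hg hx
    rw [hxz] at hr
    have key : ∀ b, f x * (ricAt F C z b / C z) + 2 / gv (F z) (C z) b *
        (D b (D b f) x - gamAt F C z b b * D 0 f x) =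
        f x * (scal g x / 4 * Real.exp (2 * p x) - r) := by
      intro b
      have hgv := (gv_pos (h.pos_F z hz) (h.pos_C z hz) b).ne'
      have e1 := hE x hx b b
      rw [tfRic, hr b, hg x hx, Matrix.smul_apply, met_apply, if_pos rfl, hxz, smul_eq_mul] at e1
      have e2 : ricAt F C z b / C z - 2 * (D b (D b p) x - D b p x ^ 2
          - gamAt F C z b b * D 0 p x) / gv (F z) (C z) b + r
          - scal g x / 4 * Real.exp (2 * p x) = 0 := by
        refine (mul_eq_zero.1 (Eq.trans ?_ e1)).resolve_left hgv
        ring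
      rw [h2 b x hx, h1 0 x hx]
      linear_combination f x * e2
    exact fun b c => (key b).trans (key c).symm
  have i1 := integrable_comp_pt hf.continuousOn hz
  have i2 := fun b => integrable_comp_pt (ContDiffOn.D h.isOpen (hD b) b).continuousOn hz
  have i3 := integrable_comp_pt (hD 0).continuousOn hz
  have h4 : ∀ b, ∫ q, (f (pt z q) * (ricAt F C z b / C z) + 2 / gv (F z) (C z) b *
      (D b (D b f) (pt z q) - gamAt F C z b b * D 0 f (pt z q))) ∂MeasureTheory.Measure.haar =
      avg f z * (ricAt F C z b / C z) + 2 / gv (F z) (C z) b *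
        (avg (D b (D b f)) z - gamAt F C z b b * avg (D 0 f) z) := by
    intro b
    have j2 := (i2 b).sub (i3.const_mul (gamAt F C z b b))
    refine (MeasureTheory.integral_add (i1.mul_const _)
      (j2.const_mul (2 / gv (F z) (C z) b))).trans ?_
    simp only [Pi.sub_apply]
    rw [MeasureTheory.integral_mul_const, MeasureTheory.integral_const_mul,
      MeasureTheory.integral_sub (i2 b) (i3.const_mul _), MeasureTheory.integral_const_mul]
    rfl
  have h5 : ∀ z ∈ S, deriv (avg f) z = avg (D 0 f) z := fun z hz =>
    (hasDerivAt_avg h.isOpen hf hz).deriv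
  have h6 : deriv (deriv (avg f)) z = avg (D 0 (D 0 f)) z := by
    have : deriv (avg f) =ᶠ[nhds z] avg (D 0 f) := by
      filter_upwards [h.isOpen.mem_nhds hz] with y hy using h5 y hy
    rw [this.deriv_eq, (hasDerivAt_avg h.isOpen (hD 0) hz).deriv]
  have h7 : ∀ b, avg (D b (D b f)) z = if b = 0 then deriv (deriv k) z else 0 := by
    intro b
    split_ifs with hb
    · rw [hk, h6, hb]
    · exact avg_D h.isOpen (hD b) hb hz
  have h8 := MeasureTheory.integral_congr_ae (μ := MeasureTheory.Measure.haar)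
    (Filter.Eventually.of_forall fun q => h3 (pt z q) (pt_mem_region hz q) (log_norm_pt z q) b c)
  rw [h4 b, h4 c, h7, h7, ← h5 z hz, ← hk] at h8
  exact h8

/-- If a `U(2)`-invariant metric is conformal to an Einstein metric, then averaging the inverse square
root of the conformal factor over the spheres gives an invariant conformal factor, because the
Einstein condition is linear in that function. -/
theorem IsConformallyEinstein.exists_radial (h : IsSmoothPair S F C)
    (hE : IsConformallyEinstein S (met F C)) :
    ∃ K : ℝ → ℝ, ContDiffOn ℝ ∞ K S ∧ (∀ z ∈ S, 0 < K z) ∧ IsEinstein S (met F K) := by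
  obtain ⟨u, hu, hu0, hE⟩ := hE
  have hp : ContDiffOn ℝ ∞ (fun x => Real.log (u x) / 2) (region S) :=
    (hu.log fun x hx => (hu0 x hx).ne').div_const 2
  have hg : ∀ y ∈ region S, (fun x => u x • met F C x) y =
      Real.exp (2 * (Real.log (u y) / 2)) • met F C y := by
    intro y hy
    simp only
    rw [mul_div_cancel₀ _ two_ne_zero, Real.exp_log (hu0 y hy)]
  have hf : ContDiffOn ℝ ∞ (fun x => Real.exp (-1 * (Real.log (u x) / 2))) (region S) :=
    (contDiffOn_const.mul hp).exp
  obtain ⟨k, hk⟩ : ∃ k, k = avg fun x => Real.exp (-1 * (Real.log (u x) / 2)) := ⟨_, rfl⟩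
  have hks : ContDiffOn ℝ ∞ k S := hk ▸ contDiffOn_avg h.isOpen hf
  have hk0 : ∀ z ∈ S, 0 < k z := fun z hz => by
    rw [hk]; exact avg_pos hf.continuousOn (fun x _ => Real.exp_pos _) hz
  have hK : IsSmoothPair S F fun z => C z / k z ^ 2 :=
    ⟨h.isOpen, h.smooth_F, h.smooth_C.div (hks.pow 2) fun z hz => pow_ne_zero 2 (hk0 z hz).ne',
      h.pos_F, fun z hz => div_pos (h.pos_C z hz) (pow_pos (hk0 z hz) 2)⟩
  have hld : ∀ z ∈ S, ld (fun z => C z / k z ^ 2) z = ld C z - 2 * (deriv k z / k z) := by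
    intro z hz
    have e1 := (h.hasDerivAt_C hz).div ((ContDiffOn.hasDerivAt_deriv h.isOpen hks hz).pow 2)
      (pow_ne_zero 2 (hk0 z hz).ne')
    have e2 := (h.pos_C z hz).ne'
    have e3 := (hk0 z hz).ne'
    have e4 : deriv (fun z => C z / k z ^ 2) z = _ := e1.deriv
    rw [ld, e4]
    simp only [Pi.pow_apply]
    field_simp
    ring
  have hld' : ∀ z ∈ S, deriv (ld fun z => C z / k z ^ 2) z = deriv (ld C) z
      - 2 * ((deriv (deriv k) z * k z - deriv k z ^ 2) / k z ^ 2) := by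
    intro z hz
    have e1 : (ld fun z => C z / k z ^ 2) =ᶠ[nhds z] fun z => ld C z - 2 * (deriv k z / k z) := by
      filter_upwards [h.isOpen.mem_nhds hz] with y hy using hld y hy
    rw [e1.deriv_eq]
    refine (((h.hasDerivAt_ld hz).sub (((ContDiffOn.hasDerivAt_deriv h.isOpen
      (ContDiffOn.deriv_infty h.isOpen hks) hz).div (ContDiffOn.hasDerivAt_deriv h.isOpen hks hz)
      (hk0 z hz).ne').const_mul 2)).congr_deriv ?_).deriv
    ring
  -- an invariant metric is Einstein as soon as the diagonal components agree
  refine ⟨_, hK.smooth_C, hK.pos_C, (isEinstein_iff hK).2 fun z hz => ?_⟩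
  have h01 := hE.avg_eq h hp hg hz 0 1 hk
  have h12 := hE.avg_eq h hp hg hz 1 2 hk
  rw [alphaAt, hld z hz, hld' z hz]
  have e1 := (h.pos_C z hz).ne'
  have e2 := (hk0 z hz).ne'
  have e3 := (h.pos_F z hz).ne'
  simp only [ricAt, ricv, gamAt, gam, gv, Matrix.cons_val, Fin.reduceEq, if_true, if_false]
    at h01 h12
  generalize deriv (deriv k) z = k2 at *
  generalize deriv k z = k1 at *
  generalize k z = k0 at *
  generalize deriv (deriv F) z = f2 at *
  generalize deriv F z = f1 at *
  generalize deriv (ld C) z = m1 at *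
  generalize ld C z = m at *
  generalize C z = c at *
  generalize F z = f at *
  clear * - h01 h12 e1 e2 e3
  field_simp at h01 h12 ⊢
  constructor
  · refine mul_left_cancel₀ e3 ?_
    linear_combination -h12 / 2
  · refine mul_left_cancel₀ (pow_ne_zero 2 e3) ?_
    linear_combination -k0 * h01 / 2

/-! ### Locality of the curvature -/

theorem chr_congr {g g' : Metric} (hS : IsOpen S) (hg : ∀ y ∈ region S, g y = g' y)
    (hx : x ∈ region S) (a b d : Fin 4) : chr g a b d x = chr g' a b d x := by
  have hD : ∀ a b d, D a (fun y => g y b d) x = D a (fun y => g' y b d) x := by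
    intro a b d
    refine D_congr ?_ a
    filter_upwards [(isOpen_region hS).mem_nhds hx] with y hy
    rw [hg y hy]
  simp only [chr, koszul, hD, hg x hx]

theorem riem_congr {g g' : Metric} (hS : IsOpen S) (hg : ∀ y ∈ region S, g y = g' y)
    (hx : x ∈ region S) (a b c d : Fin 4) : riem g a b c d x = riem g' a b c d x := by
  have hD : ∀ a b c d, D a (chr g b c d) x = D a (chr g' b c d) x := by
    intro a b c d
    refine D_congr ?_ a
    filter_upwards [(isOpen_region hS).mem_nhds hx] with y hy using chr_congr hS hg hy b c d
  simp only [riem, hD, chr_congr hS hg hx]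

theorem isEinstein_congr {g g' : Metric} (hS : IsOpen S) (hg : ∀ y ∈ region S, g y = g' y)
    (hE : IsEinstein S g') : IsEinstein S g := by
  intro x hx a b
  have h1 := hE x hx a b
  simp only [tfRic, scal, ric] at h1 ⊢
  simp only [riem_congr hS hg hx, hg x hx]
  exact h1

/-- The factor `K / C` turns `met F C` into `met F K`. -/
theorem isConformallyEinstein_of_radial (h : IsSmoothPair S F C) {K : ℝ → ℝ}
    (hK : ContDiffOn ℝ ∞ K S) (hK0 : ∀ z ∈ S, 0 < K z) (hE : IsEinstein S (met F K)) :
    IsConformallyEinstein S (met F C) := by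
  refine ⟨fun x => K (Real.log ‖x‖) / C (Real.log ‖x‖), ?_,
    fun x hx => div_pos (hK0 _ hx.2) (h.pos_C _ hx.2), isEinstein_congr h.isOpen (fun x hx => ?_) hE⟩
  · exact contDiffOn_radial (hK.div h.smooth_C fun z hz => (h.pos_C z hz).ne')
  · ext a b
    have h1 := (h.pos_C _ hx.2).ne'
    have h2 := (h.pos_F _ hx.2).ne'
    simp only [Matrix.smul_apply, met_apply, smul_eq_mul]
    generalize Real.log ‖x‖ = z at *
    split_ifs
    · revert a
      simp only [forall_fin_four]
      simp only [gv, Matrix.cons_val]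
      and_intros <;> intros <;> field_simp
    · simp

end

/-! ### Homotheties -/

section

variable {I I' : Set ℝ} {F C F' C' : ℝ → ℝ}

theorem re_inv_mul (x v : ℍ[ℝ]) : (x⁻¹ * v).re = (‖x‖ ^ 2)⁻¹ * Inner.inner ℝ x v := by
  rw [Quaternion.instInv, pow_two, ← Quaternion.normSq_eq_norm_mul_self]
  simp [Quaternion.inner_def, Quaternion.re_smul]

theorem inner_met (F C : ℝ → ℝ) (x v w : ℍ[ℝ]) : inner (met F C) x v w =
    ∑ a, gv (F (Real.log ‖x‖)) (C (Real.log ‖x‖)) a * co (x⁻¹ * v) a * co (x⁻¹ * w) a := by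
  simp only [inner, met_apply, ite_mul, zero_mul, Finset.sum_ite_eq, Finset.mem_univ, if_true]

/-- The diffeomorphism that acts by `z ↦ ε * z + t` on the coordinate `z = log ‖x‖` and trivially on
the sphere. -/
noncomputable def dil (ε t : ℝ) (x : ℍ[ℝ]) : ℍ[ℝ] :=
  Real.exp (t + (ε - 1) * Real.log ‖x‖) • x

theorem dil_ne_zero (ε t : ℝ) {x : ℍ[ℝ]} (hx : x ≠ 0) : dil ε t x ≠ 0 :=
  smul_ne_zero (Real.exp_pos _).ne' hx

theorem log_norm_dil (ε t : ℝ) {x : ℍ[ℝ]} (hx : x ≠ 0) :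
    Real.log ‖dil ε t x‖ = ε * Real.log ‖x‖ + t := by
  rw [dil, norm_smul, Real.norm_eq_abs, abs_of_pos (Real.exp_pos _),
    Real.log_mul (Real.exp_pos _).ne' (norm_ne_zero_iff.2 hx), Real.log_exp]
  ring

theorem dil_dil {ε : ℝ} (hε : ε ^ 2 = 1) (s t : ℝ) {x : ℍ[ℝ]} (hx : x ≠ 0) :
    dil ε s (dil ε t x) = Real.exp (s + ε * t) • x := by
  have h1 : dil ε s (dil ε t x) = Real.exp (s + (ε - 1) * Real.log ‖dil ε t x‖) • dil ε t x := rfl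
  rw [h1, log_norm_dil ε t hx, dil, smul_smul, ← Real.exp_add]
  congr 2
  linear_combination Real.log ‖x‖ * hε

theorem contDiffOn_dil (ε t : ℝ) (S : Set ℝ) : ContDiffOn ℝ ∞ (dil ε t) (region S) := by
  refine ContDiffOn.smul (ContDiffOn.exp (contDiffOn_const.add (contDiffOn_const.mul ?_)))
    contDiffOn_id
  exact contDiffOn_radial contDiffOn_id

theorem co_dil (ε t : ℝ) {x : ℍ[ℝ]} (hx : x ≠ 0) (v : ℍ[ℝ]) (a : Fin 4) :
    co ((dil ε t x)⁻¹ * fderiv ℝ (dil ε t) x v) a = (if a = 0 then ε else 1) * co (x⁻¹ * v) a := by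
  have h1 : HasDerivAt (fun z => Real.exp (t + (ε - 1) * z))
      (Real.exp (t + (ε - 1) * Real.log ‖x‖) * (ε - 1)) (Real.log ‖x‖) := by
    simpa using (((hasDerivAt_id (Real.log ‖x‖)).const_mul (ε - 1)).const_add t).exp
  have h2 := (hasFDerivAt_radial hx h1).smul (hasFDerivAt_id x)
  have h3 : fderiv ℝ (dil ε t) x = _ := h2.fderiv
  have h4 : (dil ε t x)⁻¹ * fderiv ℝ (dil ε t) x v
      = x⁻¹ * v + (((ε - 1) * (x⁻¹ * v).re : ℝ) : ℍ[ℝ]) := by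
    rw [h3, dil, re_inv_mul]
    have he := (Real.exp_pos (t + (ε - 1) * Real.log ‖x‖)).ne'
    generalize Real.exp (t + (ε - 1) * Real.log ‖x‖) = r at *
    have hr : (r • x)⁻¹ = r⁻¹ • x⁻¹ := by
      refine inv_eq_of_mul_eq_one_right ?_
      rw [smul_mul_smul_comm, mul_inv_cancel₀ he, mul_inv_cancel₀ hx, one_smul]
    rw [hr]
    simp only [add_apply, ContinuousLinearMap.smulRight_apply,
      smul_apply, innerSL_apply_apply, smul_eq_mul, id, mul_add,
      ContinuousLinearMap.id_apply, smul_mul_smul_comm, inv_mul_cancel₀ he, one_smul,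
      inv_mul_cancel₀ hx]
    congr 1
    rw [← mul_one ((_ : ℝ) : ℍ[ℝ]), Quaternion.coe_mul_eq_smul]
    congr 1
    field_simp
  rw [h4]
  revert a
  simp only [forall_fin_four]
  refine ⟨?_, ?_, ?_, ?_⟩ <;> simp [co]
  ring

/-- An affine change of the coordinate `z` that matches the functions is a homothety. -/
theorem homothetic_of_affine (hI : IsData I F C) {ε t l : ℝ} (hε : ε ^ 2 = 1) (hl : 0 < l)
    (hF : ∀ z ∈ I, F' (ε * z + t) = F z) (hC : ∀ z ∈ I, C' (ε * z + t) = l * C z) :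
    ∃ I', IsData I' F' C' ∧ Homothetic I F C I' F' C' := by
  have hinv : ∀ w, ε * (ε * (w - t)) + t = w := fun w => by linear_combination (w - t) * hε
  have hinv' : ∀ z, ε * (ε * z + t - t) = z := fun z => by linear_combination z * hε
  have hF' : ∀ w, ε * (w - t) ∈ I → F' w = F (ε * (w - t)) := fun w hw => by
    rw [← hF _ hw, hinv]
  have hC' : ∀ w, ε * (w - t) ∈ I → C' w = l * C (ε * (w - t)) := fun w hw => by
    rw [← hC _ hw, hinv]
  have hcd : ContDiff ℝ ∞ fun w : ℝ => ε * (w - t) := by fun_prop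
  refine ⟨{w | ε * (w - t) ∈ I}, ⟨hI.isOpen.preimage hcd.continuous, ?_, ?_, ?_, ?_, ?_, ?_⟩, ?_⟩
  · have h1 : Convex ℝ I := hI.ordConnected.convex
    have h2 : {w | ε * (w - t) ∈ I} = (AffineMap.lineMap (-(ε * t)) (ε * (1 - t))) ⁻¹' I := by
      ext w
      simp only [Set.mem_ofPred_eq, Set.mem_preimage, AffineMap.lineMap_apply_ring]
      rw [show (1 - w) * -(ε * t) + w * (ε * (1 - t)) = ε * (w - t) by ring]
    rw [h2]
    exact (h1.affine_preimage _).ordConnected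
  · obtain ⟨z, hz⟩ := hI.nonempty
    exact ⟨ε * z + t, by simpa only [Set.mem_ofPred_eq, hinv'] using hz⟩
  · exact (hI.smooth_F.comp hcd.contDiffOn fun w hw => hw).congr hF'
  · exact (contDiffOn_const.mul (hI.smooth_C.comp hcd.contDiffOn fun w hw => hw)).congr hC'
  · exact fun w hw => hF' w hw ▸ hI.pos_F _ hw
  · exact fun w hw => hC' w hw ▸ mul_pos hl (hI.pos_C _ hw)
  · refine ⟨dil ε t, dil ε (-(ε * t)), l, hl, contDiffOn_dil _ _ _, contDiffOn_dil _ _ _, ?_, ?_,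
      ⟨?_, ?_⟩, ?_, ?_⟩
    · intro x hx
      refine ⟨dil_ne_zero _ _ hx.1, ?_⟩
      rw [log_norm_dil _ _ hx.1]
      simpa only [Set.mem_ofPred_eq, hinv'] using hx.2
    · intro x hx
      refine ⟨dil_ne_zero _ _ hx.1, ?_⟩
      rw [log_norm_dil _ _ hx.1]
      have h1 := hx.2
      simp only [Set.mem_ofPred_eq] at h1
      convert h1 using 1
      ring
    · intro x hx
      rw [dil_dil hε _ _ hx.1]
      simp
    · intro x hx
      rw [dil_dil hε _ _ hx.1, show t + ε * -(ε * t) = 0 by linear_combination -t * hε]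
      simp
    · intro x hx q p hq hp _ _
      rw [dil, dil, norm_mul, norm_mul, hq, hp, one_mul, mul_one, mul_smul_comm, smul_mul_assoc]
    · intro x hx v w
      rw [inner_met, inner_met, log_norm_dil _ _ hx.1, hF _ hx.2, hC _ hx.2, Finset.mul_sum]
      refine Finset.sum_congr rfl fun a _ => ?_
      rw [co_dil _ _ hx.1, co_dil _ _ hx.1]
      have h0 := (hI.pos_F _ hx.2).ne'
      generalize co (x⁻¹ * v) a = y
      generalize co (x⁻¹ * w) a = y'
      revert a
      simp only [forall_fin_four]
      simp only [gv, Matrix.cons_val, Fin.reduceEq, if_true, if_false, Finset.mem_univ,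
        forall_true_left]
      refine ⟨?_, by ring, by ring, by ring⟩
      linear_combination l * C (Real.log ‖x‖) / (4 * F (Real.log ‖x‖)) * y * y' * hε

/-- Conjugation by a complex number rotates the orthogonal complement of the complex numbers. -/
theorem co_conj_sq {c : ℍ[ℝ]} (hc : c ≠ 0) (hJ : c.imJ = 0) (hK : c.imK = 0) :
    co (c⁻¹ * (fr 2 * c)) 0 = 0 ∧ co (c⁻¹ * (fr 2 * c)) 1 = 0 ∧
      co (c⁻¹ * (fr 2 * c)) 2 ^ 2 + co (c⁻¹ * (fr 2 * c)) 3 ^ 2 = 1 := by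
  have h1 : c.re ^ 2 + c.imI ^ 2 ≠ 0 := by
    have := Quaternion.normSq_ne_zero.2 hc
    rw [Quaternion.normSq_def', hJ, hK] at this
    simpa using this
  have h2 : c⁻¹ = (Quaternion.normSq c)⁻¹ • star c := rfl
  rw [h2, Quaternion.normSq_def', hJ, hK]
  simp only [co, Matrix.cons_val, smul_mul_assoc, Quaternion.re_smul, Quaternion.imI_smul,
    Quaternion.imJ_smul, Quaternion.imK_smul, Quaternion.re_mul, Quaternion.imI_mul,
    Quaternion.imJ_mul, Quaternion.imK_mul, Quaternion.re_star, Quaternion.imI_star,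
    Quaternion.imJ_star, Quaternion.imK_star, hJ, hK, smul_eq_mul]
  simp only [fr, Matrix.cons_val]
  refine ⟨by ring, by ring, ?_⟩
  field_simp
  ring

theorem eq_zero_of_commute_fr_one {c : ℍ[ℝ]} (h : fr 1 * c = c * fr 1) : c.imJ = 0 ∧ c.imK = 0 := by
  have h1 := congrArg (fun q : ℍ[ℝ] => q.imJ) h
  have h2 := congrArg (fun q : ℍ[ℝ] => q.imK) h
  simp only [Quaternion.imJ_mul, Quaternion.imK_mul] at h1 h2
  simp only [fr, Matrix.cons_val] at h1 h2
  constructor <;> linarith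

theorem co_fr (a b : Fin 4) : co (fr a) b = if a = b then 1 else 0 := by
  revert a b
  simp only [forall_fin_four]
  simp [co, fr]

theorem hasDerivAt_log_norm_curve {c : ℝ → ℍ[ℝ]} {c' : ℍ[ℝ]} {z : ℝ} (hc : HasDerivAt c c' z)
    (h0 : c z ≠ 0) : HasDerivAt (fun z => Real.log ‖c z‖) (co ((c z)⁻¹ * c') 0) z := by
  have h1 := (hasFDerivAt_log_norm h0).comp_hasDerivAt z hc
  exact h1.congr_deriv (re_inv_mul _ _).symm

/-- Every homothety comes from an affine change of the coordinate `z`.  Equivariance makes the image of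
the positive real axis a curve of complex numbers, and determines the map by this curve; comparing the
components of the metrics shows that the curve stays on a ray and that `log` of its modulus has
derivative `±1`. -/
theorem Homothetic.exists_affine (hI : IsData I F C) (hI' : IsData I' F' C')
    (h : Homothetic I F C I' F' C') : ∃ ε t l : ℝ, (ε = 1 ∨ ε = -1) ∧ 0 < l ∧
      ∀ z ∈ I, ε * z + t ∈ I' ∧ F' (ε * z + t) = F z ∧ C' (ε * z + t) = l * C z := by
  obtain ⟨Φ, -, l, hl, hΦ, -, hmaps, -, -, heq, hmet⟩ := h
  have hone : ∀ a, ‖fr a‖ = 1 := norm_fr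
  -- the image of the positive real axis
  obtain ⟨c, hc⟩ : ∃ c : ℝ → ℍ[ℝ], c = fun z => Φ ((Real.exp z : ℝ) : ℍ[ℝ]) := ⟨_, rfl⟩
  have hcm : ∀ z ∈ I, c z ∈ region I' := fun z hz => hc ▸ hmaps (exp_mem_region hz)
  have hleft : ∀ z ∈ I, ∀ q : ℍ[ℝ], ‖q‖ = 1 → Φ (q * ((Real.exp z : ℝ) : ℍ[ℝ])) = q * c z := by
    intro z hz q hq
    have := heq _ (exp_mem_region hz) q 1 hq (by simp) (by simp) (by simp)
    simpa [hc] using this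
  -- equivariance under left and right multiplication by `i`
  have hcomm : ∀ z ∈ I, fr 1 * c z = c z * fr 1 := by
    intro z hz
    have h1 := heq _ (exp_mem_region hz) 1 (fr 1) (by simp) (hone 1) (by simp [fr]) (by simp [fr])
    rw [← hleft z hz _ (hone 1), ← Quaternion.coe_commutes]
    simpa [hc] using h1
  have hd : ∀ z ∈ I, HasFDerivAt Φ (fderiv ℝ Φ ((Real.exp z : ℝ) : ℍ[ℝ]))
      ((Real.exp z : ℝ) : ℍ[ℝ]) := fun z hz =>
    ((hΦ.differentiableOn (by simp)).differentiableAt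
      ((isOpen_region hI.isOpen).mem_nhds (exp_mem_region hz))).hasFDerivAt
  have hc' : ∀ z ∈ I, HasDerivAt c (fderiv ℝ Φ ((Real.exp z : ℝ) : ℍ[ℝ])
      (((Real.exp z : ℝ) : ℍ[ℝ]) * fr 0)) z := by
    intro z hz
    rw [hc, fr_zero, mul_one]
    exact (hd z hz).comp_hasDerivAt z (hasDerivAt_coe_real (Real.hasDerivAt_exp z))
  have hfr : ∀ z ∈ I, ∀ a, a ≠ 0 → fderiv ℝ Φ ((Real.exp z : ℝ) : ℍ[ℝ])
      (((Real.exp z : ℝ) : ℍ[ℝ]) * fr a) = fr a * c z := by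
    intro z hz a ha
    have h1 := hasDerivAt_mul_flow ((Real.exp z : ℝ) : ℍ[ℝ]) a 0
    rw [flow_zero, mul_one] at h1
    have h2 := HasFDerivAt.comp_hasDerivAt_of_eq (0 : ℝ) (hd z hz) h1 (by rw [flow_zero, mul_one])
    have h3 : (Φ ∘ fun t => ((Real.exp z : ℝ) : ℍ[ℝ]) * flow a t) = fun t => flow a t * c z := by
      funext t
      rw [Function.comp_apply, Quaternion.coe_commutes, hleft z hz _ (norm_flow ha t)]
    rw [h3] at h2
    have h4 := (hasDerivAt_flow a 0).mul_const (c z)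
    rw [flow_zero, one_mul] at h4
    exact h2.unique h4
  -- comparing the components of the two metrics
  have hcomp : ∀ z ∈ I, ∃ n : ℝ, HasDerivAt (fun z => Real.log ‖c z‖) n z ∧ n ^ 2 = 1 ∧
      F' (Real.log ‖c z‖) = F z ∧ C' (Real.log ‖c z‖) = l * C z := by
    intro z hz
    have hm := hmet _ (exp_mem_region hz)
    have hcz := (hcm z hz).1
    have hx0 := (exp_mem_region hz).1
    have hF0 := hI.pos_F z hz
    have hC0 := hI.pos_C z hz
    have hF0' := hI'.pos_F _ (hcm z hz).2
    have hC0' := hI'.pos_C _ (hcm z hz).2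
    have hinv : ∀ a, ((Real.exp z : ℝ) : ℍ[ℝ])⁻¹ * (((Real.exp z : ℝ) : ℍ[ℝ]) * fr a) = fr a :=
      fun a => inv_mul_cancel_left₀ hx0 _
    have h00 := hm (((Real.exp z : ℝ) : ℍ[ℝ]) * fr 0) (((Real.exp z : ℝ) : ℍ[ℝ]) * fr 0)
    have h01 := hm (((Real.exp z : ℝ) : ℍ[ℝ]) * fr 0) (((Real.exp z : ℝ) : ℍ[ℝ]) * fr 1)
    have h11 := hm (((Real.exp z : ℝ) : ℍ[ℝ]) * fr 1) (((Real.exp z : ℝ) : ℍ[ℝ]) * fr 1)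
    have h22 := hm (((Real.exp z : ℝ) : ℍ[ℝ]) * fr 2) (((Real.exp z : ℝ) : ℍ[ℝ]) * fr 2)
    have hΦc : Φ ((Real.exp z : ℝ) : ℍ[ℝ]) = c z := by rw [hc]
    simp only [inner_met, hinv, log_norm_exp, hΦc, hfr z hz 1 (by decide), hfr z hz 2 (by decide)]
      at h00 h01 h11 h22
    have hD := hc' z hz
    obtain ⟨v, hv⟩ : ∃ v, v = fderiv ℝ Φ ((Real.exp z : ℝ) : ℍ[ℝ])
      (((Real.exp z : ℝ) : ℍ[ℝ]) * fr 0) := ⟨_, rfl⟩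
    rw [← hv] at h00 h01 hD
    have hccomm := hcomm z hz
    have hi : (c z)⁻¹ * (fr 1 * c z) = fr 1 := by rw [hccomm, inv_mul_cancel_left₀ hcz]
    have hvcomm : fr 1 * v = v * fr 1 := by
      refine (hD.const_mul (fr 1)).unique ((hD.mul_const (fr 1)).congr_of_eventuallyEq ?_)
      filter_upwards [hI.isOpen.mem_nhds hz] with y hy using hcomm y hy
    have hncomm : fr 1 * ((c z)⁻¹ * v) = (c z)⁻¹ * v * fr 1 := by
      rw [mul_assoc, ← hvcomm, ← mul_assoc, ← mul_assoc]
      congr 1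
      nth_rewrite 1 [← hi]
      rw [mul_assoc, mul_assoc, mul_inv_cancel₀ hcz, mul_one]
    obtain ⟨hn2, hn3⟩ := eq_zero_of_commute_fr_one hncomm
    obtain ⟨hJ, hK⟩ := eq_zero_of_commute_fr_one hccomm
    obtain ⟨k0, k1, k2⟩ := co_conj_sq hcz hJ hK
    have hn2' : co ((c z)⁻¹ * v) 2 = 0 := hn2
    have hn3' : co ((c z)⁻¹ * v) 3 = 0 := hn3
    rw [hi] at h01 h11
    have hd0 := hasDerivAt_log_norm_curve hD hcz
    simp only [Fin.sum_univ_four, co_fr, Fin.reduceEq, if_true, if_false, hn2', hn3', k0, k1, gv,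
      Matrix.cons_val] at h00 h01 h11 h22
    generalize co ((c z)⁻¹ * v) 0 = n0 at *
    generalize co ((c z)⁻¹ * v) 1 = n1 at *
    have e2 : C' (Real.log ‖c z‖) = l * C z := by linear_combination h22 - C' (Real.log ‖c z‖) * k2
    have e1 : F' (Real.log ‖c z‖) = F z := by
      rw [e2] at h11
      refine mul_left_cancel₀ (mul_pos hl hC0).ne' ?_
      linear_combination h11
    rw [e1, e2] at h00 h01
    have hn1 : n1 = 0 := by
      refine mul_left_cancel₀ (mul_pos (mul_pos hl hC0) hF0).ne' ?_
      linear_combination h01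
    refine ⟨n0, hd0, ?_, e1, e2⟩
    rw [hn1] at h00
    field_simp at h00
    linear_combination h00
  choose! n hn using hcomp
  have hncont : ContinuousOn n I := by
    have h1 : ContDiffOn ℝ ∞ (fun z => Real.log ‖c z‖) I := by
      have h2 : ContDiffOn ℝ ∞ c I := by
        rw [hc]
        refine hΦ.comp (ContDiff.contDiffOn ?_) fun z hz => exp_mem_region hz
        have : (fun z : ℝ => ((Real.exp z : ℝ) : ℍ[ℝ])) = fun z => Real.exp z • (1 : ℍ[ℝ]) := by
          funext z; rw [← Quaternion.coe_mul_eq_smul, mul_one]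
        rw [this]
        fun_prop
      exact ContDiffOn.log (h2.norm ℝ fun z hz => (hcm z hz).1)
        fun z hz => norm_ne_zero_iff.2 (hcm z hz).1
    exact (ContDiffOn.deriv_infty hI.isOpen h1).continuousOn.congr fun z hz => ((hn z hz).1.deriv).symm
  have hpre : IsPreconnected I := hI.ordConnected.isPreconnected
  obtain ⟨ε, hε, hnε⟩ : ∃ ε : ℝ, (ε = 1 ∨ ε = -1) ∧ ∀ z ∈ I, n z = ε := by
    rcases hpre.eq_or_eq_neg_of_sq_eq hncont continuousOn_const (g := fun _ => (1 : ℝ))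
      (fun z hz => by simpa using (hn z hz).2.1) (fun _ => one_ne_zero) with h1 | h1
    · exact ⟨1, Or.inl rfl, h1⟩
    · exact ⟨-1, Or.inr rfl, h1⟩
  obtain ⟨t, ht⟩ := exists_eq_const_of_hasDerivAt_zero hI.isOpen hI.ordConnected
    (f := fun z => Real.log ‖c z‖ - ε * z) fun z hz => by
      refine ((hn z hz).1.sub ((hasDerivAt_id z).const_mul ε)).congr_deriv ?_
      rw [hnε z hz]; ring
  have ht' : ∀ z ∈ I, Real.log ‖c z‖ = ε * z + t := fun z hz => by linarith [ht z hz]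
  refine ⟨ε, t, l, hε, hl, fun z hz => ?_⟩
  rw [← ht' z hz]
  exact ⟨(hcm z hz).2, (hn z hz).2.2⟩

end

/-! ### Normal forms up to homothety -/

/-- The pair `(F', C')` arises from `(F, C)` by an affine change of the coordinate `z` and by scaling
`C`. -/
def AffRel (S : Set ℝ) (F C F' C' : ℝ → ℝ) : Prop :=
  ∃ ε t l : ℝ, (ε = 1 ∨ ε = -1) ∧ 0 < l ∧ ∀ z ∈ S, F' (ε * z + t) = F z ∧ C' (ε * z + t) = l * C z

section

variable {S I I' : Set ℝ} {F C F' C' F'' C'' : ℝ → ℝ}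

theorem sq_eq_one_of_sign {ε : ℝ} (hε : ε = 1 ∨ ε = -1) : ε ^ 2 = 1 := by
  rcases hε with rfl | rfl <;> norm_num

theorem AffRel.homothetic (hI : IsData I F C) (h : AffRel I F C F' C') :
    ∃ I', IsData I' F' C' ∧ Homothetic I F C I' F' C' := by
  obtain ⟨ε, t, l, hε, hl, h⟩ := h
  exact homothetic_of_affine hI (sq_eq_one_of_sign hε) hl (fun z hz => (h z hz).1)
    fun z hz => (h z hz).2

theorem Homothetic.affRel (hI : IsData I F C) (hI' : IsData I' F' C')
    (h : Homothetic I F C I' F' C') : AffRel I F C F' C' := by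
  obtain ⟨ε, t, l, hε, hl, h⟩ := h.exists_affine hI hI'
  exact ⟨ε, t, l, hε, hl, fun z hz => (h z hz).2⟩

theorem mul_sign {ε ε' : ℝ} (hε : ε = 1 ∨ ε = -1) (hε' : ε' = 1 ∨ ε' = -1) :
    ε' * ε = 1 ∨ ε' * ε = -1 := by
  rcases hε with rfl | rfl <;> rcases hε' with rfl | rfl <;> norm_num

theorem AffRel.trans (h : AffRel S F C F' C') (h' : AffRel Set.univ F' C' F'' C'') :
    AffRel S F C F'' C'' := by
  obtain ⟨ε, t, l, hε, hl, h⟩ := h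
  obtain ⟨ε', t', l', hε', hl', h'⟩ := h'
  refine ⟨ε' * ε, ε' * t + t', l' * l, mul_sign hε hε', mul_pos hl' hl, fun z hz => ?_⟩
  obtain ⟨h1, h2⟩ := h z hz
  obtain ⟨h3, h4⟩ := h' (ε * z + t) (Set.mem_univ _)
  rw [show ε' * ε * z + (ε' * t + t') = ε' * (ε * z + t) + t' by ring, h3, h4, h1, h2, mul_assoc]
  exact ⟨rfl, rfl⟩

theorem AffRel.symm (h : AffRel Set.univ F C F' C') : AffRel Set.univ F' C' F C := by
  obtain ⟨ε, t, l, hε, hl, h⟩ := h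
  refine ⟨ε, -(ε * t), l⁻¹, hε, inv_pos.2 hl, fun z _ => ?_⟩
  obtain ⟨h1, h2⟩ := h (ε * z + -(ε * t)) (Set.mem_univ _)
  have h3 : ε * (ε * z + -(ε * t)) + t = z := by
    linear_combination (z - t) * sq_eq_one_of_sign hε
  rw [h3] at h1 h2
  rw [h1, h2, inv_mul_cancel_left₀ hl.ne']
  exact ⟨rfl, rfl⟩

theorem nfF_shift (ρ a b t z : ℝ) :
    nfF (ρ * Real.exp t) (a * Real.exp t) (b * Real.exp (-t) ^ 2) (z + t) = nfF ρ a b z := by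
  have h1 : Real.exp (-(z + t)) = Real.exp (-z) * (Real.exp t)⁻¹ := by
    rw [← Real.exp_neg, ← Real.exp_add]; congr 1; ring
  have h2 : Real.exp (-t) = (Real.exp t)⁻¹ := Real.exp_neg t
  have h3 := (Real.exp_pos t).ne'
  have h4 := (Real.exp_pos (-z)).ne'
  simp only [nfF, exp_neg_two_mul, exp_two_mul, exp_eq_inv (z + t), exp_eq_inv z, h1, h2]
  field_simp

theorem nfC_shift (ρ t z : ℝ) : nfC (ρ * Real.exp t) (z + t) = Real.exp (-t) * nfC ρ z := by
  have h1 : Real.exp (-(z + t)) = Real.exp (-t) * Real.exp (-z) := by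
    rw [← Real.exp_add]; congr 1; ring
  have h2 : ρ * Real.exp t * (Real.exp (-t) * Real.exp (-z)) = ρ * Real.exp (-z) := by
    rw [Real.exp_neg t]
    have := (Real.exp_pos t).ne'
    field_simp
  rw [nfC, nfC, h1, h2, mul_div_assoc]

theorem exists_normalized (ρ a b : ℝ) : ∃ t : ℝ,
    IsNormalized (ρ * Real.exp t) (a * Real.exp t) (b * Real.exp (-t) ^ 2) := by
  have key : ∀ r : ℝ, r ≠ 0 → r * Real.exp (-Real.log |r|) = 1 ∨
      r * Real.exp (-Real.log |r|) = -1 := by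
    intro r hr
    rw [Real.exp_neg, Real.exp_log (abs_pos.2 hr)]
    rcases abs_choice r with h | h
    · left; rw [h, mul_inv_cancel₀ hr]
    · right; rw [h, inv_neg, mul_neg, mul_inv_cancel₀ hr]
  by_cases hρ : ρ = 0
  · subst hρ
    by_cases hb : b = 0
    · subst hb
      by_cases ha : a = 0
      · subst ha
        exact ⟨0, Or.inr ⟨by simp, Or.inr ⟨by simp, Or.inr (Or.inl (by simp))⟩⟩⟩
      · refine ⟨-Real.log |a|, Or.inr ⟨by simp, Or.inr ⟨by simp, ?_⟩⟩⟩
        rcases key a ha with h | h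
        · exact Or.inl h
        · exact Or.inr (Or.inr h)
    · refine ⟨Real.log |b| / 2, Or.inr ⟨by simp, Or.inl ?_⟩⟩
      have : Real.exp (-(Real.log |b| / 2)) ^ 2 = Real.exp (-Real.log |b|) := by
        rw [← Real.exp_nat_mul]; congr 1; push_cast; ring
      rw [this]
      exact key b hb
  · exact ⟨-Real.log |ρ|, Or.inl (key ρ hρ)⟩

theorem IsNormalized.cube {σ a b : ℝ} (h : IsNormalized σ a b) : σ ^ 3 = σ := by
  rcases h with (rfl | rfl) | ⟨rfl, -⟩ <;> norm_num

/-- Reflecting `z` if necessary, the constant `c₅` of an Einstein metric becomes non-zero; a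
translation of `z` and the choice of the scale then normalise the parameters. -/
theorem HasEinsteinForm.exists_normal_form (hI : IsData I F C) {c₁ c₂ c₃ c₄ c₅ c₆ : ℝ}
    (hf : HasEinsteinForm I F C c₁ c₂ c₃ c₄ c₅ c₆) :
    ∃ σ a b : ℝ, IsNormalized σ a b ∧ AffRel I F C (nfF σ a b) (nfC σ) ∧
      (c₅ * c₆ = 0 → σ = 0) ∧
      (c₂ * c₅ ^ 2 - 2 * c₅ * c₆ + c₃ * c₆ ^ 2 = 0 → a = σ * (2 - b)) ∧
      (c₁ = 0 ∧ c₂ = 0 ∨ c₃ = 0 ∧ c₄ = 0 → a = 0 ∨ b = 0) := by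
  obtain ⟨ε, ρ, a, b, l, hε, hl, h, h1, h2, h3⟩ : ∃ ε ρ a b l : ℝ, (ε = 1 ∨ ε = -1) ∧ 0 < l ∧
      (∀ z ∈ I, F z = nfF ρ a b (ε * z) ∧ nfC ρ (ε * z) = l * C z) ∧
      (c₅ * c₆ = 0 → ρ = 0) ∧
      (c₂ * c₅ ^ 2 - 2 * c₅ * c₆ + c₃ * c₆ ^ 2 = 0 → a = ρ * (2 - b * ρ ^ 2)) ∧
      (c₁ = 0 ∧ c₂ = 0 ∨ c₃ = 0 ∧ c₄ = 0 → a = 0 ∨ b = 0) := by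
    obtain ⟨z₀, hz₀⟩ := hI.nonempty
    have hne := hf.ne_zero hI.isSmoothPair hz₀
    obtain ⟨hF, hC, h12, h34⟩ := hf
    by_cases h5 : c₅ = 0
    · subst h5
      have h6 : c₆ ≠ 0 := by rintro rfl; simp at hne
      have e2 : c₂ = 0 := by simpa [h6] using h12
      have e4 : c₄ = 0 := by simpa [h6] using h34
      subst e2
      subst e4
      refine ⟨-1, 0, c₃, c₁, c₆ ^ 2, Or.inr rfl, by positivity, fun z hz => ⟨?_, ?_⟩, fun _ => rfl,
        ?_, ?_⟩
      · rw [hF z hz, nfF]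
        simp only [neg_mul, one_mul, neg_neg, mul_neg]
        ring
      · rw [hC z hz, nfC]
        have := (Real.exp_pos (-z)).ne'
        simp only [neg_mul, one_mul, neg_neg, exp_eq_inv z]
        field_simp
        simp only [zero_add, add_zero]
        ring
      · intro h
        have : c₃ * c₆ ^ 2 = 0 := by linarith
        simpa [h6] using this
      · rintro (h | h)
        · exact Or.inr h.1
        · exact Or.inl h.1
    · have e1 : c₁ = c₂ * (c₆ / c₅) := by field_simp; linarith
      have e3 : c₃ = c₄ * (c₆ / c₅) := by field_simp; linarith
      refine ⟨1, c₆ / c₅, c₂, c₄, c₅ ^ 2, Or.inl rfl, by positivity, fun z hz => ⟨?_, ?_⟩, ?_, ?_, ?_⟩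
      · rw [hF z hz, nfF, e1, e3]
        simp only [one_mul]
        ring
      · rw [hC z hz, nfC]
        have e : c₅ + c₆ * Real.exp (-z) = c₅ * (1 + c₆ / c₅ * Real.exp (-z)) := by field_simp
        rw [one_mul, e]
        field_simp
      · intro h
        have : c₆ = 0 := by simpa [h5] using h
        simp [this]
      · intro h
        rw [e3] at h
        field_simp at h ⊢
        linear_combination h
      · rintro (h | h)
        · exact Or.inl h.2
        · exact Or.inr h.2
  obtain ⟨t, ht⟩ := exists_normalized ρ a b
  refine ⟨_, _, _, ht, ⟨ε, t, Real.exp (-t) * l, hε, mul_pos (Real.exp_pos _) hl,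
    fun z hz => ⟨?_, ?_⟩⟩, fun h0 => by rw [h1 h0, zero_mul], fun h0 => ?_, fun h0 => ?_⟩
  · rw [nfF_shift, (h z hz).1]
  · rw [nfC_shift, (h z hz).2, mul_assoc]
  · -- the new `σ` is `ρ * e ^ t`, which equals its cube
    have h4 := ht.cube
    have h5 : Real.exp (-t) * Real.exp t = 1 := by rw [← Real.exp_add]; simp
    rw [h2 h0]
    linear_combination -b * Real.exp (-t) ^ 2 * h4
      + b * ρ ^ 3 * Real.exp t * (Real.exp (-t) * Real.exp t + 1) * h5
  · rcases h3 h0 with h | h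
    · exact Or.inl (by rw [h, zero_mul])
    · exact Or.inr (by rw [h, zero_mul])

/-- Powers of `e ^ (-z)` are linearly independent on every non-empty open set. -/
theorem coeffs_eq_zero (hS : IsOpen S) (hne : S.Nonempty) {p₀ p₁ p₂ p₃ p₄ : ℝ}
    (h : ∀ z ∈ S, p₀ + p₁ * Real.exp (-z) + p₂ * Real.exp (-z) ^ 2 + p₃ * Real.exp (-z) ^ 3
      + p₄ * Real.exp (-z) ^ 4 = 0) : p₀ = 0 ∧ p₁ = 0 ∧ p₂ = 0 ∧ p₃ = 0 ∧ p₄ = 0 := by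
  let P : Polynomial ℝ := Polynomial.C p₀ + Polynomial.C p₁ * Polynomial.X
    + Polynomial.C p₂ * Polynomial.X ^ 2 + Polynomial.C p₃ * Polynomial.X ^ 3
    + Polynomial.C p₄ * Polynomial.X ^ 4
  have hinf : S.Infinite := by
    obtain ⟨z, hz⟩ := hne
    exact infinite_of_mem_nhds z (hS.mem_nhds hz)
  have hP : P = 0 := by
    refine Polynomial.eq_zero_of_infinite_isRoot P ((hinf.image
      (f := fun z => Real.exp (-z)) ?_).mono ?_)
    · exact fun x _ y _ hxy => neg_injective (Real.exp_injective hxy)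
    · rintro _ ⟨z, hz, rfl⟩
      simpa [P] using h z hz
  have hc : ∀ n, P.coeff n = 0 := fun n => by rw [hP, Polynomial.coeff_zero]
  refine ⟨?_, ?_, ?_, ?_, ?_⟩
  · simpa [P, Polynomial.coeff_X, Polynomial.coeff_X_pow] using hc 0
  · simpa [P, Polynomial.coeff_X, Polynomial.coeff_X_pow, Polynomial.coeff_C] using hc 1
  · simpa [P, Polynomial.coeff_X, Polynomial.coeff_X_pow, Polynomial.coeff_C] using hc 2
  · simpa [P, Polynomial.coeff_X, Polynomial.coeff_X_pow, Polynomial.coeff_C] using hc 3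
  · simpa [P, Polynomial.coeff_X, Polynomial.coeff_X_pow, Polynomial.coeff_C] using hc 4

/-- Comparing the coefficients of the powers of `e ^ (-z)`: for `ε = 1` only the identity relates two
normalised parameters, and for `ε = -1` the constant `σ` does not vanish and `a, b` are exchanged. -/
theorem AffRel.normalized_unique {σ a b σ' a' b' : ℝ} (hS : IsOpen S) (hne : S.Nonempty)
    (hn : IsNormalized σ a b) (hn' : IsNormalized σ' a' b') (hC0 : ∀ z ∈ S, 0 < nfC σ z)
    (h : AffRel S (nfF σ a b) (nfC σ) (nfF σ' a' b') (nfC σ')) :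
    σ' = σ ∧ ((a' = a ∧ b' = b) ∨ (σ ≠ 0 ∧ a' = σ * b ∧ b' = σ * a)) := by
  obtain ⟨ε, t, l, hε, hl, h⟩ := h
  have hd : ∀ z ∈ S, (1 + σ * Real.exp (-z)) ≠ 0 ∧ (1 + σ' * Real.exp (-(ε * z + t))) ≠ 0 := by
    intro z hz
    constructor <;> intro h0
    · have := hC0 z hz
      simp [nfC, h0] at this
    · have h1 := (h z hz).2
      rw [nfC, h0] at h1
      have := mul_pos hl (hC0 z hz)
      rw [← h1] at this
      simp at this
  have hC : ∀ z ∈ S, Real.exp (-(ε * z + t)) * (1 + σ * Real.exp (-z)) ^ 2 =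
      l * Real.exp (-z) * (1 + σ' * Real.exp (-(ε * z + t))) ^ 2 := by
    intro z hz
    have h1 := (h z hz).2
    obtain ⟨d1, d2⟩ := hd z hz
    rw [nfC, nfC] at h1
    rwa [← mul_div_assoc, div_eq_div_iff (pow_ne_zero 2 d2) (pow_ne_zero 2 d1)] at h1
  have hT : 0 < Real.exp (-t) := Real.exp_pos _
  have hX : ∀ z : ℝ, Real.exp (-z) ≠ 0 := fun z => (Real.exp_pos _).ne'
  rcases hε with rfl | rfl
  · -- a translation
    have e1 : ∀ z : ℝ, Real.exp (-(1 * z + t)) = Real.exp (-t) * Real.exp (-z) := fun z => by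
      rw [← Real.exp_add]; congr 1; ring
    simp only [e1] at hC
    generalize hTT : Real.exp (-t) = T at *
    obtain ⟨-, k1, k2, k3, -⟩ := coeffs_eq_zero hS hne (p₀ := 0) (p₁ := T - l)
      (p₂ := 2 * T * σ - 2 * l * σ' * T) (p₃ := T * σ ^ 2 - l * σ' ^ 2 * T ^ 2) (p₄ := 0)
      fun z hz => by linear_combination hC z hz
    have hlT : l = T := by linarith
    subst hlT
    have hσ : σ = σ' * l := mul_left_cancel₀ (mul_pos two_pos hl).ne' (by linear_combination k2)
    have hF : ∀ z ∈ S, a' * (σ' / 2 * (l * Real.exp (-z)) ^ 2 + l * Real.exp (-z))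
        + b' * (σ' * (l * Real.exp (-z))⁻¹ + (l * Real.exp (-z))⁻¹ ^ 2 / 2)
        = a * (σ / 2 * Real.exp (-z) ^ 2 + Real.exp (-z))
        + b * (σ * (Real.exp (-z))⁻¹ + (Real.exp (-z))⁻¹ ^ 2 / 2) := by
      intro z hz
      have h1 := (h z hz).1
      simp only [nfF, exp_neg_two_mul, exp_two_mul, exp_eq_inv z, exp_eq_inv (1 * z + t), e1] at h1
      linear_combination h1
    obtain ⟨m0, -, -, m3, -⟩ := coeffs_eq_zero hS hne (p₀ := b' - l ^ 2 * b)
      (p₁ := 2 * (b' * σ' * l - l ^ 2 * b * σ)) (p₂ := 0) (p₃ := 2 * (l ^ 3 * a' - l ^ 2 * a))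
      (p₄ := a' * σ' * l ^ 4 - l ^ 2 * a * σ)
      fun z hz => by
        have h1 := hF z hz
        have h2 := hX z
        field_simp at h1
        linear_combination h1
    have ha : a = l * a' := mul_left_cancel₀ (pow_pos hl 2).ne' (by linear_combination -m3 / 2)
    have hb : b' = l ^ 2 * b := by linarith
    have hl1 : ∀ {x y : ℝ}, (x = 1 ∨ x = -1) → (y = 1 ∨ y = -1) → x = y * l → l = 1 := by
      rintro x y (rfl | rfl) (rfl | rfl) hxy <;> linarith
    have done : l = 1 → σ' = σ ∧ ((a' = a ∧ b' = b) ∨ (σ ≠ 0 ∧ a' = σ * b ∧ b' = σ * a)) := by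
      rintro rfl
      exact ⟨by linarith, Or.inl ⟨by linarith, by linarith⟩⟩
    rcases hn with hs | ⟨hs, hn⟩
    · rcases hn' with hs' | ⟨hs', -⟩
      · exact done (hl1 hs hs' hσ)
      · rw [hs', zero_mul] at hσ
        rcases hs with hs | hs <;> norm_num [hσ] at hs
    · have hs' : σ' = 0 := by
        rw [hs] at hσ
        exact (mul_eq_zero.1 hσ.symm).resolve_right hl.ne'
      rcases hn' with hs'' | ⟨-, hn'⟩
      · rcases hs'' with hs'' | hs'' <;> norm_num [hs'] at hs''
      · by_cases hb0 : b = 0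
        · have hb0' : b' = 0 := by rw [hb, hb0, mul_zero]
          by_cases ha0 : a' = 0
          · exact ⟨by rw [hs, hs'], Or.inl ⟨by rw [ha, ha0, mul_zero], by rw [hb0, hb0']⟩⟩
          · have ha1 : a ≠ 0 := by rw [ha]; exact mul_ne_zero hl.ne' ha0
            have q1 : a = 1 ∨ a = -1 := by
              rcases hn with hn | ⟨-, hn | hn | hn⟩
              · rcases hn with hn | hn <;> norm_num [hb0] at hn
              · exact Or.inl hn
              · exact absurd hn ha1
              · exact Or.inr hn
            have q2 : a' = 1 ∨ a' = -1 := by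
              rcases hn' with hn' | ⟨-, hn' | hn' | hn'⟩
              · rcases hn' with hn' | hn' <;> norm_num [hb0'] at hn'
              · exact Or.inl hn'
              · exact absurd hn' ha0
              · exact Or.inr hn'
            exact done (hl1 q1 q2 (by rw [ha, mul_comm]))
        · have hb0' : b' ≠ 0 := by rw [hb]; exact mul_ne_zero (pow_pos hl 2).ne' hb0
          have q1 : b = 1 ∨ b = -1 := hn.resolve_right fun h => hb0 h.1
          have q2 : b' = 1 ∨ b' = -1 := hn'.resolve_right fun h => hb0' h.1
          refine done ?_
          have q3 : l ^ 2 = 1 := by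
            rcases q1 with q1 | q1 <;> rcases q2 with q2 | q2 <;> rw [q1, q2] at hb <;> nlinarith
          nlinarith
  · -- a reflection
    have e1 : ∀ z : ℝ, Real.exp (-(-1 * z + t)) = Real.exp (-t) * (Real.exp (-z))⁻¹ := fun z => by
      rw [← Real.exp_neg, ← Real.exp_add]; congr 1; ring
    simp only [e1] at hC
    generalize hTT : Real.exp (-t) = T at *
    obtain ⟨k0, k1, k2, -, -⟩ := coeffs_eq_zero hS hne (p₀ := T - l * σ' ^ 2 * T ^ 2)
      (p₁ := 2 * T * σ - 2 * l * σ' * T)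
      (p₂ := T * σ ^ 2 - l) (p₃ := 0) (p₄ := 0) fun z hz => by
        have h1 := hC z hz
        have h2 := hX z
        field_simp at h1
        linear_combination h1
    have hσ0 : σ ≠ 0 := by
      rintro rfl
      linarith
    have hσ1 : σ = 1 ∨ σ = -1 := hn.resolve_right fun h => hσ0 h.1
    have hlT : l = T := by
      have := sq_eq_one_of_sign hσ1
      rw [this] at k2; linarith
    subst hlT
    have hσ0' : σ' ≠ 0 := by
      rintro rfl
      have : l = 0 := by linear_combination k0
      exact hl.ne' this
    have hσ1' : σ' = 1 ∨ σ' = -1 := hn'.resolve_right fun h => hσ0' h.1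
    have hl1 : l = 1 := by
      rw [sq_eq_one_of_sign hσ1'] at k0
      have : l * (1 - l) * (1 + l) = 0 := by linear_combination k0
      have h3 := (mul_eq_zero.1 this).resolve_right (by positivity)
      have h4 := (mul_eq_zero.1 h3).resolve_left hl.ne'
      linarith
    subst hl1
    have hσ : σ' = σ := by linarith
    subst hσ
    have hF : ∀ z ∈ S, a' * (σ' / 2 * (Real.exp (-z))⁻¹ ^ 2 + (Real.exp (-z))⁻¹)
        + b' * (σ' * Real.exp (-z) + Real.exp (-z) ^ 2 / 2)
        = a * (σ' / 2 * Real.exp (-z) ^ 2 + Real.exp (-z))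
        + b * (σ' * (Real.exp (-z))⁻¹ + (Real.exp (-z))⁻¹ ^ 2 / 2) := by
      intro z hz
      have h1 := (h z hz).1
      simp only [nfF, exp_neg_two_mul, exp_two_mul, exp_eq_inv z, exp_eq_inv (-1 * z + t), e1,
        one_mul, inv_inv] at h1
      linear_combination h1
    obtain ⟨m0, -, -, m3, -⟩ := coeffs_eq_zero hS hne (p₀ := a' * σ' - b)
      (p₁ := 2 * (a' - b * σ')) (p₂ := 0) (p₃ := 2 * (b' * σ' - a)) (p₄ := b' - a * σ')
      fun z hz => by
        have h1 := hF z hz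
        have h2 := hX z
        field_simp at h1
        linear_combination h1
    have hs2 := sq_eq_one_of_sign hσ1
    refine ⟨rfl, Or.inr ⟨hσ0, ?_, ?_⟩⟩
    · linear_combination σ' * m0 - a' * hs2
    · linear_combination σ' * m3 / 2 - b' * hs2

end

/-! ### The families of normal forms -/

section

variable {S I I' : Set ℝ} {F C F' C' : ℝ → ℝ}

theorem exists_isData {U : Set ℝ} (hU : IsOpen U) (hF : ContDiffOn ℝ ∞ F U)
    (hC : ContDiffOn ℝ ∞ C U) {z : ℝ} (hz : z ∈ U) (hFz : 0 < F z) (hCz : 0 < C z) :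
    ∃ I, IsData I F C := by
  have h1 := (hF.continuousOn.continuousAt (hU.mem_nhds hz)).eventually (lt_mem_nhds hFz)
  have h2 := (hC.continuousOn.continuousAt (hU.mem_nhds hz)).eventually (lt_mem_nhds hCz)
  obtain ⟨δ, hδ, hb⟩ := Metric.eventually_nhds_iff_ball.1 ((h1.and h2).and (hU.mem_nhds hz))
  exact ⟨Metric.ball z δ, Metric.isOpen_ball, (convex_ball z δ).ordConnected,
    ⟨z, Metric.mem_ball_self hδ⟩, hF.mono fun y hy => (hb y hy).2, hC.mono fun y hy => (hb y hy).2,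
    fun y hy => (hb y hy).1.1, fun y hy => (hb y hy).1.2⟩

theorem exists_isData_nf {σ a b z : ℝ} (hF : 0 < nfF σ a b z) (hσ : 1 + σ * Real.exp (-z) ≠ 0) :
    ∃ I, IsData I (nfF σ a b) (nfC σ) := by
  refine exists_isData (U := {z | 1 + σ * Real.exp (-z) ≠ 0}) (isOpen_ne_fun (by fun_prop)
    continuous_const) ?_ ?_ hσ hF (div_pos (Real.exp_pos _) (sq_pos_of_ne_zero hσ))
  · unfold nfF; fun_prop
  · exact ContDiffOn.div (by fun_prop) (by fun_prop) fun z hz => pow_ne_zero 2 hz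

theorem hasEinsteinForm_nf (σ a b : ℝ) (I : Set ℝ) :
    HasEinsteinForm I (nfF σ a b) (nfC σ) (a * σ) a (b * σ) b 1 σ :=
  ⟨fun z _ => by rw [nfF]; ring, fun z _ => rfl, by ring, by ring⟩

theorem exists_isData_nf_of_pos {σ a b : ℝ} (hb : 0 < b) : ∃ I, IsData I (nfF σ a b) (nfC σ) := by
  -- for large `E = e ^ z` the last term dominates
  obtain ⟨E, hE1, hE2, hE3⟩ : ∃ E : ℝ, 1 ≤ E ∧ 2 + 2 * |σ| ≤ E ∧ |a| * (|σ| + 1) / b ≤ E :=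
    ⟨max 1 (max (2 + 2 * |σ|) (|a| * (|σ| + 1) / b)), le_max_left _ _,
      (le_max_left _ _).trans (le_max_right _ _), (le_max_right _ _).trans (le_max_right _ _)⟩
  have hE0 : 0 < E := by linarith
  have hX : Real.exp (-Real.log E) = E⁻¹ := by rw [Real.exp_neg, Real.exp_log hE0]
  have hX0 : 0 < E⁻¹ := inv_pos.2 hE0
  have hX1 : E⁻¹ ≤ 1 := inv_le_one_of_one_le₀ hE1
  have hσE : |σ| * E⁻¹ ≤ 1 / 2 := by
    rw [← div_eq_mul_inv, div_le_iff₀ hE0]; linarith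
  refine exists_isData_nf (z := Real.log E) ?_ ?_
  · rw [nfF, exp_neg_two_mul, exp_two_mul, hX, Real.exp_log hE0]
    have h1 : -(|a| * (|σ| + 1)) ≤ a * (σ / 2 * E⁻¹ ^ 2 + E⁻¹) := by
      have h2 : |σ / 2 * E⁻¹ ^ 2 + E⁻¹| ≤ |σ| + 1 := by
        refine (abs_add_le _ _).trans ?_
        rw [abs_mul, abs_div, abs_two, abs_of_pos hX0, abs_of_pos (pow_pos hX0 2)]
        have : E⁻¹ ^ 2 ≤ 1 := pow_le_one₀ hX0.le hX1
        nlinarith [abs_nonneg σ]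
      have h3 := neg_abs_le (a * (σ / 2 * E⁻¹ ^ 2 + E⁻¹))
      rw [abs_mul] at h3
      have h4 := mul_le_mul_of_nonneg_left h2 (abs_nonneg a)
      linarith
    have h5 : |a| * (|σ| + 1) ≤ b * E := by
      rw [div_le_iff₀ hb] at hE3; linarith
    have h6 : 1 ≤ σ + E / 2 := by linarith [neg_abs_le σ]
    have h7 : b * E ≤ b * (σ * E + E ^ 2 / 2) := by
      have := mul_le_mul_of_nonneg_left h6 (mul_pos hb hE0).le
      linarith
    linarith
  · rw [hX]
    have := neg_abs_le (σ * E⁻¹)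
    rw [abs_mul, abs_of_pos hX0] at this
    linarith

theorem exists_isData_nf_ricciFlat {σ b : ℝ} (hn : IsNormalized σ (σ * (2 - b)) b) :
    ∃ I, IsData I (nfF σ (σ * (2 - b)) b) (nfC σ) := by
  rcases hn with (rfl | rfl) | ⟨rfl, hb⟩
  · refine exists_isData_nf (z := 0) ?_ ?_
    · simp only [nfF, mul_zero, neg_zero, Real.exp_zero]; linarith
    · simp
  · -- here `F` vanishes at `z = 0`, and is positive on one side of it
    have key : ∀ X : ℝ, 0 < X → X ≠ 1 → 0 ≤ b * (1 - X) →
        ∃ I, IsData I (nfF (-1) (-1 * (2 - b)) b) (nfC (-1)) := by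
      intro X hX hX1 hbX
      have e : Real.exp (-(-Real.log X)) = X := by rw [neg_neg, Real.exp_log hX]
      refine exists_isData_nf (z := -Real.log X) ?_ ?_
      · rw [nfF, exp_neg_two_mul, exp_two_mul, exp_eq_inv (-Real.log X), e]
        have : 1 + -1 * (2 - b) * (-1 / 2 * X ^ 2 + X) + b * (-1 * X⁻¹ + X⁻¹ ^ 2 / 2)
            = (1 - X) ^ 2 * (1 + b * (1 - X) * (1 + X) / (2 * X ^ 2)) := by
          field_simp
          ring
        rw [this]
        have h1 : 0 < (1 - X) ^ 2 := sq_pos_of_ne_zero (sub_ne_zero.2 hX1.symm)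
        have h2 : 0 ≤ b * (1 - X) * (1 + X) / (2 * X ^ 2) :=
          div_nonneg (mul_nonneg hbX (by linarith)) (by positivity)
        positivity
      · rw [e]
        intro h; exact hX1 (by linarith)
    rcases le_total 0 b with hb | hb
    · exact key (1 / 2) (by norm_num) (by norm_num) (by linarith)
    · exact key 2 (by norm_num) (by norm_num) (by linarith)
  · refine exists_isData_nf (z := 0) ?_ (by simp)
    simp only [nfF, mul_zero, neg_zero, Real.exp_zero]
    rcases hb with (rfl | rfl) | ⟨rfl, -⟩ <;> norm_num

theorem isRicciFlat_iff {g : Metric} : IsRicciFlat S g ↔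
    IsEinstein S g ∧ ∀ x ∈ region S, scal g x = 0 := by
  constructor
  · intro h
    have hs : ∀ x ∈ region S, scal g x = 0 := fun x hx => by simp [scal, h x hx]
    exact ⟨fun x hx a b => by rw [tfRic, h x hx, hs x hx]; ring, hs⟩
  · rintro ⟨h1, h2⟩ x hx a b
    have h3 := h1 x hx a b
    rw [tfRic, h2 x hx] at h3
    linarith

theorem HasEinsteinForm.isRicciFlat_iff (hI : IsData I F C) {c₁ c₂ c₃ c₄ c₅ c₆ : ℝ}
    (hf : HasEinsteinForm I F C c₁ c₂ c₃ c₄ c₅ c₆) : IsRicciFlat I (met F C) ↔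
      c₂ * c₅ ^ 2 - 2 * c₅ * c₆ + c₃ * c₆ ^ 2 = 0 := by
  rw [U2.isRicciFlat_iff]
  constructor
  · rintro ⟨-, h⟩
    obtain ⟨z, hz⟩ := hI.nonempty
    have h1 := h _ (exp_mem_region hz)
    rw [hf.scal_eq hI.isSmoothPair (exp_mem_region hz)] at h1
    linarith
  · intro h
    refine ⟨hf.isEinstein hI.isSmoothPair, fun x hx => ?_⟩
    rw [hf.scal_eq hI.isSmoothPair hx, h, mul_zero]

theorem isRicciFlat_nf_iff {σ a b : ℝ} (hn : IsNormalized σ a b)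
    (hI : IsData I (nfF σ a b) (nfC σ)) :
    IsRicciFlat I (met (nfF σ a b) (nfC σ)) ↔ a = σ * (2 - b) := by
  rw [(hasEinsteinForm_nf σ a b I).isRicciFlat_iff hI]
  have h := hn.cube
  constructor
  · intro h1
    linear_combination h1 - b * h
  · intro h1
    linear_combination h1 + b * h

/-! ### The five Ricci-flat Kähler pairs -/

/-- The parameter `σ` of the normal forms of the five pairs. -/
def fiveσ : Fin 5 → ℝ := ![0, -1, 1, 0, 0]

/-- The parameter `b` of the normal forms of the five pairs; the parameter `a` is `0`. -/
def fiveb : Fin 5 → ℝ := ![0, 2, 2, -1, 1]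

theorem isNormalized_five (k : Fin 5) : IsNormalized (fiveσ k) 0 (fiveb k) := by
  fin_cases k
  · exact Or.inr ⟨rfl, Or.inr ⟨rfl, Or.inr (Or.inl rfl)⟩⟩
  · exact Or.inl (Or.inr rfl)
  · exact Or.inl (Or.inl rfl)
  · exact Or.inr ⟨rfl, Or.inl (Or.inr rfl)⟩
  · exact Or.inr ⟨rfl, Or.inl (Or.inl rfl)⟩

theorem affRel_id (hF : ∀ z ∈ S, F' z = F z) (hC : ∀ z ∈ S, C' z = C z) : AffRel S F C F' C' :=
  ⟨1, 0, 1, Or.inl rfl, one_pos, fun z hz => by simp [hF z hz, hC z hz]⟩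

theorem nfC_eq (σ z : ℝ) : nfC σ z = Real.exp z / (Real.exp z + σ) ^ 2 := by
  have h1 := (Real.exp_pos z).ne'
  have h2 : 1 + σ * (Real.exp z)⁻¹ = (Real.exp z + σ) * (Real.exp z)⁻¹ := by field_simp
  rw [nfC, Real.exp_neg, h2]
  field_simp

theorem five_affRel (k : Fin 5) :
    AffRel Set.univ (fiveF k) (fiveC k) (nfF (fiveσ k) 0 (fiveb k)) (nfC (fiveσ k)) := by
  have hEH : ∀ s : ℝ, AffRel Set.univ (fun z => 1 + s * Real.exp (-2 * z)) Real.exp (nfF 0 0 s)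
      (nfC 0) := by
    intro s
    refine ⟨-1, Real.log 2 / 2, Real.exp (-(Real.log 2 / 2)), Or.inr rfl, Real.exp_pos _,
      fun z _ => ⟨?_, ?_⟩⟩
    · have h1 : Real.exp (2 * (-1 * z + Real.log 2 / 2)) = 2 * Real.exp (-2 * z) := by
        rw [← Real.exp_log two_pos, ← Real.exp_add, Real.exp_log two_pos]; congr 1; ring
      rw [nfF, h1]; ring
    · rw [nfC, ← Real.exp_add]
      simp
  fin_cases k
  · exact affRel_id (fun z _ => by simp [nfF, fiveσ, fiveb, fiveF])
      fun z _ => by simp [nfC, fiveσ, fiveC]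
  · refine affRel_id (fun z _ => ?_) fun z _ => ?_
    · simp [nfF, fiveσ, fiveb, fiveF, exp_two_mul]; ring
    · rw [nfC_eq]; simp [fiveσ, fiveC]
      congr 1; ring
  · refine affRel_id (fun z _ => ?_) fun z _ => ?_
    · simp [nfF, fiveσ, fiveb, fiveF, exp_two_mul]; ring
    · rw [nfC_eq]; simp [fiveσ, fiveC]
      congr 1; ring
  · have h := hEH (-1)
    have e : (fun z : ℝ => 1 + -1 * Real.exp (-2 * z)) = fun z => 1 - Real.exp (-2 * z) := by
      funext z; ring
    rw [e] at h
    exact h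
  · have h := hEH 1
    have e : (fun z : ℝ => 1 + 1 * Real.exp (-2 * z)) = fun z => 1 + Real.exp (-2 * z) := by
      funext z; ring
    rw [e] at h
    exact h

theorem AffRel.flip_nf {σ : ℝ} (hσ : σ = 1 ∨ σ = -1) (a b : ℝ) :
    AffRel Set.univ (nfF σ a b) (nfC σ) (nfF σ (σ * b) (σ * a)) (nfC σ) := by
  have h2 := sq_eq_one_of_sign hσ
  refine ⟨-1, 0, 1, Or.inr rfl, one_pos, fun z _ => ⟨?_, ?_⟩⟩
  · simp only [nfF]
    rw [show -2 * (-1 * z + 0) = 2 * z by ring, show -(-1 * z + 0) = z by ring,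
      show (-1 * z + 0) = -z by ring, show 2 * -z = -2 * z by ring]
    linear_combination (b * Real.exp (2 * z) / 2 + a * Real.exp (-z)) * h2
  · rw [nfC_eq, nfC, show (-1 * z + 0) = -z by ring, one_mul]
    congr 1
    linear_combination (1 - Real.exp (-z) ^ 2) * h2

theorem exists_five_affRel {σ a b : ℝ} (hn : IsNormalized σ a b) (ha : a = σ * (2 - b))
    (h0 : a = 0 ∨ b = 0) : ∃ k, AffRel Set.univ (nfF σ a b) (nfC σ) (fiveF k) (fiveC k) := by
  have key : ∀ k, AffRel Set.univ (nfF (fiveσ k) 0 (fiveb k)) (nfC (fiveσ k)) (fiveF k) (fiveC k) :=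
    fun k => (five_affRel k).symm
  rcases hn with hσ | ⟨rfl, hn⟩
  · obtain ⟨k, hk⟩ : ∃ k, AffRel Set.univ (nfF σ 0 2) (nfC σ) (fiveF k) (fiveC k) := by
      rcases hσ with rfl | rfl
      · exact ⟨2, key 2⟩
      · exact ⟨1, key 1⟩
    have h2 := sq_eq_one_of_sign hσ
    rcases h0 with rfl | rfl
    · have : b = 2 := by linear_combination σ * ha + (2 - b) * h2
      subst this
      exact ⟨k, hk⟩
    · have := AffRel.flip_nf hσ a 0
      rw [mul_zero, show σ * a = 2 by rw [ha]; linear_combination 2 * h2] at this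
      exact ⟨k, this.trans hk⟩
  · rw [zero_mul] at ha
    subst ha
    rcases hn with (rfl | rfl) | ⟨rfl, -⟩
    · exact ⟨4, key 4⟩
    · exact ⟨3, key 3⟩
    · exact ⟨0, key 0⟩

theorem exists_isData_five (k : Fin 5) : ∃ I, IsData I (fiveF k) (fiveC k) := by
  have he : Real.exp 1 > 1 := by simp
  have he' : Real.exp (-2) < 1 := by simp
  have h1 : (1 - Real.exp 1) ≠ 0 := by linarith
  fin_cases k
  · exact exists_isData (z := 0) isOpen_univ contDiffOn_const
      (by simp only [fiveC, Fin.zero_eta, Matrix.cons_val]; fun_prop) (Set.mem_univ _)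
      (by simp [fiveF]) (Real.exp_pos _)
  · refine exists_isData (U := {z : ℝ | 1 - Real.exp z ≠ 0}) (z := 1)
      (isOpen_ne_fun (by fun_prop) continuous_const) ?_ ?_ h1 (sq_pos_of_ne_zero h1)
      (div_pos (Real.exp_pos _) (sq_pos_of_ne_zero h1))
    · exact ContDiff.contDiffOn (show ContDiff ℝ ∞ fun z => (1 - Real.exp z) ^ 2 by fun_prop)
    · exact ContDiffOn.div (by fun_prop) (by fun_prop) fun z hz => pow_ne_zero 2 hz
  · have h2 : ∀ z : ℝ, 0 < 1 + Real.exp z := fun z => by positivity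
    refine exists_isData (U := Set.univ) (z := 1) isOpen_univ ?_ ?_ (Set.mem_univ _)
      (pow_pos (h2 1) 2) (div_pos (Real.exp_pos _) (pow_pos (h2 1) 2))
    · exact ContDiff.contDiffOn (show ContDiff ℝ ∞ fun z => (1 + Real.exp z) ^ 2 by fun_prop)
    · exact ContDiffOn.div (by fun_prop) (by fun_prop) fun z _ => pow_ne_zero 2 (h2 z).ne'
  · refine exists_isData (U := Set.univ) (z := 1) isOpen_univ ?_ ?_ (Set.mem_univ _) ?_
      (Real.exp_pos _)
    · exact ContDiff.contDiffOn (show ContDiff ℝ ∞ fun z => 1 - Real.exp (-2 * z) by fun_prop)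
    · exact Real.contDiff_exp.contDiffOn
    · show 0 < 1 - Real.exp (-2 * 1)
      rw [mul_one]; linarith
  · refine exists_isData (U := Set.univ) (z := 1) isOpen_univ ?_ ?_ (Set.mem_univ _) ?_
      (Real.exp_pos _)
    · exact ContDiff.contDiffOn (show ContDiff ℝ ∞ fun z => 1 + Real.exp (-2 * z) by fun_prop)
    · exact Real.contDiff_exp.contDiffOn
    · show 0 < 1 + Real.exp (-2 * 1)
      positivity

theorem five_homothetic_unique {k l : Fin 5} (hI : IsData I (fiveF k) (fiveC k))
    (hI' : IsData I' (fiveF l) (fiveC l))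
    (h : Homothetic I (fiveF k) (fiveC k) I' (fiveF l) (fiveC l)) : k = l := by
  obtain ⟨ε, t, r, hε, hr, h1⟩ := (five_affRel k).symm
  obtain ⟨ε', t', r', hε', hr', h2⟩ := (h.affRel hI hI').trans (five_affRel l)
  -- the two normal forms are related over the corresponding interval
  have h3 : AffRel {z | ε * z + t ∈ I} (nfF (fiveσ k) 0 (fiveb k)) (nfC (fiveσ k))
      (nfF (fiveσ l) 0 (fiveb l)) (nfC (fiveσ l)) := by
    refine ⟨ε' * ε, ε' * t + t', r' * r, mul_sign hε hε', mul_pos hr' hr, fun z hz => ?_⟩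
    obtain ⟨e1, e2⟩ := h1 z (Set.mem_univ _)
    obtain ⟨e3, e4⟩ := h2 _ hz
    rw [show ε' * ε * z + (ε' * t + t') = ε' * (ε * z + t) + t' by ring, e3, e4, e1, e2, mul_assoc]
    exact ⟨rfl, rfl⟩
  have hne : {z | ε * z + t ∈ I}.Nonempty := by
    obtain ⟨w, hw⟩ := hI.nonempty
    refine ⟨ε * (w - t), ?_⟩
    have : ε * (ε * (w - t)) + t = w := by linear_combination (w - t) * sq_eq_one_of_sign hε
    simpa only [Set.mem_ofPred_eq, this] using hw
  obtain ⟨h4, h5⟩ := h3.normalized_unique (hI.isOpen.preimage (by fun_prop)) hne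
    (isNormalized_five k) (isNormalized_five l) fun z hz => by
      have e1 := (h1 z (Set.mem_univ _)).2
      have e2 := hI.pos_C _ hz
      rw [e1] at e2
      exact pos_of_mul_pos_right e2 hr.le
  have h6 : fiveb l = fiveb k := by
    rcases h5 with h5 | ⟨h5, h6, h7⟩
    · exact h5.2
    · have h8 : fiveb k = 0 := (mul_eq_zero.1 h6.symm).resolve_left h5
      rw [h8, h7, mul_zero]
  clear * - h4 h6
  fin_cases k <;> fin_cases l <;> simp [fiveσ, fiveb] at h4 h6 ⊢ <;> linarith

end

/-! ### Kähler metrics -/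

section

variable {S I : Set ℝ} {F C : ℝ → ℝ} {x : ℍ[ℝ]}

/-- The complex structures `cstr F` (for `s = 1`) and `cstr (-F)` (for `s = -1`) are parallel exactly
if `C' / C = -s`. -/
theorem isKahler_cstr_iff (h : IsSmoothPair S F C) {s : ℝ} (hs : s ^ 2 = 1) :
    IsKahler S (met F C) (cstr fun z => s * F z) ↔ ∀ z ∈ S, ld C z = -s := by
  have hs0 : s ≠ 0 := by rintro rfl; norm_num at hs
  have hs1 : s = 1 ∨ s = -1 := sq_eq_one_iff.1 hs
  obtain ⟨j, hj⟩ : ∃ j : ℝ → Fin 4 → Fin 4 → ℝ, j = fun f => ![![0, -2 * f, 0, 0],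
    ![1 / (2 * f), 0, 0, 0], ![0, 0, 0, -1], ![0, 0, 1, 0]] := ⟨_, rfl⟩
  obtain ⟨dj, hdj⟩ : ∃ dj : ℝ → ℝ → Fin 4 → Fin 4 → ℝ, dj = fun f f' => ![![0, -2 * f', 0, 0],
    ![-f' / (2 * f ^ 2), 0, 0, 0], ![0, 0, 0, 0], ![0, 0, 0, 0]] := ⟨_, rfl⟩
  have hJ : ∀ x a b, cstr (fun z => s * F z) x a b = j (s * F (Real.log ‖x‖)) a b := by
    intro x a b
    rw [hj]
    rfl
  have hjd : ∀ z ∈ S, ∀ a b, HasDerivAt (fun z => j (s * F z) a b)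
      (dj (s * F z) (s * deriv F z) a b) z := by
    intro z hz a b
    have h1 := (h.hasDerivAt_F hz).const_mul s
    have h2 : s * F z ≠ 0 := mul_ne_zero hs0 (h.pos_F z hz).ne'
    rw [hj, hdj]
    revert a b
    simp only [forall_fin_four]
    simp only [Matrix.cons_val]
    have e1 : HasDerivAt (fun z => 1 / (2 * (s * F z))) (-(s * deriv F z) / (2 * (s * F z) ^ 2)) z := by
      refine ((hasDerivAt_const z (1 : ℝ)).div (h1.const_mul 2)
        (mul_ne_zero two_ne_zero h2)).congr_deriv ?_
      field_simp
      ring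
    and_intros <;> first | exact h1.const_mul (-2) | exact e1 | exact hasDerivAt_const _ _
  have hDJ : ∀ x ∈ region S, ∀ a b d, D a (fun y => cstr (fun z => s * F z) y d b) x =
      if a = 0 then dj (s * F (Real.log ‖x‖)) (s * deriv F (Real.log ‖x‖)) d b else 0 :=
    fun x hx a b d => D_radial h.isOpen hx (fun y _ => hJ y d b) (hjd _ hx.2 d b) a
  constructor
  · intro hK z hz
    have h1 := hK.parallel _ (exp_mem_region hz) 2 0 3
    rw [hDJ _ (exp_mem_region hz)] at h1
    simp only [hJ, chr_met' h (exp_mem_region hz), log_norm_exp] at h1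
    have h2 := (h.pos_F z hz).ne'
    rw [hj] at h1
    simp only [Fin.sum_univ_four, xr, gamAt, gam, Matrix.cons_val, Fin.reduceEq, if_true, if_false]
      at h1
    field_simp at h1
    linear_combination -s * h1 - ld C z * hs
  · intro hld
    refine ⟨fun a b => ?_, fun x hx => ?_, fun x hx => ?_, fun x hx a b d => ?_⟩
    · have h1 : ContDiffOn ℝ ∞ (fun z => j (s * F z) a b) S := by
        have hF := h.smooth_F
        have hF0 : ∀ z ∈ S, 2 * (s * F z) ≠ 0 := fun z hz =>
          mul_ne_zero two_ne_zero (mul_ne_zero hs0 (h.pos_F z hz).ne')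
        rw [hj]
        revert a b
        simp only [forall_fin_four]
        simp only [Matrix.cons_val]
        and_intros <;> fun_prop (disch := assumption)
      exact (contDiffOn_radial h1).congr fun x _ => hJ x a b
    · have h2 := (h.pos_F _ hx.2).ne'
      ext a b
      simp only [Matrix.mul_apply, Matrix.neg_apply, Matrix.one_apply, hJ, Fin.sum_univ_four]
      generalize F (Real.log ‖x‖) = f at *
      rw [hj]
      revert a b
      simp only [forall_fin_four]
      simp only [Matrix.cons_val, Fin.reduceEq, if_true, if_false]
      and_intros <;> first | (ring; done) | (field_simp; done) | (field_simp; ring)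
    · have h2 := (h.pos_F _ hx.2).ne'
      ext a b
      simp only [Matrix.mul_apply, Matrix.transpose_apply, met_apply, hJ, Fin.sum_univ_four]
      generalize F (Real.log ‖x‖) = f at *
      generalize C (Real.log ‖x‖) = c at *
      rw [hj]
      revert a b
      simp only [forall_fin_four]
      simp only [gv, Matrix.cons_val, Fin.reduceEq, if_true, if_false]
      rcases hs1 with rfl | rfl <;> and_intros <;>
        first | (ring; done) | (field_simp; done) | (field_simp; ring)
    · have h2 := (h.pos_F _ hx.2).ne'
      have h3 := hld _ hx.2
      rw [hDJ x hx]
      simp only [hJ, chr_met' h hx]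
      rw [hj, hdj]
      simp only [gamAt, h3]
      generalize deriv F (Real.log ‖x‖) = f1
      generalize F (Real.log ‖x‖) = f at *
      revert a b d
      simp only [forall_fin_four, Fin.sum_univ_four]
      simp only [xr, gam, Matrix.cons_val, Fin.reduceEq, if_true, if_false]
      rcases hs1 with rfl | rfl <;> and_intros <;>
        first | (ring; done) | (field_simp; done) | (field_simp; ring)

theorem isKahler_Jplus_iff (h : IsSmoothPair S F C) :
    IsKahler S (met F C) (Jplus F) ↔ ∀ z ∈ S, ld C z = -1 := by
  have h1 := isKahler_cstr_iff h (s := 1) (by norm_num)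
  simp only [one_mul] at h1
  exact h1

theorem isKahler_Jminus_iff (h : IsSmoothPair S F C) :
    IsKahler S (met F C) (Jminus F) ↔ ∀ z ∈ S, ld C z = 1 := by
  have h1 := isKahler_cstr_iff h (s := -1) (by norm_num)
  simp only [neg_mul, one_mul, neg_neg] at h1
  exact h1

theorem HasEinsteinForm.isKahlerEinstein_Jplus_iff (hI : IsData I F C) {c₁ c₂ c₃ c₄ c₅ c₆ : ℝ}
    (hf : HasEinsteinForm I F C c₁ c₂ c₃ c₄ c₅ c₆) :
    IsKahlerEinstein I (met F C) (Jplus F) ↔ c₆ = 0 := by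
  have h := hI.isSmoothPair
  rw [IsKahlerEinstein, isKahler_Jplus_iff h]
  constructor
  · rintro ⟨-, h1⟩
    obtain ⟨z, hz⟩ := hI.nonempty
    have h2 := h1 z hz
    have h3 := hf.ne_zero h hz
    have h4 := (Real.exp_pos (-z)).ne'
    rw [hf.ld_eq h hz] at h2
    have h5 : 2 * c₆ * Real.exp (-z) / (c₅ + c₆ * Real.exp (-z)) = 0 := by linarith
    simpa [h3, h4] using h5
  · rintro rfl
    exact ⟨hf.isEinstein h, fun z hz => by rw [hf.ld_eq h hz]; simp⟩

theorem HasEinsteinForm.isKahlerEinstein_Jminus_iff (hI : IsData I F C) {c₁ c₂ c₃ c₄ c₅ c₆ : ℝ}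
    (hf : HasEinsteinForm I F C c₁ c₂ c₃ c₄ c₅ c₆) :
    IsKahlerEinstein I (met F C) (Jminus F) ↔ c₅ = 0 := by
  have h := hI.isSmoothPair
  rw [IsKahlerEinstein, isKahler_Jminus_iff h]
  constructor
  · rintro ⟨-, h1⟩
    obtain ⟨z, hz⟩ := hI.nonempty
    have h2 := h1 z hz
    have h3 := hf.ne_zero h hz
    rw [hf.ld_eq h hz] at h2
    have h5 : 2 * c₆ * Real.exp (-z) / (c₅ + c₆ * Real.exp (-z)) = 2 := by linarith
    rw [div_eq_iff h3] at h5
    linarith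
  · rintro rfl
    refine ⟨hf.isEinstein h, fun z hz => ?_⟩
    have h3 := hf.ne_zero h hz
    rw [hf.ld_eq h hz]
    rw [zero_add] at h3 ⊢
    rw [mul_assoc, mul_div_assoc, div_self h3]
    norm_num

theorem HasEinsteinForm.eq_zero_of_c₆ (hI : IsData I F C) {c₁ c₂ c₃ c₄ c₅ c₆ : ℝ}
    (hf : HasEinsteinForm I F C c₁ c₂ c₃ c₄ c₅ c₆) (h6 : c₆ = 0) : c₁ = 0 ∧ c₃ = 0 := by
  obtain ⟨z, hz⟩ := hI.nonempty
  have h3 := hf.ne_zero hI.isSmoothPair hz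
  have h1 := hf.2.2.1
  have h2 := hf.2.2.2
  subst h6
  have h5 : c₅ ≠ 0 := by simpa using h3
  exact ⟨by simpa [h5] using h1, by simpa [h5] using h2⟩

theorem HasEinsteinForm.eq_zero_of_c₅ (hI : IsData I F C) {c₁ c₂ c₃ c₄ c₅ c₆ : ℝ}
    (hf : HasEinsteinForm I F C c₁ c₂ c₃ c₄ c₅ c₆) (h5 : c₅ = 0) : c₂ = 0 ∧ c₄ = 0 := by
  obtain ⟨z, hz⟩ := hI.nonempty
  have h3 := hf.ne_zero hI.isSmoothPair hz
  have h1 := hf.2.2.1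
  have h2 := hf.2.2.2
  subst h5
  have h6 : c₆ ≠ 0 := by rintro rfl; simp at h3
  exact ⟨by simpa [h6] using h1, by simpa [h6] using h2⟩

theorem IsSmoothPair.comp_neg (h : IsSmoothPair S F C) :
    IsSmoothPair {z | -z ∈ S} (fun z => F (-z)) fun z => C (-z) :=
  ⟨h.isOpen.preimage continuous_neg, h.smooth_F.comp contDiff_neg.contDiffOn fun _ hz => hz,
    h.smooth_C.comp contDiff_neg.contDiffOn fun _ hz => hz, fun _ hz => h.pos_F _ hz,
    fun _ hz => h.pos_C _ hz⟩

theorem ld_comp_neg (C : ℝ → ℝ) : ld (fun z => C (-z)) = fun z => -ld C (-z) := by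
  funext z
  rw [ld, ld, deriv_comp_neg, neg_div]

theorem isKahlerEinstein_comp_neg (h : IsSmoothPair S F C) :
    IsKahlerEinstein S (met F C) (Jplus F) ↔
      IsKahlerEinstein {z | -z ∈ S} (met (fun z => F (-z)) fun z => C (-z))
        (Jminus fun z => F (-z)) := by
  rw [IsKahlerEinstein, IsKahlerEinstein, isKahler_Jplus_iff h, isKahler_Jminus_iff h.comp_neg,
    isEinstein_iff h, isEinstein_iff h.comp_neg]
  have e1 : deriv (fun z => F (-z)) = fun z => -deriv F (-z) := funext fun z => deriv_comp_neg _ _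
  have e2 : ∀ z, deriv (deriv fun z => F (-z)) z = deriv (deriv F) (-z) := by
    intro z
    rw [e1, deriv.fun_neg, deriv_comp_neg, neg_neg]
  have e3 : ∀ z, deriv (ld fun z => C (-z)) z = deriv (ld C) (-z) := by
    intro z
    rw [ld_comp_neg, deriv.fun_neg, deriv_comp_neg, neg_neg]
  have e4 : ∀ z, alphaAt (fun z => F (-z)) (fun z => C (-z)) z = alphaAt F C (-z) := by
    intro z
    rw [alphaAt, e2, e1, ld_comp_neg, alphaAt]
    ring
  have e5 : ∀ {P : ℝ → Prop}, (∀ z ∈ S, P z) ↔ ∀ z ∈ {z | -z ∈ S}, P (-z) := by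
    intro P
    refine ⟨fun hP z hz => hP _ hz, fun hP z hz => ?_⟩
    have := hP (-z) (by simpa using hz)
    rwa [neg_neg] at this
  refine and_congr (e5.trans (forall₂_congr ?_)) (e5.trans (forall₂_congr ?_))
  · intro z _
    rw [e4, e3, ld_comp_neg, neg_sq]
  · intro z _
    rw [ld_comp_neg, neg_eq_iff_eq_neg]

/-! ### The curvature commutes with parallel endomorphisms -/

/-- The second derivative along the frame consists of the second derivative as a bilinear form and of the
first derivative along `x * fr a * fr b`, the derivative of the field `x ↦ x * fr b` along `E_a`. -/
theorem D_mul_fr {f : ℍ[ℝ] → ℝ} (hS : IsOpen S) (hf : ContDiffOn ℝ ∞ f (region S))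
    (hx : x ∈ region S) (a b : Fin 4) :
    D a (D b f) x = fderiv ℝ (fderiv ℝ f) x (x * fr a) (x * fr b)
      + fderiv ℝ f x (x * fr a * fr b) := by
  have h1 : DifferentiableAt ℝ (fderiv ℝ f) x :=
    ((hf.fderiv_of_isOpen (m := ∞) (isOpen_region hS) (by simp)).differentiableOn
      (by simp)).differentiableAt ((isOpen_region hS).mem_nhds hx)
  have h2 := (hasFDerivAt_id (𝕜 := ℝ) x).mul_const' (fr b)
  have h3 := h1.hasFDerivAt.clm_apply h2
  have h4 : fderiv ℝ (D b f) x = _ := h3.fderiv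
  rw [D, h4]
  simp [add_comm]

theorem D_sum {ι : Type*} (s : Finset ι) {f : ι → ℍ[ℝ] → ℝ} (hf : ∀ i ∈ s, DifferentiableAt ℝ (f i) x)
    (a : Fin 4) : D a (fun y => ∑ i ∈ s, f i y) x = ∑ i ∈ s, D a (f i) x := by
  rw [D, fderiv_fun_sum hf, sum_apply]
  rfl

theorem sum_co (v : ℍ[ℝ]) : v = ∑ d, co v d • fr d := by
  rw [Fin.sum_univ_four]
  ext <;> simp only [Quaternion.re_add, Quaternion.imI_add, Quaternion.imJ_add, Quaternion.imK_add,
    Quaternion.re_smul, Quaternion.imI_smul, Quaternion.imJ_smul, Quaternion.imK_smul] <;>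
    simp [co, fr]

/-- The commutators of the frame fields. -/
theorem D_comm {f : ℍ[ℝ] → ℝ} (hS : IsOpen S) (hf : ContDiffOn ℝ ∞ f (region S))
    (hx : x ∈ region S) (a b : Fin 4) :
    D a (D b f) x - D b (D a f) x = ∑ d, str a b d * D d f x := by
  have hsymm : IsSymmSndFDerivAt ℝ f x := by
    refine ((hf.contDiffAt ((isOpen_region hS).mem_nhds hx)).of_le
      (m := 2) (WithTop.coe_le_coe.2 le_top)).isSymmSndFDerivAt (by simp)
  rw [D_mul_fr hS hf hx, D_mul_fr hS hf hx, hsymm.eq (x * fr a) (x * fr b)]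
  have h1 : x * fr a * fr b - x * fr b * fr a = ∑ d, str a b d • (x * fr d) := by
    rw [mul_assoc, mul_assoc, ← mul_sub]
    conv_lhs => rw [sum_co (fr a * fr b - fr b * fr a), Finset.mul_sum]
    simp only [mul_smul_comm, str]
  have h2 : fderiv ℝ f x (x * fr a * fr b) - fderiv ℝ f x (x * fr b * fr a) =
      ∑ d, str a b d * D d f x := by
    rw [← map_sub, h1, map_sum]
    simp only [map_smul, smul_eq_mul, D]
  rw [← h2]
  ring

/-- A parallel endomorphism commutes with the curvature operators: write the condition as
`D_a J = [J, G_a]` with the matrices `G_a` of connection coefficients, and take the commutator of two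
derivatives. -/
theorem IsKahler.commute_riem (h : IsSmoothPair S F C) {J : ℍ[ℝ] → Matrix (Fin 4) (Fin 4) ℝ}
    (hJ : IsKahler S (met F C) J) (hx : x ∈ region S) (a b : Fin 4) :
    J x * Matrix.of (fun d c => riem (met F C) a b c d x)
      = Matrix.of (fun d c => riem (met F C) a b c d x) * J x := by
  obtain ⟨G, hG⟩ : ∃ G : Fin 4 → Matrix (Fin 4) (Fin 4) ℝ,
    G = fun a => Matrix.of fun d c => chr (met F C) a c d x := ⟨_, rfl⟩
  obtain ⟨DG, hDG⟩ : ∃ DG : Fin 4 → Fin 4 → Matrix (Fin 4) (Fin 4) ℝ,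
    DG = fun a b => Matrix.of fun d c => D a (chr (met F C) b c d) x := ⟨_, rfl⟩
  obtain ⟨DJ, hDJ⟩ : ∃ DJ : Fin 4 → Matrix (Fin 4) (Fin 4) ℝ,
    DJ = fun a => Matrix.of fun d c => D a (fun y => J y d c) x := ⟨_, rfl⟩
  have hd : ∀ c d, DifferentiableAt ℝ (fun y => J y d c) x := fun c d =>
    ContDiffOn.differentiableAt_region h.isOpen (hJ.smooth d c) hx
  have h1 : ∀ b, ∀ y ∈ region S, ∀ d c, D b (fun y => J y d c) y =
      ∑ e, (J y d e * chr (met F C) b c e y - chr (met F C) b e d y * J y e c) := by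
    intro b y hy d c
    have := hJ.parallel y hy b c d
    rw [← eq_neg_iff_add_eq_zero] at this
    rw [this, ← Finset.sum_neg_distrib]
    exact Finset.sum_congr rfl fun e _ => by ring
  have h2 : ∀ b, DJ b = J x * G b - G b * J x := by
    intro b
    ext d c
    rw [hDJ, hG, Matrix.sub_apply, Matrix.mul_apply, Matrix.mul_apply, ← Finset.sum_sub_distrib]
    exact h1 b x hx d c
  have h3 : ∀ a b, Matrix.of (fun d c => D a (D b fun y => J y d c) x) =
      DJ a * G b + J x * DG a b - (DG a b * J x + G b * DJ a) := by
    intro a b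
    ext d c
    have e1 : (D b fun y => J y d c) =ᶠ[nhds x] fun y =>
        ∑ e, (J y d e * chr (met F C) b c e y - chr (met F C) b e d y * J y e c) := by
      filter_upwards [(isOpen_region h.isOpen).mem_nhds hx] with y hy using h1 b y hy d c
    have hc := differentiableAt_chr_met h hx
    refine ((D_congr e1 a).trans (D_sum _ (fun e _ =>
      ((hd e d).mul (hc b c e)).sub ((hc b e d).mul (hd c e))) a)).trans ?_
    simp only [hDJ, hG, hDG, Matrix.sub_apply, Matrix.add_apply, Matrix.mul_apply, Matrix.of_apply,
      ← Finset.sum_add_distrib, ← Finset.sum_sub_distrib]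
    refine Finset.sum_congr rfl fun e _ => ?_
    exact (D_sub ((hd e d).mul (hc b c e)) ((hc b e d).mul (hd c e)) a).trans
      (congrArg₂ HSub.hSub (D_mul (hd e d) (hc b c e) a) (D_mul (hc b e d) (hd c e) a))
  have h4 : Matrix.of (fun d c => D a (D b fun y => J y d c) x)
      - Matrix.of (fun d c => D b (D a fun y => J y d c) x) = ∑ e, str a b e • DJ e := by
    ext d c
    rw [Matrix.sub_apply, Matrix.of_apply, Matrix.of_apply,
      D_comm h.isOpen (hJ.smooth d c) hx, Matrix.sum_apply, hDJ]
    rfl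
  have h5 : Matrix.of (fun d c => riem (met F C) a b c d x) = DG a b - DG b a + G a * G b - G b * G a
      - ∑ e, str a b e • G e := by
    ext d c
    simp only [riem, hG, hDG, Matrix.sub_apply, Matrix.add_apply, Matrix.mul_apply, Matrix.of_apply,
      Matrix.sum_apply, Matrix.smul_apply, smul_eq_mul, Finset.sum_sub_distrib]
    rw [Finset.sum_congr rfl fun e _ => mul_comm (chr (met F C) b c e x) _,
      Finset.sum_congr rfl fun e _ => mul_comm (chr (met F C) a c e x) _]
    ring
  rw [h3, h3] at h4
  simp only [h2] at h4
  have h6 : ∑ e, str a b e • (J x * G e - G e * J x) =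
      J x * (∑ e, str a b e • G e) - (∑ e, str a b e • G e) * J x := by
    simp only [smul_sub, Finset.sum_sub_distrib, Finset.mul_sum, Finset.sum_mul, mul_smul_comm,
      smul_mul_assoc]
  rw [h6] at h4
  rw [h5, ← sub_eq_zero]
  rw [← sub_eq_zero] at h4
  rw [← h4]
  noncomm_ring

end

/-! ### Ricci-flat Kähler metrics -/

section

variable {S I : Set ℝ} {F C : ℝ → ℝ} {x : ℍ[ℝ]}

/-- The curvature of a Ricci-flat metric is its Weyl tensor. -/
theorem riem_mul_gv_of_isRicciFlat (h : IsSmoothPair S F C) (hR : IsRicciFlat S (met F C))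
    (hx : x ∈ region S) (a b c d : Fin 4) :
    riem (met F C) a b c d x * gv (F (Real.log ‖x‖)) (C (Real.log ‖x‖)) d =
      if d = xr a (xr b c) then
      cur (C (Real.log ‖x‖) * wv F (Real.log ‖x‖) / 6)
        (-(C (Real.log ‖x‖) * wv F (Real.log ‖x‖) / F (Real.log ‖x‖) / 12))
        (-(C (Real.log ‖x‖) * F (Real.log ‖x‖) * wv F (Real.log ‖x‖) / 3))
        (2 * C (Real.log ‖x‖) * wv F (Real.log ‖x‖) / 3)
        (C (Real.log ‖x‖) * deriv F (Real.log ‖x‖) / 2) a b c else 0 := by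
  have h1 := weyl_met h hx ![a, b, c, d]
  simp only [weyl, hR x hx, (isRicciFlat_iff.1 hR).2 x hx, rm, met_apply, mul_ite, mul_zero,
    Finset.sum_ite_eq', Finset.mem_univ, if_true, Matrix.cons_val] at h1
  refine Eq.trans ?_ h1
  ring

/-- The algebra behind this fact: two endomorphisms that are block sums of infinitesimal rotations in the
same pair of orthogonal planes, with linearly independent pairs of angles, only commute with
endomorphisms that preserve the planes. -/
theorem eq_zero_of_det {p q p' q' u v : ℝ} (h1 : u * q = p * v) (h2 : u * q' = p' * v)
    (hd : p * q' - p' * q ≠ 0) : v = 0 :=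
  (mul_eq_zero.1 (show (p * q' - p' * q) * v = 0 by linear_combination q * h2 - q' * h1)).resolve_left
    hd

/-- The two halves of the Weyl tensor of a Ricci-flat Kähler metric cannot both be non-zero: otherwise
the curvature operators generate all rotations of the tangent space, and the complex structure commutes
with them. -/
theorem IsKahler.weyl_halves_mul (h : IsSmoothPair S F C) (hR : IsRicciFlat S (met F C))
    {J : ℍ[ℝ] → Matrix (Fin 4) (Fin 4) ℝ} (hJ : IsKahler S (met F C) J) {z : ℝ} (hz : z ∈ S) :
    (wv F z + 3 * deriv F z) * (wv F z - 3 * deriv F z) = 0 := by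
  have hx := exp_mem_region hz
  have hcomm := fun a b d c => congrFun (congrFun (hJ.commute_riem h hx a b) d) c
  have hcur := riem_mul_gv_of_isRicciFlat h hR hx
  have hsq := hJ.sq _ hx
  have hcompat := hJ.compatible _ hx
  have hF0 := h.pos_F z hz
  have hC0 := h.pos_C z hz
  rw [log_norm_exp] at hcur
  have hg := gv_pos hF0 hC0
  obtain ⟨R, hRd⟩ : ∃ R : Fin 4 → Fin 4 → Fin 4 → Fin 4 → ℝ,
    R = fun a b c d => riem (met F C) a b c d ((Real.exp z : ℝ) : ℍ[ℝ]) := ⟨_, rfl⟩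
  have hR0 : ∀ a b c d, d ≠ xr a (xr b c) → R a b c d = 0 := by
    intro a b c d hd
    have h1 := hcur a b c d
    rw [if_neg hd] at h1
    rw [hRd]
    exact (mul_eq_zero.1 h1).resolve_right (hg d).ne'
  have hR1 := fun a b c => hcur a b c (xr a (xr b c))
  -- `g J` is antisymmetric
  have hanti : J ((Real.exp z : ℝ) : ℍ[ℝ]) 0 0 = 0 := by
    have h1 : (J ((Real.exp z : ℝ) : ℍ[ℝ])).transpose * met F C ((Real.exp z : ℝ) : ℍ[ℝ]) =
        -(met F C ((Real.exp z : ℝ) : ℍ[ℝ]) * J ((Real.exp z : ℝ) : ℍ[ℝ])) := by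
      rw [← neg_eq_iff_eq_neg]
      conv_rhs => rw [← hcompat]
      rw [mul_assoc, hsq, mul_neg, mul_one]
    have h2 := congrFun (congrFun h1 0) 0
    simp only [Matrix.mul_apply, Matrix.neg_apply, Matrix.transpose_apply, met_apply, log_norm_exp,
      mul_ite, ite_mul, mul_zero, zero_mul, Finset.sum_ite_eq, Finset.sum_ite_eq', Finset.mem_univ,
      if_true] at h2
    have h3 := (hg 0).ne'
    have h4 : gv (F z) (C z) 0 * J ((Real.exp z : ℝ) : ℍ[ℝ]) 0 0 = 0 := by linarith
    exact (mul_eq_zero.1 h4).resolve_left h3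
  have hsq0 := congrFun (congrFun hsq 0) 0
  simp only [Matrix.mul_apply, Fin.sum_univ_four, Matrix.neg_apply, Matrix.one_apply, if_true,
    hanti] at hsq0
  by_contra hne
  have e1 : deriv F z ^ 2 - wv F z ^ 2 / 9 ≠ 0 := fun h0 => hne (by linear_combination -9 * h0)
  have hcomm' : ∀ a b d c, ∑ e, J ((Real.exp z : ℝ) : ℍ[ℝ]) d e * R a b c e =
      ∑ e, R a b e d * J ((Real.exp z : ℝ) : ℍ[ℝ]) e c := by
    intro a b d c
    have h1 := hcomm a b d c
    rw [Matrix.mul_apply, Matrix.mul_apply] at h1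
    rw [hRd]
    exact h1
  have hR1' : ∀ a b c, R a b c (xr a (xr b c)) * gv (F z) (C z) (xr a (xr b c)) =
      cur (C z * wv F z / 6) (-(C z * wv F z / F z / 12)) (-(C z * F z * wv F z / 3))
        (2 * C z * wv F z / 3) (C z * deriv F z / 2) a b c := by
    intro a b c
    have := hR1 a b c
    rw [if_pos rfl] at this
    rw [hRd]
    exact this
  generalize J ((Real.exp z : ℝ) : ℍ[ℝ]) = j at *
  clear hR1 hcur hcomm hRd hsq hcompat hR
  have hF1 := hF0.ne'
  have hC1 := hC0.ne'
  have r : ∀ a b c d t, d = xr a (xr b c) → t = cur (C z * wv F z / 6) (-(C z * wv F z / F z / 12))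
      (-(C z * F z * wv F z / 3)) (2 * C z * wv F z / 3) (C z * deriv F z / 2) a b c
        / gv (F z) (C z) d → R a b c d = t := by
    rintro a b c d t rfl rfl
    rw [eq_div_iff (hg _).ne', hR1']
  have r0110 := r 0 1 0 1 (wv F z / (6 * F z)) rfl (by simp [cur, gv]; field_simp)
  have r0123 := r 0 1 2 3 (-deriv F z) rfl (by simp [cur, gv]; field_simp)
  have r0132 := r 0 1 3 2 (deriv F z) rfl (by simp [cur, gv]; field_simp)
  have r2301 := r 2 3 0 1 (-deriv F z / F z) rfl (by simp [cur, gv]; field_simp)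
  have r2323 := r 2 3 2 3 (2 * wv F z / 3) rfl (by simp [cur, gv]; field_simp)
  have r2332 := r 2 3 3 2 (-(2 * wv F z / 3)) rfl (by simp [cur, gv]; field_simp)
  have r0213 := r 0 2 1 3 (-deriv F z / 2) rfl (by simp [cur, gv]; field_simp)
  have r0202 := r 0 2 0 2 (-(wv F z / F z / 12)) rfl (by simp [cur, gv]; field_simp)
  have r1313 := r 1 3 1 3 (-(F z * wv F z / 3)) rfl (by simp [cur, gv]; field_simp)
  have r1302 := r 1 3 0 2 (-deriv F z / 2) rfl (by simp [cur, gv]; field_simp)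
  -- off-diagonal entries of the commutators with the curvatures of three pairs of orthogonal planes
  have a1 := hcomm' 0 1 1 2
  have a2 := hcomm' 2 3 1 2
  have b1 := hcomm' 0 1 1 3
  have b2 := hcomm' 2 3 1 3
  have c1 := hcomm' 0 2 2 1
  have c2 := hcomm' 1 3 2 1
  simp only [Fin.sum_univ_four] at a1 a2 b1 b2 c1 c2
  rw [hR0 0 1 2 0 (by decide), hR0 0 1 2 1 (by decide), hR0 0 1 2 2 (by decide), r0123,
    hR0 0 1 1 1 (by decide), hR0 0 1 3 1 (by decide), r0110] at a1
  rw [hR0 2 3 2 0 (by decide), hR0 2 3 2 1 (by decide), hR0 2 3 2 2 (by decide), r2323,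
    hR0 2 3 1 1 (by decide), hR0 2 3 3 1 (by decide), r2301] at a2
  rw [hR0 0 1 3 0 (by decide), hR0 0 1 3 1 (by decide), hR0 0 1 3 3 (by decide), r0132,
    hR0 0 1 1 1 (by decide), hR0 0 1 2 1 (by decide), r0110] at b1
  rw [hR0 2 3 3 0 (by decide), hR0 2 3 3 1 (by decide), hR0 2 3 3 3 (by decide), r2332,
    hR0 2 3 1 1 (by decide), hR0 2 3 2 1 (by decide), r2301] at b2
  rw [hR0 0 2 1 0 (by decide), hR0 0 2 1 1 (by decide), hR0 0 2 1 2 (by decide), r0213,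
    hR0 0 2 2 2 (by decide), hR0 0 2 3 2 (by decide), r0202] at c1
  rw [hR0 1 3 1 0 (by decide), hR0 1 3 1 1 (by decide), hR0 1 3 1 2 (by decide), r1313,
    hR0 1 3 2 2 (by decide), hR0 1 3 3 2 (by decide), r1302] at c2
  have k1 : j 0 2 = 0 := by
    refine eq_zero_of_det (u := j 1 3) (p := wv F z / (6 * F z)) (q := -deriv F z)
      (p' := -deriv F z / F z) (q' := 2 * wv F z / 3) (by linear_combination a1)
      (by linear_combination a2) fun h0 => e1 ?_
    field_simp at h0
    linarith
  have k2 : j 0 3 = 0 := by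
    refine eq_zero_of_det (u := j 1 2) (p := wv F z / (6 * F z)) (q := deriv F z)
      (p' := -deriv F z / F z) (q' := -(2 * wv F z / 3)) (by linear_combination b1)
      (by linear_combination b2) fun h0 => e1 ?_
    field_simp at h0
    linarith
  have k3 : j 0 1 = 0 := by
    refine eq_zero_of_det (u := j 2 3) (p := -(wv F z / F z / 12)) (q := -deriv F z / 2)
      (p' := -deriv F z / 2) (q' := -(F z * wv F z / 3)) (by linear_combination c1)
      (by linear_combination c2) fun h0 => e1 ?_
    field_simp at h0
    linarith
  rw [k1, k2, k3] at hsq0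
  norm_num at hsq0

/-- One half of the Weyl tensor vanishes, and the two halves `w ± 3 F'` are multiples of
`c₃ e ^ (-z) + c₄` and of `c₁ e ^ (-z) + c₂`. -/
theorem HasEinsteinForm.eq_zero_of_isKahler (hI : IsData I F C) {c₁ c₂ c₃ c₄ c₅ c₆ : ℝ}
    (hf : HasEinsteinForm I F C c₁ c₂ c₃ c₄ c₅ c₆) (hR : IsRicciFlat I (met F C))
    {J : ℍ[ℝ] → Matrix (Fin 4) (Fin 4) ℝ} (hJ : IsKahler I (met F C) J) :
    c₁ = 0 ∧ c₂ = 0 ∨ c₃ = 0 ∧ c₄ = 0 := by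
  obtain ⟨z, hz⟩ := hI.nonempty
  have h := hI.isSmoothPair
  have h1 := hJ.weyl_halves_mul h hR hz
  obtain ⟨e0, e1, e2⟩ := hf.derivs h hz
  have h0 := hf.ne_zero h hz
  have h12 := hf.2.2.1
  have h34 := hf.2.2.2
  have hX := (Real.exp_pos (-z)).ne'
  rw [wv, e0, e1, e2] at h1
  generalize Real.exp (-z) = X at *
  rcases mul_eq_zero.1 h1 with h2 | h2
  · right
    have h3 : c₃ * X + c₄ = 0 := by
      field_simp at h2
      linear_combination h2 / 6
    have h4 : c₄ = 0 := (mul_eq_zero.1 (show c₄ * (c₅ + c₆ * X) = 0 by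
      linear_combination c₅ * h3 - X * h34)).resolve_right h0
    rw [h4, add_zero] at h3
    exact ⟨(mul_eq_zero.1 h3).resolve_right hX, h4⟩
  · left
    have h3 : c₁ * X + c₂ = 0 := by
      refine (mul_eq_zero.1 (show (6 * X) * (c₁ * X + c₂) = 0 from ?_)).resolve_left (by positivity)
      field_simp at h2
      refine mul_left_cancel₀ (pow_ne_zero 2 hX) ?_
      linear_combination h2
    have h4 : c₁ = 0 := (mul_eq_zero.1 (show c₁ * (c₅ + c₆ * X) = 0 by
      linear_combination h12 + c₆ * h3)).resolve_right h0
    rw [h4, zero_mul, zero_add] at h3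
    exact ⟨h4, h3⟩

end

/-! ### Complex structures that are not `U(2)`-invariant -/

section

variable {S I : Set ℝ} {F C : ℝ → ℝ} {x : ℍ[ℝ]}

instance instStarModuleQuaternion : StarModule ℝ ℍ[ℝ] :=
  ⟨fun r x => by rw [Quaternion.star_smul, star_trivial r]⟩

theorem co_eq_inner (v : ℍ[ℝ]) (i : Fin 4) : co v i = Inner.inner ℝ (fr i) v := by
  revert i
  simp only [forall_fin_four]
  simp only [Quaternion.inner_def, Quaternion.re_mul, Quaternion.re_star, Quaternion.imI_star,
    Quaternion.imJ_star, Quaternion.imK_star]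
  simp [co, fr]

/-- The components of `x⁻¹ i x`, a unit vector orthogonal to `1` that depends on the direction of `x`
only; the exponential is `‖x‖⁻²`. -/
noncomputable def nv (x : ℍ[ℝ]) (i : Fin 4) : ℝ :=
  co (star x * fr 1 * x) i * Real.exp (-2 * Real.log ‖x‖)

theorem nv_zero (x : ℍ[ℝ]) : nv x 0 = 0 := by
  simp only [nv, co, Matrix.cons_val, Quaternion.re_mul, Quaternion.imI_mul, Quaternion.imJ_mul,
    Quaternion.imK_mul, Quaternion.re_star, Quaternion.imI_star, Quaternion.imJ_star,
    Quaternion.imK_star]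
  simp only [fr, Matrix.cons_val]
  ring

theorem nv_sq (hx : x ≠ 0) : nv x 1 ^ 2 + nv x 2 ^ 2 + nv x 3 ^ 2 = 1 := by
  have h1 : Real.exp (-2 * Real.log ‖x‖) = (Quaternion.normSq x)⁻¹ := by
    rw [Quaternion.normSq_eq_norm_mul_self, exp_neg_two_mul, Real.exp_neg,
      Real.exp_log (norm_pos_iff.2 hx), inv_pow, pow_two]
  have h2 : Quaternion.normSq x ≠ 0 := Quaternion.normSq_ne_zero.2 hx
  simp only [nv, h1]
  rw [Quaternion.normSq_def'] at h2 ⊢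
  simp only [co, Matrix.cons_val, Quaternion.re_mul, Quaternion.imI_mul, Quaternion.imJ_mul,
    Quaternion.imK_mul, Quaternion.re_star, Quaternion.imI_star, Quaternion.imJ_star,
    Quaternion.imK_star]
  simp only [fr, Matrix.cons_val]
  field_simp
  ring

theorem contDiffOn_nv (i : Fin 4) : ContDiffOn ℝ ∞ (fun x => nv x i) (region S) := by
  have h1 : ContDiff ℝ ∞ fun x : ℍ[ℝ] => co (star x * fr 1 * x) i := by
    simp only [co_eq_inner]
    have h2 : ContDiff ℝ ∞ fun x : ℍ[ℝ] => star x := (starL' ℝ : ℍ[ℝ] ≃L[ℝ] ℍ[ℝ]).contDiff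
    exact contDiff_const.inner ℝ ((h2.mul contDiff_const).mul contDiff_id)
  refine h1.contDiffOn.mul (contDiffOn_radial (φ := fun z => Real.exp (-2 * z)) ?_)
  fun_prop

/-- The vector `x⁻¹ i x` is constant along the radial direction, and right translations rotate it. -/
theorem D_nv (hx : x ≠ 0) (a i : Fin 4) :
    D a (fun y => nv y i) x = strc (xr a i) a * nv x (xr a i) := by
  have h1 := ((hasFDerivAt_id (𝕜 := ℝ) x).star.mul_const' (fr 1)).mul' (hasFDerivAt_id (𝕜 := ℝ) x)
  have h2 := (innerSL ℝ (fr i)).hasFDerivAt.comp x h1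
  have h3 : D a (fun y : ℍ[ℝ] => co (star y * fr 1 * y) i) x =
      co (star x * fr 1 * x * fr a + star (fr a) * (star x * fr 1 * x)) i := by
    have h4 : (fun y : ℍ[ℝ] => co (star y * fr 1 * y) i) =
        (innerSL ℝ (fr i)) ∘ fun y : ℍ[ℝ] => star y * fr 1 * y := by
      funext y
      simp [co_eq_inner]
    rw [D, h4]
    have h5 : fderiv ℝ ((innerSL ℝ (fr i)) ∘ fun y : ℍ[ℝ] => star y * fr 1 * y) x = _ := h2.fderiv
    rw [h5, co_eq_inner]
    simp [mul_assoc, inner_add_right]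
  have h4 : HasDerivAt (fun z => Real.exp (-2 * z)) (Real.exp (-2 * Real.log ‖x‖) * -2)
      (Real.log ‖x‖) := by
    simpa using ((hasDerivAt_id (Real.log ‖x‖)).const_mul (-2)).exp
  have h6 : D a (fun y : ℍ[ℝ] => Real.exp (-2 * Real.log ‖y‖)) x = _ :=
    D_radial isOpen_univ (S := Set.univ) ⟨hx, Set.mem_univ _⟩ (fun y _ => rfl) h4 a
  have h7 : DifferentiableAt ℝ (fun y : ℍ[ℝ] => co (star y * fr 1 * y) i) x := by
    refine h2.differentiableAt.congr_of_eventuallyEq (Filter.Eventually.of_forall fun y => ?_)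
    simp [co_eq_inner]
  have h8 : D a (fun y => nv y i) x = _ :=
    D_mul h7 (differentiableAt_radial (φ := fun z => Real.exp (-2 * z)) hx h4.differentiableAt) a
  rw [h8, h3, h6]
  -- the term from the derivative of `‖x‖⁻²` cancels because `x⁻¹ i x` has real part `0`
  have h9 : (star x * fr 1 * x).re = 0 := by
    have := nv_zero x
    rw [nv, mul_eq_zero] at this
    exact this.resolve_right (Real.exp_pos _).ne'
  simp only [nv]
  generalize star x * fr 1 * x = q at *
  generalize Real.exp (-2 * Real.log ‖x‖) = e
  clear * - h9
  revert a i
  simp only [forall_fin_four]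
  simp only [co, strc, xr, Matrix.cons_val, Quaternion.re_add, Quaternion.imI_add,
    Quaternion.imJ_add, Quaternion.imK_add, Quaternion.re_mul, Quaternion.imI_mul,
    Quaternion.imJ_mul, Quaternion.imK_mul, Quaternion.re_star, Quaternion.imI_star,
    Quaternion.imJ_star, Quaternion.imK_star, h9, Fin.reduceEq, if_true, if_false]
  simp only [fr, Matrix.cons_val]
  and_intros <;> ring

/-- The coefficients of a complex structure on a metric with `F = r²`: its matrix has the entries
`rho r d b * nv x (xr d b)`.  Equivalently, the entries with `xr d b = i` form the matrix of one of
three anticommuting almost complex structures, and these are combined with the components of the unit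
vector `nv x`. -/
noncomputable def rho (r : ℝ) : Fin 4 → Fin 4 → ℝ :=
  ![![0, -2 * r ^ 2, -2 * r, -2 * r], ![1 / (2 * r ^ 2), 0, -1 / r, 1 / r],
    ![1 / (2 * r), r, 0, -1], ![1 / (2 * r), -r, 1, 0]]

theorem rho_sq {s : ℝ} (hs : s ≠ 0) {n : Fin 4 → ℝ} (h0 : n 0 = 0)
    (h1 : n 1 ^ 2 + n 2 ^ 2 + n 3 ^ 2 = 1) (a b : Fin 4) :
    ∑ e, rho s a e * n (xr a e) * (rho s e b * n (xr e b)) = if a = b then -1 else 0 := by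
  revert a b
  simp only [forall_fin_four, Fin.sum_univ_four]
  simp only [rho, xr, Matrix.cons_val, Fin.reduceEq, if_true, if_false, h0]
  generalize n 1 = n1 at *
  generalize n 2 = n2 at *
  generalize n 3 = n3 at *
  and_intros <;> first
    | (ring; done) | (field_simp; done) | (field_simp; ring_nf; done)
    | (field_simp; linear_combination -h1)

theorem rho_compatible {s : ℝ} (c : ℝ) (hs : s ≠ 0) {n : Fin 4 → ℝ} (h0 : n 0 = 0)
    (h1 : n 1 ^ 2 + n 2 ^ 2 + n 3 ^ 2 = 1) (a b : Fin 4) :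
    ∑ e, rho s e a * n (xr e a) * gv (s ^ 2) c e * (rho s e b * n (xr e b)) =
      if a = b then gv (s ^ 2) c a else 0 := by
  revert a b
  simp only [forall_fin_four, Fin.sum_univ_four]
  simp only [gv, rho, xr, Matrix.cons_val, Fin.reduceEq, if_true, if_false, h0]
  generalize n 1 = n1 at *
  generalize n 2 = n2 at *
  generalize n 3 = n3 at *
  and_intros <;> first
    | (ring; done) | (field_simp; done) | (field_simp; ring_nf; done)
    | (field_simp; linear_combination h1)
    | (field_simp; linear_combination 4 * c * h1)

/-- The derivatives of `rho` with respect to `z`, when `r' = r - 1`. -/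
noncomputable def drho (r : ℝ) : Fin 4 → Fin 4 → ℝ :=
  ![![0, -4 * r * (r - 1), -2 * (r - 1), -2 * (r - 1)],
    ![-(r - 1) / r ^ 3, 0, (r - 1) / r ^ 2, -(r - 1) / r ^ 2],
    ![-(r - 1) / (2 * r ^ 2), r - 1, 0, 0], ![-(r - 1) / (2 * r ^ 2), -(r - 1), 0, 0]]

theorem rho_parallel {s : ℝ} (hs : s ≠ 0) {n : Fin 4 → ℝ} (h0 : n 0 = 0) (a b d : Fin 4) :
    (if a = 0 then drho s d b else 0) * n (xr d b) +
        rho s d b * (strc (xr a (xr d b)) a * n (xr a (xr d b))) +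
      ∑ e, (rho s e b * n (xr e b) *
          (if d = xr a e then gam (s ^ 2) (2 * s * (s - 1)) (2 / s - 1) a e else 0) -
        (if e = xr a b then gam (s ^ 2) (2 * s * (s - 1)) (2 / s - 1) a b else 0) *
          (rho s d e * n (xr d e))) = 0 := by
  revert b d
  fin_cases a <;> simp only [forall_fin_four, Fin.sum_univ_four] <;>
  simp only [rho, drho, xr, strc, gam, Matrix.cons_val, Fin.reduceEq, if_true, if_false, h0,
    Fin.zero_eta, Fin.mk_one, Fin.reduceFinMk] <;>
  and_intros <;> first
    | (ring; done) | (field_simp; done) | (field_simp; ring)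

/-- If `F = r²` with `r' = r - 1`, and `C' / C = 2 / r - 1`, then the metric is Kähler for a complex
structure that is not `U(2)`-invariant: as the point `x` moves on a sphere, it rotates with the axis
`x⁻¹ i x`.  The sign of `r` matters, and is negative for the Taub-NUT metric on `z > 0`. -/
theorem exists_isKahler_of_sq (h : IsSmoothPair S F C) {r : ℝ → ℝ} (hr : ContDiffOn ℝ ∞ r S)
    (hr' : ∀ z ∈ S, HasDerivAt r (r z - 1) z) (hF : ∀ z ∈ S, F z = r z ^ 2)
    (hld : ∀ z ∈ S, ld C z = 2 / r z - 1) : ∃ J, IsKahler S (met F C) J := by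
  have hr0 : ∀ z ∈ S, r z ≠ 0 := fun z hz h0 => by
    have := h.pos_F z hz
    rw [hF z hz, h0] at this
    norm_num at this
  have hd : ∀ z ∈ S, ∀ a b, HasDerivAt (fun z => rho (r z) a b) (drho (r z) a b) z := by
    intro z hz a b
    have h1 := hr' z hz
    have h2 := hr0 z hz
    have h3 : HasDerivAt (fun z => r z ^ 2) (2 * r z * (r z - 1)) z :=
      (h1.pow 2).congr_deriv (by norm_num)
    have h4 : HasDerivAt (fun z => 1 / (2 * r z)) (-(r z - 1) / (2 * r z ^ 2)) z := by
      refine ((hasDerivAt_const z (1 : ℝ)).div (h1.const_mul 2)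
        (mul_ne_zero two_ne_zero h2)).congr_deriv ?_
      field_simp
      ring
    have h5 : HasDerivAt (fun z => 1 / (2 * r z ^ 2)) (-(r z - 1) / r z ^ 3) z := by
      refine ((hasDerivAt_const z (1 : ℝ)).div (h3.const_mul 2)
        (mul_ne_zero two_ne_zero (pow_ne_zero 2 h2))).congr_deriv ?_
      field_simp
      ring
    have h6 : ∀ c : ℝ, HasDerivAt (fun z => c / r z) (-c * (r z - 1) / r z ^ 2) z := fun c =>
      ((hasDerivAt_const z c).div h1 h2).congr_deriv (by ring)
    revert a b
    simp only [forall_fin_four]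
    simp only [rho, drho, Matrix.cons_val]
    and_intros <;> first
      | exact hasDerivAt_const _ _
      | exact h1.const_mul (-2)
      | exact h1
      | exact h1.neg
      | exact h4
      | exact h5
      | exact (h3.const_mul (-2)).congr_deriv (by ring)
      | exact (h6 1).congr_deriv (by ring)
      | exact (h6 (-1)).congr_deriv (by ring)
  have hDJ : ∀ x ∈ region S, ∀ a b d,
      D a (fun y => rho (r (Real.log ‖y‖)) d b * nv y (xr d b)) x =
        (if a = 0 then drho (r (Real.log ‖x‖)) d b else 0) * nv x (xr d b) +
          rho (r (Real.log ‖x‖)) d b * (strc (xr a (xr d b)) a * nv x (xr a (xr d b))) := by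
    intro x hx a b d
    have e1 : D a (fun y => rho (r (Real.log ‖y‖)) d b) x = _ :=
      D_radial h.isOpen hx (fun y _ => rfl) (hd _ hx.2 d b) a
    refine (D_mul (differentiableAt_radial (φ := fun z => rho (r z) d b) hx.1
      (hd _ hx.2 d b).differentiableAt)
      (ContDiffOn.differentiableAt_region h.isOpen (contDiffOn_nv (S := S) (xr d b)) hx) a).trans ?_
    rw [e1, D_nv hx.1]
  obtain ⟨J, hJ⟩ : ∃ J : ℍ[ℝ] → Matrix (Fin 4) (Fin 4) ℝ,
      ∀ x d b, J x d b = rho (r (Real.log ‖x‖)) d b * nv x (xr d b) := ⟨_, fun _ _ _ => rfl⟩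
  refine ⟨J, fun a b => ?_, fun x hx => ?_, fun x hx => ?_, fun x hx a b d => ?_⟩
  · simp only [hJ]
    refine (contDiffOn_radial (φ := fun z => rho (r z) a b) ?_).mul (contDiffOn_nv _)
    have h1 : ∀ z ∈ S, 2 * r z ≠ 0 := fun z hz => mul_ne_zero two_ne_zero (hr0 z hz)
    have h2 : ∀ z ∈ S, 2 * r z ^ 2 ≠ 0 := fun z hz =>
      mul_ne_zero two_ne_zero (pow_ne_zero 2 (hr0 z hz))
    revert a b
    simp only [forall_fin_four]
    simp only [rho, Matrix.cons_val]
    and_intros <;> fun_prop (disch := assumption)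
  · ext a b
    simp only [Matrix.mul_apply, Matrix.neg_apply, Matrix.one_apply, hJ]
    rw [rho_sq (hr0 _ hx.2) (nv_zero x) (nv_sq hx.1)]
    split_ifs <;> simp
  · ext a b
    simp only [Matrix.mul_apply, Matrix.transpose_apply, met_apply, hJ, hF _ hx.2, mul_ite, mul_zero,
      Finset.sum_ite_eq', Finset.mem_univ, if_true]
    exact rho_compatible _ (hr0 _ hx.2) (nv_zero x) (nv_sq hx.1) a b
  · have h4 : deriv F (Real.log ‖x‖) = 2 * r (Real.log ‖x‖) * (r (Real.log ‖x‖) - 1) := by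
      have e1 := (((hr' _ hx.2).pow 2).congr_of_eventuallyEq (f₁ := F) ?_).deriv
      · rw [e1]
        norm_num
      · filter_upwards [h.isOpen.mem_nhds hx.2] with z hz using hF z hz
    simp only [hJ]
    rw [hDJ x hx]
    simp only [chr_met' h hx, gamAt, h4, hF _ hx.2, hld _ hx.2]
    exact rho_parallel (hr0 _ hx.2) (nv_zero x) a b d

end

/-! ### The geometry of the five pairs -/

section

variable {S I : Set ℝ} {F C : ℝ → ℝ} {x : ℍ[ℝ]}

theorem ld_eq_of_hasDerivAt {c c' z : ℝ} (h : HasDerivAt C (c' * c) z) (hc : C z = c) (h0 : c ≠ 0) :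
    ld C z = c' := by
  rw [ld, h.deriv, hc, mul_div_cancel_right₀ _ h0]

theorem ld_exp (z : ℝ) : ld Real.exp z = 1 :=
  ld_eq_of_hasDerivAt ((Real.hasDerivAt_exp z).congr_deriv (one_mul _).symm) rfl (Real.exp_pos z).ne'

theorem ld_exp_neg (z : ℝ) : ld (fun z => Real.exp (-z)) z = -1 :=
  ld_eq_of_hasDerivAt ((hasDerivAt_neg z).exp.congr_deriv (mul_comm _ _)) rfl (Real.exp_pos _).ne'

theorem ld_taubNUT {s z : ℝ} (h : 1 + s * Real.exp z ≠ 0) :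
    ld (fun z => Real.exp z / (1 + s * Real.exp z) ^ 2) z = 2 / (1 + s * Real.exp z) - 1 := by
  have h1 : HasDerivAt (fun z => (1 + s * Real.exp z) ^ 2)
      (2 * (1 + s * Real.exp z) * (s * Real.exp z)) z :=
    ((((Real.hasDerivAt_exp z).const_mul s).const_add 1).pow 2).congr_deriv (by norm_num)
  refine ld_eq_of_hasDerivAt (((Real.hasDerivAt_exp z).div h1 (pow_ne_zero 2 h)).congr_deriv ?_) rfl
    (div_ne_zero (Real.exp_pos z).ne' (pow_ne_zero 2 h))
  have h2 : s * Real.exp z = 1 + s * Real.exp z - 1 := by ring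
  generalize 1 + s * Real.exp z = r at *
  rw [h2]
  field_simp
  ring

theorem fiveF_one : fiveF 1 = fun z => (1 + -1 * Real.exp z) ^ 2 := by
  funext z
  simp only [fiveF, Matrix.cons_val]
  ring

theorem fiveC_one : fiveC 1 = fun z => Real.exp z / (1 + -1 * Real.exp z) ^ 2 := by
  funext z
  simp only [fiveC, Matrix.cons_val]
  congr 1
  ring

theorem fiveF_two : fiveF 2 = fun z => (1 + 1 * Real.exp z) ^ 2 := by
  funext z
  simp only [fiveF, Matrix.cons_val]
  ring

theorem fiveC_two : fiveC 2 = fun z => Real.exp z / (1 + 1 * Real.exp z) ^ 2 := by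
  funext z
  simp only [fiveC, Matrix.cons_val]
  congr 1
  ring

theorem exists_isKahler_five (k : Fin 5) (hI : IsData I (fiveF k) (fiveC k)) :
    ∃ J, IsKahler I (met (fiveF k) (fiveC k)) J := by
  have hTN : ∀ s : ℝ, IsData I (fun z => (1 + s * Real.exp z) ^ 2)
      (fun z => Real.exp z / (1 + s * Real.exp z) ^ 2) → ∃ J, IsKahler I
        (met (fun z => (1 + s * Real.exp z) ^ 2) fun z => Real.exp z / (1 + s * Real.exp z) ^ 2) J := by
    intro s h
    refine exists_isKahler_of_sq h.isSmoothPair (r := fun z => 1 + s * Real.exp z) (by fun_prop)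
      (fun z _ => ?_) (fun _ _ => rfl) fun z hz => ld_taubNUT ?_
    · exact (((Real.hasDerivAt_exp z).const_mul s).const_add 1).congr_deriv (by ring)
    · have := (h.pos_F z hz).ne'
      exact fun h0 => this (by rw [h0]; ring)
  have hEH := fun h : fiveC k = Real.exp =>
    (isKahler_Jminus_iff hI.isSmoothPair).2 fun z _ => h ▸ ld_exp z
  fin_cases k
  · exact ⟨_, (isKahler_Jplus_iff hI.isSmoothPair).2 fun z _ => ld_exp_neg z⟩
  · have := hTN (-1)
    rw [← fiveF_one, ← fiveC_one] at this
    exact this hI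
  · have := hTN 1
    rw [← fiveF_two, ← fiveC_two] at this
    exact this hI
  · exact ⟨_, hEH rfl⟩
  · exact ⟨_, hEH rfl⟩

theorem isRicciFlat_five (k : Fin 5) (hI : IsData I (fiveF k) (fiveC k)) :
    IsRicciFlat I (met (fiveF k) (fiveC k)) := by
  have hEH : ∀ z : ℝ, Real.exp z = Real.exp (-z) / (0 + 1 * Real.exp (-z)) ^ 2 := by
    intro z
    have := (Real.exp_pos z).ne'
    rw [Real.exp_neg]
    field_simp
    norm_num
  suffices h : ∃ c₁ c₂ c₃ c₄ c₅ c₆ : ℝ, HasEinsteinForm I (fiveF k) (fiveC k) c₁ c₂ c₃ c₄ c₅ c₆ ∧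
      c₂ * c₅ ^ 2 - 2 * c₅ * c₆ + c₃ * c₆ ^ 2 = 0 by
    obtain ⟨c₁, c₂, c₃, c₄, c₅, c₆, h, h0⟩ := h
    exact (h.isRicciFlat_iff hI).2 h0
  have hTN : ∀ s z : ℝ, Real.exp z / (1 + s * Real.exp z) ^ 2 =
      Real.exp (-z) / (s + 1 * Real.exp (-z)) ^ 2 := by
    intro s z
    have h1 := (Real.exp_pos z).ne'
    have h2 : s + 1 * (Real.exp z)⁻¹ = (1 + s * Real.exp z) * (Real.exp z)⁻¹ := by field_simp; ring
    rw [Real.exp_neg, h2]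
    field_simp
  clear hI
  fin_cases k
  · refine ⟨0, 0, 0, 0, 1, 0, ⟨fun z _ => ?_, fun z _ => ?_, by norm_num, by norm_num⟩, by norm_num⟩
    · simp [fiveF]
    · simp [fiveC]
  · refine ⟨0, 0, -2, 2, -1, 1, ⟨fun z _ => ?_, fun z _ => ?_, by norm_num, by norm_num⟩,
      by norm_num⟩
    · simp only [fiveF, Fin.mk_one, Matrix.cons_val, exp_two_mul]
      ring
    · simp only [Fin.mk_one, fiveC_one]
      exact hTN _ z
  · refine ⟨0, 0, 2, 2, 1, 1, ⟨fun z _ => ?_, fun z _ => ?_, by norm_num, by norm_num⟩,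
      by norm_num⟩
    · simp only [fiveF, Fin.reduceFinMk, Matrix.cons_val, exp_two_mul]
      ring
    · simp only [Fin.reduceFinMk, fiveC_two]
      exact hTN _ z
  · refine ⟨-2, 0, 0, 0, 0, 1, ⟨fun z _ => ?_, fun z _ => hEH z, by norm_num, by norm_num⟩,
      by norm_num⟩
    simp only [fiveF, Fin.reduceFinMk, Matrix.cons_val]
    ring
  · refine ⟨2, 0, 0, 0, 0, 1, ⟨fun z _ => ?_, fun z _ => hEH z, by norm_num, by norm_num⟩,
      by norm_num⟩
    simp only [fiveF, Fin.reduceFinMk, Matrix.cons_val]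
    ring

theorem isFlat_five_zero : IsFlat Set.univ (met (fiveF 0) (fiveC 0)) := by
  have h : IsSmoothPair Set.univ (fiveF 0) (fiveC 0) :=
    ⟨isOpen_univ, contDiffOn_const, ContDiff.contDiffOn (f := fun z => Real.exp (-z)) (by fun_prop),
      fun _ _ => one_pos, fun _ _ => Real.exp_pos _⟩
  intro x hx i
  rw [rm_met h hx]
  split_ifs with hi
  · have h1 : ld (fiveC 0) = fun _ => -1 := funext ld_exp_neg
    have h2 : fiveF 0 = fun _ => 1 := rfl
    rw [hi, riemAt_mul_gv h hx.2, h1, h2]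
    simp only [deriv_const']
    norm_num
    generalize i 0 = a
    generalize i 1 = b
    generalize i 2 = c
    clear * -
    revert a b c
    simp [forall_fin_four, cur]
  · rfl

/-- The curvature of the plane spanned by `E₂` and `E₃` bounds the norm of the curvature from
below. -/
theorem le_rmNormSq (h : IsSmoothPair S F C) (hx : x ∈ region S) :
    ((-4 + 3 * F (Real.log ‖x‖) + F (Real.log ‖x‖) * ld C (Real.log ‖x‖) ^ 2) /
      C (Real.log ‖x‖)) ^ 2 ≤ rmNormSq (met F C) x := by
  have hF := h.pos_F _ hx.2
  have hC := h.pos_C _ hx.2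
  have h1 : rmNormSq (met F C) x = ∑ i : Fin 4 → Fin 4,
      (∏ k, (gv (F (Real.log ‖x‖)) (C (Real.log ‖x‖)) (i k))⁻¹) * rm (met F C) i x ^ 2 := by
    refine Finset.sum_congr rfl fun i _ => ?_
    rw [Finset.sum_eq_single i]
    · simp only [met_inv_apply hF hC, if_true]
      ring
    · intro j _ hj
      obtain ⟨k, hk⟩ : ∃ k, i k ≠ j k := by
        by_contra! hk
        exact hj (funext hk).symm
      rw [Finset.prod_eq_zero (Finset.mem_univ k) (by rw [met_inv_apply hF hC, if_neg hk]), zero_mul]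
    · exact fun hi => absurd (Finset.mem_univ i) hi
  rw [h1]
  refine le_trans (le_of_eq ?_) (Finset.single_le_sum (fun i _ => ?_)
    (Finset.mem_univ (![2, 3, 2, 3] : Fin 4 → Fin 4)))
  · have h2 := riemAt_mul_gv h hx.2 2 3 2
    rw [rm_met h hx]
    simp only [Fin.prod_univ_four, xr, Matrix.cons_val, if_true, cur, gv] at h2 ⊢
    rw [h2]
    field_simp
  · exact mul_nonneg (Finset.prod_nonneg fun k _ => (inv_pos.2 (gv_pos hF hC _)).le) (sq_nonneg _)

theorem isSmoothPair_five_two : IsSmoothPair Set.univ (fiveF 2) (fiveC 2) := by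
  have h1 : ∀ z : ℝ, 0 < 1 + 1 * Real.exp z := fun z => by positivity
  rw [fiveF_two, fiveC_two]
  refine ⟨isOpen_univ, by fun_prop, ContDiffOn.div (by fun_prop) (by fun_prop)
    fun z _ => pow_ne_zero 2 (h1 z).ne', fun z _ => pow_pos (h1 z) 2,
    fun z _ => div_pos (Real.exp_pos z) (pow_pos (h1 z) 2)⟩

theorem isSmoothPair_five_four : IsSmoothPair Set.univ (fiveF 4) (fiveC 4) := by
  refine ⟨isOpen_univ, ContDiff.contDiffOn (f := fun z => 1 + Real.exp (-2 * z)) (by fun_prop),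
    Real.contDiff_exp.contDiffOn, fun z _ => ?_, fun z _ => Real.exp_pos z⟩
  show 0 < 1 + Real.exp (-2 * z)
  positivity

/-- The logarithm of the norm takes the junk value `0` at the origin, so the origin belongs to no
neighbourhood of an end of the manifold. -/
theorem ne_zero_of_log_norm_ne_zero (h : Real.log ‖x‖ ≠ 0) : x ≠ 0 := by
  rintro rfl
  simp at h

theorem tendsto_rmNormSq_five_two : Filter.Tendsto (rmNormSq (met (fiveF 2) (fiveC 2)))
    (Filter.comap (fun x : ℍ[ℝ] => Real.log ‖x‖) Filter.atTop) Filter.atTop := by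
  refine Filter.tendsto_atTop_mono' _ ?_ (Real.tendsto_exp_atTop.comp Filter.tendsto_comap)
  filter_upwards [Filter.preimage_mem_comap (Filter.Ioi_mem_atTop (0 : ℝ))] with x hx
  refine le_trans ?_ (le_rmNormSq isSmoothPair_five_two
    ⟨ne_zero_of_log_norm_ne_zero (ne_of_gt hx), Set.mem_univ _⟩)
  rw [fiveF_two, fiveC_two, ld_taubNUT (by positivity), Function.comp_apply]
  beta_reduce
  generalize Real.log ‖x‖ = z
  have h1 := Real.exp_pos z
  generalize Real.exp z = e at *
  have h2 : (-4 + 3 * (1 + 1 * e) ^ 2 + (1 + 1 * e) ^ 2 * (2 / (1 + 1 * e) - 1) ^ 2) /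
      (e / (1 + 1 * e) ^ 2) = 4 * (1 + e) ^ 3 := by
    have : (1 : ℝ) + 1 * e ≠ 0 := by positivity
    field_simp
    ring
  rw [h2]
  have h3 : 1 ≤ (1 + e) ^ 3 := one_le_pow₀ (by linarith)
  have h4 : e ≤ (1 + e) ^ 3 := le_trans (by linarith) (le_self_pow₀ (by linarith : (1 : ℝ) ≤ 1 + e)
    three_ne_zero)
  nlinarith

theorem tendsto_rmNormSq_five_four : Filter.Tendsto (rmNormSq (met (fiveF 4) (fiveC 4)))
    (Filter.comap (fun x : ℍ[ℝ] => Real.log ‖x‖) Filter.atBot) Filter.atTop := by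
  refine Filter.tendsto_atTop_mono' _ ?_ (Real.tendsto_exp_atTop.comp
    (Filter.tendsto_neg_atBot_atTop.comp Filter.tendsto_comap))
  filter_upwards [Filter.preimage_mem_comap (Filter.Iio_mem_atBot (0 : ℝ))] with x hx
  refine le_trans ?_ (le_rmNormSq isSmoothPair_five_four
    ⟨ne_zero_of_log_norm_ne_zero (ne_of_lt hx), Set.mem_univ _⟩)
  have hx' : Real.log ‖x‖ < 0 := hx
  have h0 : ld (fiveC 4) (Real.log ‖x‖) = 1 := ld_exp _
  rw [h0, Function.comp_apply, Function.comp_apply]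
  generalize Real.log ‖x‖ = z at *
  show _ ≤ ((-4 + 3 * (1 + Real.exp (-2 * z)) + (1 + Real.exp (-2 * z)) * 1 ^ 2) / Real.exp z) ^ 2
  have h2 : (-4 + 3 * (1 + Real.exp (-2 * z)) + (1 + Real.exp (-2 * z)) * 1 ^ 2) / Real.exp z =
      4 * Real.exp (-z) ^ 3 := by
    rw [exp_neg_two_mul, Real.exp_neg]
    field_simp
    ring
  have h1 : 1 ≤ Real.exp (-z) := Real.one_le_exp (by linarith)
  rw [h2]
  generalize Real.exp (-z) = e at *
  have h3 : 1 ≤ e ^ 3 := one_le_pow₀ h1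
  have h4 : e ≤ e ^ 3 := le_self_pow₀ h1 three_ne_zero
  nlinarith

/-- The distance to the singularity at `z = +∞` is finite. -/
theorem integrableOn_five_two :
    MeasureTheory.IntegrableOn (fun z => √(fiveC 2 z / (4 * fiveF 2 z))) (Set.Ioi 0) := by
  have h := isSmoothPair_five_two
  refine MeasureTheory.Integrable.mono' (exp_neg_integrableOn_Ioi 0 one_pos)
    (ContinuousOn.aestronglyMeasurable ?_ measurableSet_Ioi) ?_
  · refine ContinuousOn.sqrt ?_
    refine ContinuousOn.div (h.smooth_C.continuousOn.mono (Set.subset_univ _))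
      (continuousOn_const.mul (h.smooth_F.continuousOn.mono (Set.subset_univ _))) fun z _ => ?_
    exact (mul_pos four_pos (h.pos_F z trivial)).ne'
  · filter_upwards with z
    rw [Real.norm_of_nonneg (Real.sqrt_nonneg _)]
    refine Real.sqrt_le_iff.2 ⟨(Real.exp_pos _).le, ?_⟩
    rw [fiveF_two, fiveC_two, neg_one_mul, Real.exp_neg]
    beta_reduce
    have h1 := Real.exp_pos z
    generalize Real.exp z = e at *
    rw [div_div, inv_pow, ← one_div, div_le_div_iff₀ (by positivity) (by positivity)]
    have h2 : e ^ 3 ≤ (1 + e) ^ 3 := by gcongr; linarith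
    have h3 : (1 + e) ^ 3 ≤ (1 + e) ^ 4 := pow_le_pow_right₀ (by linarith) (by norm_num)
    rw [one_mul e]
    nlinarith [pow_pos h1 3]

/-- The distance to the singularity at `z = -∞` is finite. -/
theorem integrableOn_five_four :
    MeasureTheory.IntegrableOn (fun z => √(fiveC 4 z / (4 * fiveF 4 z))) (Set.Iio 0) := by
  have h := isSmoothPair_five_four
  refine MeasureTheory.Integrable.mono' ((integrableOn_exp_Iic 0).mono_set Set.Iio_subset_Iic_self)
    (ContinuousOn.aestronglyMeasurable ?_ measurableSet_Iio) ?_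
  · refine ContinuousOn.sqrt ?_
    refine ContinuousOn.div (h.smooth_C.continuousOn.mono (Set.subset_univ _))
      (continuousOn_const.mul (h.smooth_F.continuousOn.mono (Set.subset_univ _))) fun z _ => ?_
    exact (mul_pos four_pos (h.pos_F z trivial)).ne'
  · filter_upwards with z
    rw [Real.norm_of_nonneg (Real.sqrt_nonneg _)]
    refine Real.sqrt_le_iff.2 ⟨(Real.exp_pos _).le, ?_⟩
    show Real.exp z / (4 * (1 + Real.exp (-2 * z))) ≤ _
    rw [exp_neg_two_mul, Real.exp_neg]
    have h1 := Real.exp_pos z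
    generalize Real.exp z = e at *
    have h2 : e / (4 * (1 + e⁻¹ ^ 2)) = e ^ 3 / (4 * (e ^ 2 + 1)) := by field_simp
    rw [h2, div_le_iff₀ (by positivity)]
    nlinarith [sq_nonneg e, sq_nonneg (e ^ 2), sq_nonneg (e - 1), sq_nonneg (e * (e - 1)),
      pow_pos h1 3, pow_pos h1 2]

end

end U2

theorem mainTheorem8 :
    -- the conditions on a given metric
    (∀ (I : Set ℝ) (F C : ℝ → ℝ), U2.IsData I F C →
      -- Einstein metrics are given by the explicit form, and they satisfy the other two conditions
      (U2.IsEinstein I (U2.met F C) ↔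
        ∃ c₁ c₂ c₃ c₄ c₅ c₆ : ℝ, U2.HasEinsteinForm I F C c₁ c₂ c₃ c₄ c₅ c₆) ∧
      (U2.IsEinstein I (U2.met F C) → U2.IsHarmonicCurvature I (U2.met F C)) ∧
      (U2.IsHarmonicCurvature I (U2.met F C) → U2.IsHarmonicWeyl I (U2.met F C)) ∧
      -- the four conditions are equivalent unless the Weyl tensor vanishes identically
      (¬ U2.IsWeylFlat I (U2.met F C) →
        List.TFAE
          [U2.IsHarmonicWeyl I (U2.met F C),
           U2.IsHarmonicCurvature I (U2.met F C),
           U2.IsEinstein I (U2.met F C),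
           ∃ c₁ c₂ c₃ c₄ c₅ c₆ : ℝ, U2.HasEinsteinForm I F C c₁ c₂ c₃ c₄ c₅ c₆]) ∧
      -- scalar curvature, and the Kähler-Einstein conditions
      (∀ c₁ c₂ c₃ c₄ c₅ c₆ : ℝ, U2.HasEinsteinForm I F C c₁ c₂ c₃ c₄ c₅ c₆ →
        (∀ x ∈ U2.region I,
          U2.scal (U2.met F C) x = -24 * (c₂ * c₅ ^ 2 - 2 * c₅ * c₆ + c₃ * c₆ ^ 2)) ∧
        (U2.IsKahlerEinstein I (U2.met F C) (U2.Jplus F) ↔ c₆ = 0) ∧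
        (c₆ = 0 → c₁ = 0 ∧ c₃ = 0) ∧
        (U2.IsKahlerEinstein I (U2.met F C) (U2.Jminus F) ↔ c₅ = 0) ∧
        (c₅ = 0 → c₂ = 0 ∧ c₄ = 0)) ∧
      -- Bach-flat metrics are the conformally Einstein ones, away from at most one slice
      List.TFAE
        [U2.IsBachFlat I (U2.met F C),
         ∃ Z : Set ℝ, Z.Subsingleton ∧ U2.IsConformallyEinstein (I \ Z) (U2.met F C),
         ∃ (Z : Set ℝ) (K : ℝ → ℝ), Z.Subsingleton ∧ ContDiffOn ℝ ∞ K (I \ Z) ∧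
           (∀ z ∈ I \ Z, 0 < K z) ∧ U2.IsEinstein (I \ Z) (U2.met F K)]) ∧
    -- Einstein metrics up to homothety: a two-parameter family
    ((∀ (I : Set ℝ) (F C : ℝ → ℝ), U2.IsData I F C → U2.IsEinstein I (U2.met F C) →
        ∃ (σ a b : ℝ) (I' : Set ℝ), U2.IsNormalized σ a b ∧
          U2.IsData I' (U2.nfF σ a b) (U2.nfC σ) ∧
          U2.Homothetic I F C I' (U2.nfF σ a b) (U2.nfC σ)) ∧
      (∀ (σ a b : ℝ) (I : Set ℝ), U2.IsData I (U2.nfF σ a b) (U2.nfC σ) →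
        U2.IsEinstein I (U2.met (U2.nfF σ a b) (U2.nfC σ))) ∧
      (∀ σ a b : ℝ, 0 < b → ∃ I : Set ℝ, U2.IsData I (U2.nfF σ a b) (U2.nfC σ)) ∧
      (∀ (σ a b σ' a' b' : ℝ) (I I' : Set ℝ),
        U2.IsNormalized σ a b → U2.IsNormalized σ' a' b' →
        U2.IsData I (U2.nfF σ a b) (U2.nfC σ) → U2.IsData I' (U2.nfF σ' a' b') (U2.nfC σ') →
        U2.Homothetic I (U2.nfF σ a b) (U2.nfC σ) I' (U2.nfF σ' a' b') (U2.nfC σ') →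
        σ' = σ ∧ ((a' = a ∧ b' = b) ∨ (σ ≠ 0 ∧ a' = σ * b ∧ b' = σ * a)))) ∧
    -- Ricci-flat metrics up to homothety: a one-parameter family
    ((∀ (I : Set ℝ) (F C : ℝ → ℝ), U2.IsData I F C → U2.IsRicciFlat I (U2.met F C) →
        ∃ (σ b : ℝ) (I' : Set ℝ), U2.IsNormalized σ (σ * (2 - b)) b ∧
          U2.IsData I' (U2.nfF σ (σ * (2 - b)) b) (U2.nfC σ) ∧
          U2.Homothetic I F C I' (U2.nfF σ (σ * (2 - b)) b) (U2.nfC σ)) ∧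
      (∀ (σ a b : ℝ) (I : Set ℝ), U2.IsNormalized σ a b →
        U2.IsData I (U2.nfF σ a b) (U2.nfC σ) →
        (U2.IsRicciFlat I (U2.met (U2.nfF σ a b) (U2.nfC σ)) ↔ a = σ * (2 - b))) ∧
      (∀ σ b : ℝ, U2.IsNormalized σ (σ * (2 - b)) b →
        ∃ I : Set ℝ, U2.IsData I (U2.nfF σ (σ * (2 - b)) b) (U2.nfC σ))) ∧
    -- Kähler-Einstein metrics up to homothety: a one-parameter family, and its mirror image
    ((∀ (I : Set ℝ) (F C : ℝ → ℝ), U2.IsData I F C →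
        (U2.IsKahlerEinstein I (U2.met F C) (U2.Jplus F) ∨
          U2.IsKahlerEinstein I (U2.met F C) (U2.Jminus F)) →
        ∃ (a b : ℝ) (I' : Set ℝ), U2.IsNormalized 0 a b ∧
          U2.IsData I' (U2.nfF 0 a b) (U2.nfC 0) ∧
          U2.Homothetic I F C I' (U2.nfF 0 a b) (U2.nfC 0)) ∧
      (∀ (a b : ℝ) (I : Set ℝ), U2.IsData I (U2.nfF 0 a b) (U2.nfC 0) →
        U2.IsKahlerEinstein I (U2.met (U2.nfF 0 a b) (U2.nfC 0)) (U2.Jplus (U2.nfF 0 a b))) ∧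
      (∀ (I : Set ℝ) (F C : ℝ → ℝ), U2.IsData I F C →
        (U2.IsKahlerEinstein I (U2.met F C) (U2.Jplus F) ↔
          U2.IsKahlerEinstein {z | -z ∈ I} (U2.met (fun z => F (-z)) (fun z => C (-z)))
            (U2.Jminus (fun z => F (-z)))))) ∧
    -- exactly five Ricci-flat Kähler metrics up to homothety
    ((∀ k : Fin 5, ∃ I : Set ℝ, U2.IsData I (U2.fiveF k) (U2.fiveC k)) ∧
      (∀ (k : Fin 5) (I : Set ℝ), U2.IsData I (U2.fiveF k) (U2.fiveC k) →
        U2.IsRicciFlat I (U2.met (U2.fiveF k) (U2.fiveC k)) ∧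
        ∃ J, U2.IsKahler I (U2.met (U2.fiveF k) (U2.fiveC k)) J) ∧
      (∀ (I : Set ℝ) (F C : ℝ → ℝ), U2.IsData I F C → U2.IsRicciFlat I (U2.met F C) →
        (∃ J, U2.IsKahler I (U2.met F C) J) →
        ∃ (k : Fin 5) (I' : Set ℝ), U2.IsData I' (U2.fiveF k) (U2.fiveC k) ∧
          U2.Homothetic I F C I' (U2.fiveF k) (U2.fiveC k)) ∧
      (∀ (k l : Fin 5) (I I' : Set ℝ), U2.IsData I (U2.fiveF k) (U2.fiveC k) →
        U2.IsData I' (U2.fiveF l) (U2.fiveC l) →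
        U2.Homothetic I (U2.fiveF k) (U2.fiveC k) I' (U2.fiveF l) (U2.fiveC l) → k = l) ∧
      -- the first is flat; the third and the fifth have curvature singularities at finite distance
      U2.IsFlat Set.univ (U2.met (U2.fiveF 0) (U2.fiveC 0)) ∧
      (MeasureTheory.IntegrableOn (fun z => √(U2.fiveC 2 z / (4 * U2.fiveF 2 z))) (Set.Ioi 0) ∧
        Filter.Tendsto (U2.rmNormSq (U2.met (U2.fiveF 2) (U2.fiveC 2)))
          (Filter.comap (fun x : ℍ[ℝ] => Real.log ‖x‖) Filter.atTop) Filter.atTop) ∧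
      (MeasureTheory.IntegrableOn (fun z => √(U2.fiveC 4 z / (4 * U2.fiveF 4 z))) (Set.Iio 0) ∧
        Filter.Tendsto (U2.rmNormSq (U2.met (U2.fiveF 4) (U2.fiveC 4)))
          (Filter.comap (fun x : ℍ[ℝ] => Real.log ‖x‖) Filter.atBot) Filter.atTop)) := by
  have hform : ∀ (I : Set ℝ) (F C : ℝ → ℝ), U2.IsData I F C → (U2.IsEinstein I (U2.met F C) ↔
      ∃ c₁ c₂ c₃ c₄ c₅ c₆ : ℝ, U2.HasEinsteinForm I F C c₁ c₂ c₃ c₄ c₅ c₆) := fun I F C hI =>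
    ⟨fun h => h.exists_form hI.isSmoothPair hI.ordConnected,
      fun ⟨_, _, _, _, _, _, h⟩ => h.isEinstein hI.isSmoothPair⟩
  have hcurv : ∀ (I : Set ℝ) (F C : ℝ → ℝ), U2.IsData I F C →
      U2.IsHarmonicCurvature I (U2.met F C) → U2.IsHarmonicWeyl I (U2.met F C) := fun I F C hI h =>
    (U2.isHarmonicWeyl_iff hI.isSmoothPair).2 fun z hz =>
      let h' := (U2.isHarmonicCurvature_iff hI.isSmoothPair).1 h z hz
      ⟨h'.1, h'.2.1⟩
  refine ⟨fun I F C hI => ⟨hform I F C hI, fun h => h.isHarmonicCurvature hI.isSmoothPair,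
    hcurv I F C hI, fun hW => ?_, fun c₁ c₂ c₃ c₄ c₅ c₆ hf => ⟨fun x hx =>
      hf.scal_eq hI.isSmoothPair hx, hf.isKahlerEinstein_Jplus_iff hI, hf.eq_zero_of_c₆ hI,
      hf.isKahlerEinstein_Jminus_iff hI, hf.eq_zero_of_c₅ hI⟩, ?_⟩,
    ⟨fun I F C hI hE => ?_, fun σ a b I hI =>
      (U2.hasEinsteinForm_nf σ a b I).isEinstein hI.isSmoothPair,
      fun σ a b hb => U2.exists_isData_nf_of_pos hb,
      fun σ a b σ' a' b' I I' hn hn' hI hI' h => (h.affRel hI hI').normalized_unique hI.isOpen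
        hI.nonempty hn hn' hI.pos_C⟩,
    ⟨fun I F C hI hR => ?_, fun σ a b I hn hI => U2.isRicciFlat_nf_iff hn hI,
      fun σ b hn => U2.exists_isData_nf_ricciFlat hn⟩,
    ⟨fun I F C hI hK => ?_, fun a b I hI =>
      ((U2.hasEinsteinForm_nf 0 a b I).isKahlerEinstein_Jplus_iff hI).2 rfl,
      fun I F C hI => U2.isKahlerEinstein_comp_neg hI.isSmoothPair⟩,
    U2.exists_isData_five, fun k I hI => ⟨U2.isRicciFlat_five k hI, U2.exists_isKahler_five k hI⟩,
    fun I F C hI hR hJ => ?_, fun k l I I' hI hI' h => U2.five_homothetic_unique hI hI' h,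
    U2.isFlat_five_zero, ⟨U2.integrableOn_five_two, U2.tendsto_rmNormSq_five_two⟩,
    U2.integrableOn_five_four, U2.tendsto_rmNormSq_five_four⟩
  · tfae_have 4 ↔ 3 := (hform I F C hI).symm
    tfae_have 3 → 2 := fun h => h.isHarmonicCurvature hI.isSmoothPair
    tfae_have 2 → 1 := hcurv I F C hI
    tfae_have 1 → 3 := fun h =>
      U2.isEinstein_of_isHarmonicWeyl hI.isSmoothPair hI.ordConnected h hW
    tfae_finish
  · have hS : ∀ Z : Set ℝ, Z.Subsingleton → U2.IsSmoothPair (I \ Z) F C := fun Z hZ =>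
      ⟨hI.isOpen.sdiff hZ.isClosed, hI.smooth_F.mono Set.sdiff_subset,
        hI.smooth_C.mono Set.sdiff_subset, fun z hz => hI.pos_F z hz.1, fun z hz => hI.pos_C z hz.1⟩
    tfae_have 1 → 3 := fun h => h.exists_conformal hI.isSmoothPair hI.ordConnected hI.nonempty
    tfae_have 3 → 1 := fun ⟨Z, K, hZ, hK, hK0, hE⟩ =>
      U2.isBachFlat_of_conformal hI.isSmoothPair hZ hK hK0 hE
    tfae_have 2 → 3 := fun ⟨Z, hZ, h⟩ =>
      let ⟨K, hK, hK0, hE⟩ := h.exists_radial (hS Z hZ)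
      ⟨Z, K, hZ, hK, hK0, hE⟩
    tfae_have 3 → 2 := fun ⟨Z, K, hZ, hK, hK0, hE⟩ =>
      ⟨Z, hZ, U2.isConformallyEinstein_of_radial (hS Z hZ) hK hK0 hE⟩
    tfae_finish
  · obtain ⟨c₁, c₂, c₃, c₄, c₅, c₆, hf⟩ := (hform I F C hI).1 hE
    obtain ⟨σ, a, b, hn, h, -⟩ := hf.exists_normal_form hI
    obtain ⟨I', hI', hh⟩ := h.homothetic hI
    exact ⟨σ, a, b, I', hn, hI', hh⟩
  · obtain ⟨c₁, c₂, c₃, c₄, c₅, c₆, hf⟩ := (hform I F C hI).1 (U2.isRicciFlat_iff.1 hR).1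
    obtain ⟨σ, a, b, hn, h, -, h2, -⟩ := hf.exists_normal_form hI
    obtain ⟨I', hI', hh⟩ := h.homothetic hI
    have ha := h2 ((hf.isRicciFlat_iff hI).1 hR)
    subst ha
    exact ⟨σ, b, I', hn, hI', hh⟩
  · obtain ⟨c₁, c₂, c₃, c₄, c₅, c₆, hf⟩ := (hform I F C hI).1 (hK.elim And.left And.left)
    obtain ⟨σ, a, b, hn, h, h1, -⟩ := hf.exists_normal_form hI
    obtain ⟨I', hI', hh⟩ := h.homothetic hI
    have hσ : σ = 0 := h1 <| by
      rcases hK with hK | hK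
      · rw [(hf.isKahlerEinstein_Jplus_iff hI).1 hK, mul_zero]
      · rw [(hf.isKahlerEinstein_Jminus_iff hI).1 hK, zero_mul]
    subst hσ
    exact ⟨a, b, I', hn, hI', hh⟩
  · obtain ⟨c₁, c₂, c₃, c₄, c₅, c₆, hf⟩ := (hform I F C hI).1 (U2.isRicciFlat_iff.1 hR).1
    obtain ⟨J, hJ⟩ := hJ
    obtain ⟨σ, a, b, hn, h, -, h2, h3⟩ := hf.exists_normal_form hI
    obtain ⟨k, hk⟩ := U2.exists_five_affRel hn (h2 ((hf.isRicciFlat_iff hI).1 hR))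
      (h3 (hf.eq_zero_of_isKahler hI hR hJ))
    obtain ⟨I', hI', hh⟩ := (h.trans hk).homothetic hI
    exact ⟨k, I', hI', hh⟩
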